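/- Let $M$ be a smooth manifold of dimension $m$ and let $(A,[\cdot,\cdot],\rho)$ be a (real) Lie algebroid of rank $n$ over $M$, with sections $\Gamma(A)$, Lie derivative $\mathcal L_X$ and differential $d$. For $\Lambda\in\Gamma(\wedge^2A)$ let $\Lambda^\sharp:A^*\to A$ be given by $\langle\theta,\Lambda^\sharp\xi\rangle=\Lambda(\xi,\theta)$, and put $$[\xi,\theta]_\Lambda=\mathcal L_{\Lambda^\sharp\xi}\theta-\mathcal L_{\Lambda^\sharp\theta}\xi-d(\Lambda(\xi,\theta)),\qquad \xi,\theta\in\Gamma(A^*).$$ For a bundle map $N$ of a bundle with bracket $[\cdot,\cdot]$ on its sections, put $[X,Y]_N=[NX,Y]+[X,NY]-N[X,Y]$. Suppose that $(A,N,\Lambda)$ is a Poisson–Nijenhuis Lie algebroid: $N:A\to A$ is a bundle map with $[NX,NY]=N[X,Y]_N$; $[\Lambda,\Lambda]=0$ for the Schouten bracket; $\Lambda^\sharp N^*=N\Lambda^\sharp$; and $[\xi,\theta]_{N\Lambda}=([\xi,\theta]_\Lambda)_{N^*}$ for all $\xi,\theta\in\Gamma(A^*)$, where $N\Lambda$ is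 the bivector with $(N\Lambda)^\sharp=N\Lambda^\sharp$. For $k,l\in\mathbb N=\{0,1,2,\dots\}$ let $A_l$ be the bundle $A$ with the bracket $[\cdot,\cdot]_{N^l}$ and the anchor $\rho N^l$, and let $A_k^*$ be the bundle $A^*$ with the bracket $[\cdot,\cdot]_{\Lambda_k}$ and the anchor $\rho\Lambda_k^\sharp$, where $\Lambda_k^\sharp=N^k\Lambda^\sharp$. Assume that the line bundle $\wedge^nA^*\otimes\wedge^mT^*M$ has a square root, i.e. let $L$ be a line bundle with an isomorphism $L\otimes L\cong\wedge^nA^*\otimes\wedge^mT^*M$. A section $\alpha$ of $A_k^*$ acts on $\wedge^nA^*\otimes\wedge^mT^*M$ by $$\alpha\cdot(\alpha_1\wedge\dots\wedge\alpha_n\otimes\mu)=\sum_i\alpha_1\wedge\dots\wedge[\alpha,\alpha_i]_{\Lambda_k}\wedge\dots\wedge\alpha_n\otimes\mu+\alpha_1\wedge\dots\wedge\alpha_n\otimes\mathcal L_{\rho\Lambda_k^\sharp\alpha}\mu ;$$ this makes $L$ an $A_k^*$-module (with $2\,l\,(\alpha\cdot l)=\alpha\cdot l^2$) and gives a differential $\breve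 d_*:\Gamma(\wedge^jA\otimes L)\to\Gamma(\wedge^{j+1}A\otimes L)$. In the same way $L'=\wedge^nA\otimes L$, a square root of $\wedge^nA\otimes\wedge^mT^*M$, is an $A_l$-module, with differential $d':\Gamma(\wedge^iA^*\otimes L')\to\Gamma(\wedge^{i+1}A^*\otimes L')$. Let $T:\wedge^jA\otimes L\to\wedge^{n-j}A^*\otimes L'$ be the isomorphism $(Ta)(X_1,\dots,X_{n-j})=X_1\wedge\dots\wedge X_{n-j}\wedge a$, and let $\breve\partial:\Gamma(\wedge^jA\otimes L)\to\Gamma(\wedge^{j-1}A\otimes L)$ be the operator with $d'(Ta)=(-1)^{n-j}\,T(\breve\partial a)$. Then these module structures and operators exist and are uniquely determined, and for all $k,l\in\mathbb N$ the operator $$Ð=\breve d_*+\breve\partial:\Gamma(\wedge A\otimes L)\to\Gamma(\wedge A\otimes L)$$ of the pair $(A_l,A_k^*)$ satisfies $Ð^2=0$. -/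

import Mathlib

open scoped Manifold ContDiff Bundle

noncomputable section

namespace PNDirac

/-! ## Algebroids, described on the modules of sections

`R` plays the role of `C^∞(M)`, an `R`-module `E` the role of the sections of a vector bundle,
`Module.Dual R E` that of the sections of the dual bundle, and `Derivation ℝ R R` that of the
vector fields on `M`. -/

section Algebra

variable {R : Type*} [CommRing R] [Algebra ℝ R]
variable {E : Type*} [AddCommGroup E] [Module R E]
variable {Q : Type*} [AddCommGroup Q] [Module R Q]

/-- A skew-symmetric bracket on sections with an anchor satisfying the Leibniz rule (a Lie
algebroid without the Jacobi identity). -/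
structure SkewAlgebroid (R : Type*) [CommRing R] [Algebra ℝ R]
    (E : Type*) [AddCommGroup E] [Module R E] where
  bracket : E → E → E
  anchor : E →ₗ[R] Derivation ℝ R R
  bracket_add : ∀ X Y Z, bracket X (Y + Z) = bracket X Y + bracket X Z
  bracket_skew : ∀ X Y, bracket X Y = -bracket Y X
  leibniz : ∀ (X : E) (f : R) (Y : E),
    bracket X (f • Y) = (anchor X f) • Y + f • bracket X Y

/-- A Lie algebroid. -/
structure LieAlgebroid (R : Type*) [CommRing R] [Algebra ℝ R]
    (E : Type*) [AddCommGroup E] [Module R E] extends SkewAlgebroid R E where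
  jacobi : ∀ X Y Z, bracket X (bracket Y Z) = bracket (bracket X Y) Z + bracket Y (bracket X Z)
  anchor_bracket : ∀ X Y, anchor (bracket X Y) = ⁅anchor X, anchor Y⁆

namespace SkewAlgebroid

variable (S : SkewAlgebroid R E)

theorem add_bracket (X Y Z : E) : S.bracket (X + Y) Z = S.bracket X Z + S.bracket Y Z := by
  rw [S.bracket_skew, S.bracket_add, S.bracket_skew X Z, S.bracket_skew Y Z]; abel

theorem smul_bracket (f : R) (X Y : E) :
    S.bracket (f • X) Y = f • S.bracket X Y - (S.anchor Y f) • X := by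
  rw [S.bracket_skew, S.leibniz, S.bracket_skew X Y, smul_neg]; abel

/-- The differential of a function, `⟨df, X⟩ = ρ(X) f`. -/
def dFun (f : R) : Module.Dual R E where
  toFun X := S.anchor X f
  map_add' X Y := by simp
  map_smul' g X := by simp

/-- The Lie derivative of a section of the dual,
`⟨ℒ_X θ, Y⟩ = ρ(X) ⟨θ, Y⟩ - ⟨θ, [X, Y]⟩`. -/
def lieDual (X : E) (θ : Module.Dual R E) : Module.Dual R E where
  toFun Y := S.anchor X (θ Y) - θ (S.bracket X Y)
  map_add' Y Z := by simp only [map_add, S.bracket_add]; abel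
  map_smul' f Y := by
    simp only [map_smul, S.leibniz, map_add, smul_eq_mul, Derivation.leibniz, RingHom.id_apply]
    ring

/-- The deformation along `N`: the bracket `[NX, Y] + [X, NY] - N[X, Y]` with anchor `ρ ∘ N`. -/
def deform (N : E →ₗ[R] E) : SkewAlgebroid R E where
  bracket X Y := S.bracket (N X) Y + S.bracket X (N Y) - N (S.bracket X Y)
  anchor := S.anchor ∘ₗ N
  bracket_add X Y Z := by simp only [map_add, S.bracket_add]; abel
  bracket_skew X Y := by
    rw [S.bracket_skew (N X) Y, S.bracket_skew X (N Y), S.bracket_skew X Y, map_neg]; abel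
  leibniz X f Y := by
    simp only [map_smul, map_add, S.leibniz, LinearMap.comp_apply, smul_sub, smul_add]; abel

/-- `N` is a Nijenhuis operator: its torsion vanishes. -/
def IsNijenhuis (N : E →ₗ[R] E) : Prop :=
  ∀ X Y, S.bracket (N X) (N Y) = N ((S.deform N).bracket X Y)

end SkewAlgebroid

/-- A bivector `Λ`, given by its skew-symmetric bundle map `Λ♯ : A* → A`,
with `Λ(ξ, θ) = ⟨θ, Λ♯ ξ⟩`. -/
@[ext]
structure Bivector (R : Type*) [CommRing R] (E : Type*) [AddCommGroup E] [Module R E] where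
  sharp : Module.Dual R E →ₗ[R] E
  skew : ∀ ξ θ : Module.Dual R E, θ (sharp ξ) = -ξ (sharp θ)

/-- The value `Λ(ξ, θ)`. -/
def Bivector.eval (Λ : Bivector R E) (ξ θ : Module.Dual R E) : R := θ (Λ.sharp ξ)

namespace SkewAlgebroid

variable (S : SkewAlgebroid R E)

/-- Half of the Schouten square `[Λ, Λ]` (up to sign), evaluated on three sections of the dual. -/
def halfSchouten (Λ : Bivector R E) (α β γ : Module.Dual R E) : R :=
  γ (S.bracket (Λ.sharp α) (Λ.sharp β)) + α (S.bracket (Λ.sharp β) (Λ.sharp γ))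
      + β (S.bracket (Λ.sharp γ) (Λ.sharp α))
    - (S.anchor (Λ.sharp α) (Λ.eval β γ) + S.anchor (Λ.sharp β) (Λ.eval γ α)
      + S.anchor (Λ.sharp γ) (Λ.eval α β))

/-- `Λ` is a Poisson bivector: `[Λ, Λ] = 0`. -/
def IsPoisson (Λ : Bivector R E) : Prop := ∀ α β γ, S.halfSchouten Λ α β γ = 0

/-- The structure induced on the dual by a bivector:
`[ξ, θ]_Λ = ℒ_{Λ♯ξ} θ - ℒ_{Λ♯θ} ξ - d(Λ(ξ, θ))`, with anchor `ρ ∘ Λ♯`. -/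
def dual (Λ : Bivector R E) : SkewAlgebroid R (Module.Dual R E) where
  bracket ξ θ := S.lieDual (Λ.sharp ξ) θ - S.lieDual (Λ.sharp θ) ξ - S.dFun (Λ.eval ξ θ)
  anchor := S.anchor ∘ₗ Λ.sharp
  bracket_add ξ θ η := by
    ext Y
    simp only [lieDual, dFun, Bivector.eval, map_add, LinearMap.sub_apply, LinearMap.add_apply,
      LinearMap.coe_mk, AddHom.coe_mk, S.add_bracket, Derivation.coe_add, Pi.add_apply]
    ring
  bracket_skew ξ θ := by
    ext Y
    have h := Λ.skew ξ θ
    simp only [lieDual, dFun, Bivector.eval, LinearMap.sub_apply, LinearMap.neg_apply,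
      LinearMap.coe_mk, AddHom.coe_mk, h, map_neg]
    ring
  leibniz ξ f θ := by
    ext Y
    have h := Λ.skew ξ θ
    simp only [lieDual, dFun, Bivector.eval, LinearMap.sub_apply, LinearMap.add_apply,
      LinearMap.smul_apply, LinearMap.coe_mk, AddHom.coe_mk, map_smul, S.smul_bracket,
      LinearMap.comp_apply, smul_eq_mul, Derivation.leibniz, map_sub, h, Derivation.coe_smul,
      Pi.smul_apply, map_neg]
    ring

end SkewAlgebroid

theorem sharp_pow_skew {R : Type*} [CommRing R] {E : Type*} [AddCommGroup E] [Module R E]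
    {N : E →ₗ[R] E} {Λ : Bivector R E}
    (h : Λ.sharp ∘ₗ N.dualMap = N ∘ₗ Λ.sharp) (k : ℕ) (ξ θ : Module.Dual R E) :
    θ ((N ^ k) (Λ.sharp ξ)) = -ξ ((N ^ k) (Λ.sharp θ)) := by
  have h1 : ∀ η, N (Λ.sharp η) = Λ.sharp (N.dualMap η) := fun η =>
    (LinearMap.congr_fun h η).symm
  induction k generalizing θ with
  | zero => simpa using Λ.skew ξ θ
  | succ k ih =>
    have e1 : θ ((N ^ (k + 1)) (Λ.sharp ξ)) = (N.dualMap θ) ((N ^ k) (Λ.sharp ξ)) := by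
      rw [pow_succ']; rfl
    have e2 : (N ^ (k + 1)) (Λ.sharp θ) = (N ^ k) (Λ.sharp (N.dualMap θ)) := by
      rw [pow_succ, ← h1]; rfl
    rw [e1, e2, ih]

/-- The bivector `Λ_k = N^k Λ`, with bundle map `N^k ∘ Λ♯`, for `Λ♯ N* = N Λ♯`. -/
def Bivector.iterate (Λ : Bivector R E) (N : E →ₗ[R] E)
    (h : Λ.sharp ∘ₗ N.dualMap = N ∘ₗ Λ.sharp) (k : ℕ) : Bivector R E where
  sharp := (N ^ k) ∘ₗ Λ.sharp
  skew := sharp_pow_skew h k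

/-- `(A, N, Λ)` is a Poisson–Nijenhuis Lie algebroid. The field `dual_bracket` is the
condition `[ξ, θ]_{NΛ} = ([ξ, θ]_Λ)_{N*}`. -/
structure IsPoissonNijenhuis (A : LieAlgebroid R E) (N : E →ₗ[R] E) (Λ : Bivector R E) :
    Prop where
  nijenhuis : A.IsNijenhuis N
  poisson : A.IsPoisson Λ
  sharp_comm : Λ.sharp ∘ₗ N.dualMap = N ∘ₗ Λ.sharp
  dual_bracket : ∀ ξ θ, (A.dual (Λ.iterate N sharp_comm 1)).bracket ξ θ =
    ((A.dual Λ).deform N.dualMap).bracket ξ θ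

/-! ## Modules over an algebroid and the associated differential -/

/-- A module over the algebroid `S`: a flat `S`-connection. -/
@[ext]
structure Representation (S : SkewAlgebroid R E)
    (Q : Type*) [AddCommGroup Q] [Module R Q] where
  act : E → Q → Q
  add_act : ∀ X Y l, act (X + Y) l = act X l + act Y l
  smul_act : ∀ (f : R) X l, act (f • X) l = f • act X l
  act_add : ∀ X l l', act X (l + l') = act X l + act X l'
  act_smul : ∀ X (f : R) l, act X (f • l) = f • act X l + (S.anchor X f) • l
  flat : ∀ X Y l, act (S.bracket X Y) l = act X (act Y l) - act Y (act X l)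

/-- The differential of a form with values in a module, as a function of the arguments:
`(dω)(x₀, …, x_p) = ∑ᵢ (-1)ⁱ xᵢ · ω(…, x̂ᵢ, …) + ∑_{i<j} (-1)^{i+j} ω([xᵢ, xⱼ], …, x̂ᵢ, …, x̂ⱼ, …)`.
In the second sum the bracket is put in the slot of `xⱼ`, the sign is adapted, and
the sum is extended to all ordered pairs `i ≠ j`, which counts every unordered pair twice. -/
def diffFun (S : SkewAlgebroid R E) (ρ : Representation S Q) {p : ℕ} (w : (Fin p → E) → Q)
    (x : Fin (p + 1) → E) : Q :=
  ∑ i : Fin (p + 1), (-1 : ℤ) ^ (i : ℕ) •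
    (ρ.act (x i) (w (i.removeNth x)) -
      algebraMap ℝ R (1 / 2) • ∑ j : Fin p,
        w (Function.update (i.removeNth x) j (S.bracket (x i) (i.removeNth x j))))

/-- The terms `∑ⱼ w(…, [X, yⱼ], …)` form an alternating map of `y`. -/
def bracketInsert (S : SkewAlgebroid R E) {p : ℕ} (w : E [⋀^Fin p]→ₗ[R] Q) (X : E) :
    E [⋀^Fin p]→ₗ[ℤ] Q where
  toFun y := ∑ j : Fin p, w (Function.update y j (S.bracket X (y j)))
  map_update_add' := by
    intro inst y i a b
    obtain rfl : inst = instDecidableEqFin p := Subsingleton.elim _ _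
    rw [← Finset.sum_add_distrib]
    refine Finset.sum_congr rfl fun j _ => ?_
    by_cases h : j = i
    · subst h; simp [S.bracket_add]
    · simp only [Function.update_of_ne h, Function.update_comm (Ne.symm h)]
      exact w.map_update_add _ _ _ _
  map_update_smul' := by
    intro inst y i c a
    obtain rfl : inst = instDecidableEqFin p := Subsingleton.elim _ _
    rw [Finset.smul_sum]
    refine Finset.sum_congr rfl fun j _ => ?_
    have hz : S.bracket X (c • a) = c • S.bracket X a :=
      map_zsmul (AddMonoidHom.mk' (S.bracket X) (S.bracket_add X)) c a
    by_cases h : j = i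
    · subst h
      simp only [Function.update_self, Function.update_idem, hz]
      rw [← Int.cast_smul_eq_zsmul R c, w.map_update_smul, Int.cast_smul_eq_zsmul]
    · simp only [Function.update_of_ne h, Function.update_comm (Ne.symm h)]
      rw [← Int.cast_smul_eq_zsmul R c, w.map_update_smul, Int.cast_smul_eq_zsmul]
  map_eq_zero_of_eq' := by
    intro y a b hab hne
    show ∑ j : Fin p, w (Function.update y j (S.bracket X (y j))) = 0
    rw [← Finset.add_sum_erase _ _ (Finset.mem_univ a),
      ← Finset.add_sum_erase _ _ (Finset.mem_erase.2 ⟨hne.symm, Finset.mem_univ b⟩),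
      Finset.sum_eq_zero, add_zero]
    · rw [hab]
      have : Function.update y b (S.bracket X (y b)) =
          (Function.update y a (S.bracket X (y b))) ∘ Equiv.swap a b := by
        ext c
        by_cases hca : c = a
        · subst hca; simp [Function.update_of_ne hne, Function.update_of_ne hne.symm, hab]
        · by_cases hcb : c = b
          · subst hcb; simp
          · simp [Function.update_of_ne hca, Function.update_of_ne hcb,
              Equiv.swap_apply_of_ne_of_ne hca hcb]
      rw [this, w.map_swap _ hne, add_neg_cancel]
    · intro j hj
      simp only [Finset.mem_erase] at hj
      exact w.map_eq_zero_of_eq _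
        (by simp [Function.update_of_ne hj.2.1.symm, Function.update_of_ne hj.1.symm, hab]) hne

/-- `X ↦ (y ↦ X · w(y) - ½ ∑ⱼ w(…, [X, yⱼ], …))`. -/
def diffAux (S : SkewAlgebroid R E) (ρ : Representation S Q) {p : ℕ} (w : E [⋀^Fin p]→ₗ[R] Q) :
    E →ₗ[ℤ] E [⋀^Fin p]→ₗ[ℤ] Q :=
  (AddMonoidHom.mk' (fun X =>
    ((AddMonoidHom.mk' (ρ.act X) (ρ.act_add X)).toIntLinearMap.compAlternatingMap
        { w.toMultilinearMap.restrictScalars ℤ with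
          map_eq_zero_of_eq' := w.map_eq_zero_of_eq' } -
      (DistribSMul.toAddMonoidHom Q (algebraMap ℝ R (1 / 2))).toIntLinearMap.compAlternatingMap
        (bracketInsert S w X)))
    (fun X Y => by
      ext y
      have : ∑ j : Fin p, w (Function.update y j (S.bracket (X + Y) (y j))) =
          ∑ j : Fin p, w (Function.update y j (S.bracket X (y j))) +
          ∑ j : Fin p, w (Function.update y j (S.bracket Y (y j))) := by
        rw [← Finset.sum_add_distrib]
        refine Finset.sum_congr rfl fun j _ => ?_
        rw [S.add_bracket, w.map_update_add]
      show ρ.act (X + Y) (w y) - algebraMap ℝ R (1 / 2) • (∑ j : Fin p, _) =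
        (ρ.act X (w y) - algebraMap ℝ R (1 / 2) • (∑ j : Fin p, _)) +
        (ρ.act Y (w y) - algebraMap ℝ R (1 / 2) • (∑ j : Fin p, _))
      rw [this, ρ.add_act, smul_add]; abel)).toIntLinearMap

theorem diffAux_apply (S : SkewAlgebroid R E) (ρ : Representation S Q) {p : ℕ}
    (w : E [⋀^Fin p]→ₗ[R] Q) (x : Fin (p + 1) → E) :
    AlternatingMap.alternatizeUncurryFin (diffAux S ρ w) x = diffFun S ρ w x := by
  rw [AlternatingMap.alternatizeUncurryFin_apply]; rfl

theorem diffFun_cons_smul (S : SkewAlgebroid R E) (ρ : Representation S Q) {p : ℕ}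
    (w : E [⋀^Fin p]→ₗ[R] Q) (f : R) (a : E) (y : Fin p → E) :
    diffFun S ρ w (Fin.cons (f • a) y : Fin (p + 1) → E) =
      f • diffFun S ρ w (Fin.cons a y : Fin (p + 1) → E) := by
  have hhalf : ∀ q : Q, algebraMap ℝ R (1 / 2) • q + algebraMap ℝ R (1 / 2) • q = q := by
    intro q
    rw [← add_smul, ← map_add]; norm_num
  cases p with
  | zero => simp [diffFun, ρ.smul_act]
  | succ p =>
    have hw : ∀ (g : R) (v : E) (z : Fin p → E),
        w (Fin.cons (g • v) z : Fin (p + 1) → E) = g • w (Fin.cons v z : Fin (p + 1) → E) := by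
      intro g v z
      have := w.map_update_smul (Fin.cons v z : Fin (p + 1) → E) 0 g v
      simpa only [Fin.update_cons_zero] using this
    have hwa : ∀ (u v : E) (z : Fin p → E), w (Fin.cons (u + v) z : Fin (p + 1) → E) =
        w (Fin.cons u z : Fin (p + 1) → E) + w (Fin.cons v z : Fin (p + 1) → E) := by
      intro u v z
      have := w.map_update_add (Fin.cons v z : Fin (p + 1) → E) 0 u v
      simpa only [Fin.update_cons_zero] using this
    have hins : ∀ t : Fin (p + 1), w (Function.update y t a) =
        (-1 : ℤ) ^ (t : ℕ) • w (Fin.cons a (t.removeNth y) : Fin (p + 1) → E) := by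
      intro t
      rw [← Fin.insertNth_removeNth, w.map_insertNth]
      rfl
    have hrem : ∀ (v : E) (t : Fin (p + 1)),
        (t.succ).removeNth (Fin.cons v y : Fin (p + 2) → E) = Fin.cons v (t.removeNth y) := by
      intro v t
      funext c
      refine Fin.cases ?_ (fun c => ?_) c <;> simp [Fin.removeNth]
    have hexp : ∀ v : E, diffFun S ρ w (Fin.cons v y : Fin (p + 2) → E) =
        (ρ.act v (w y) - algebraMap ℝ R (1 / 2) •
          ∑ j, w (Function.update y j (S.bracket v (y j)))) +
        ∑ t : Fin (p + 1), (-1 : ℤ) ^ ((t : ℕ) + 1) •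
          (ρ.act (y t) (w (Fin.cons v (t.removeNth y) : Fin (p + 1) → E)) -
            algebraMap ℝ R (1 / 2) • (w (Fin.cons (S.bracket (y t) v) (t.removeNth y) :
                Fin (p + 1) → E) +
              ∑ j : Fin p, w (Fin.cons v (Function.update (t.removeNth y) j
                (S.bracket (y t) (t.removeNth y j))) : Fin (p + 1) → E))) := by
      intro v
      rw [diffFun, Fin.sum_univ_succ]
      congr 1
      · simp
      · refine Finset.sum_congr rfl fun t _ => ?_
        rw [hrem, Fin.sum_univ_succ]
        simp only [Fin.cons_succ, Fin.val_succ, Fin.cons_zero, Fin.update_cons_zero,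
          Fin.cons_update]
    rw [hexp, hexp, smul_add]
    have h0 : (ρ.act (f • a) (w y) - algebraMap ℝ R (1 / 2) •
          ∑ j, w (Function.update y j (S.bracket (f • a) (y j)))) =
        f • (ρ.act a (w y) - algebraMap ℝ R (1 / 2) •
          ∑ j, w (Function.update y j (S.bracket a (y j)))) +
        ∑ t : Fin (p + 1), (-1 : ℤ) ^ (t : ℕ) • algebraMap ℝ R (1 / 2) • (S.anchor (y t) f) •
          w (Fin.cons a (t.removeNth y) : Fin (p + 1) → E) := by
      have : ∀ j, w (Function.update y j (S.bracket (f • a) (y j))) =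
          f • w (Function.update y j (S.bracket a (y j))) -
            (-1 : ℤ) ^ (j : ℕ) • (S.anchor (y j) f) •
              w (Fin.cons a (j.removeNth y) : Fin (p + 1) → E) := by
        intro j
        rw [S.smul_bracket, w.map_update_sub, w.map_update_smul, w.map_update_smul, hins,
          smul_comm]
      simp only [this, Finset.sum_sub_distrib, ρ.smul_act, smul_sub, ← Finset.smul_sum]
      rw [smul_comm f (algebraMap ℝ R (1 / 2))]
      simp only [Finset.smul_sum, smul_comm (algebraMap ℝ R (1 / 2)) ((-1 : ℤ) ^ _)]
      abel
    rw [h0, add_assoc]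
    congr 1
    rw [Finset.smul_sum, ← Finset.sum_add_distrib]
    refine Finset.sum_congr rfl fun t _ => ?_
    rw [hw, ρ.act_smul, S.leibniz, hwa, hw, hw]
    simp only [hw, ← Finset.smul_sum]
    rw [pow_succ, mul_neg_one, neg_smul, neg_smul, smul_neg, smul_comm f ((-1 : ℤ) ^ (t : ℕ)),
      ← sub_eq_add_neg, ← smul_sub, ← smul_neg]
    congr 1
    have := hhalf ((S.anchor (y t) f) • w (Fin.cons a (t.removeNth y) : Fin (p + 1) → E))
    simp only [smul_add, smul_sub, smul_comm f (algebraMap ℝ R (1 / 2))]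
    generalize (S.anchor (y t) f) • w (Fin.cons a (t.removeNth y) : Fin (p + 1) → E) = G at this ⊢
    generalize algebraMap ℝ R (1 / 2) • G = H at this ⊢
    subst this
    abel

/-- The differential of the algebroid `S` on forms with values in the module `Q`. -/
def diff (S : SkewAlgebroid R E) (ρ : Representation S Q) {p : ℕ} (w : E [⋀^Fin p]→ₗ[R] Q) :
    E [⋀^Fin (p + 1)]→ₗ[R] Q where
  toFun := diffFun S ρ w
  map_update_add' := by
    intro inst x i a b
    obtain rfl : inst = instDecidableEqFin (p + 1) := Subsingleton.elim _ _
    simp only [← diffAux_apply]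
    exact AlternatingMap.map_update_add _ _ _ _ _
  map_update_smul' := by
    intro inst x i f a
    obtain rfl : inst = instDecidableEqFin (p + 1) := Subsingleton.elim _ _
    have h0 : ∀ (z : Fin (p + 1) → E), diffFun S ρ w (Function.update z 0 (f • a)) =
        f • diffFun S ρ w (Function.update z 0 a) := by
      intro z
      have hz : ∀ v, Function.update z 0 v = Fin.cons v (Fin.tail z) := by
        intro v
        rw [← Fin.cons_self_tail z, Fin.update_cons_zero, Fin.tail_cons]
      rw [hz, hz, diffFun_cons_smul]
    by_cases hi : i = 0
    · subst hi; exact h0 x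
    · have hs : ∀ v, diffFun S ρ w (Function.update x i v) =
          -diffFun S ρ w (Function.update (x ∘ Equiv.swap 0 i) 0 v) := by
        intro v
        rw [← diffAux_apply, ← diffAux_apply, ← AlternatingMap.map_swap _ _ (Ne.symm hi)]
        congr 1
        funext c
        by_cases hc : c = i
        · subst hc; simp
        · by_cases hc0 : c = 0
          · subst hc0; simp [Function.update_of_ne hc, Function.update_of_ne hi]
          · simp [Function.update_of_ne hc, Equiv.swap_apply_of_ne_of_ne hc0 hc,
              Function.update_of_ne hc0]
      rw [hs, hs, h0, smul_neg]
  map_eq_zero_of_eq' := by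
    intro x i j hij hne
    show diffFun S ρ w x = 0
    rw [← diffAux_apply]
    exact AlternatingMap.map_eq_zero_of_eq _ _ hij hne

/-! ## The modules of densities and their square roots -/

variable (R) in
/-- For `E` the sections of a vector bundle `B` of rank `n` over a manifold of dimension `m`:
the sections of `∧ⁿ B ⊗ ∧ᵐ T*M`. -/
abbrev Density (E : Type*) [AddCommGroup E] [Module R E] (n m : ℕ) : Type _ :=
  (Module.Dual R E) [⋀^Fin n]→ₗ[R] ((Derivation ℝ R R) [⋀^Fin m]→ₗ[R] R)

/-- The action of `X` on `∧ⁿ B ⊗ ∧ᵐ T*M`, by the derivation extending `[X, ·]` on the first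
factor and by the Lie derivative along the anchor of `X` on the second one. It is written
through its values on sections `φᵢ` of the dual of `B` and vector fields `vⱼ`. -/
def densityAct (S : SkewAlgebroid R E) {n m : ℕ} (X : E) (κ : Density R E n m)
    (φ : Fin n → Module.Dual R E) (v : Fin m → Derivation ℝ R R) : R :=
  S.anchor X (κ φ v)
    - ∑ i, κ (Function.update φ i (S.lieDual X (φ i))) v
    - ∑ j, κ φ (Function.update v j ⁅S.anchor X, v j⁆)

/-- The module structure `ρ` on `Q` is the square root, along the product
`q : Q ⊗ Q → ∧ⁿ B ⊗ ∧ᵐ T*M`, of the natural one on the target. -/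
def IsRootOf (S : SkewAlgebroid R E) {n m : ℕ} (q : Q →ₗ[R] Q →ₗ[R] Density R E n m)
    (ρ : Representation S Q) : Prop :=
  ∀ X l l' φ v, q (ρ.act X l) l' φ v + q l (ρ.act X l') φ v = densityAct S X (q l l') φ v

/-! ## The operator -/

/-- The sections of `∧ʲ A ⊗ L`, where `E` and `P` are the sections of `A` and `L`. -/
abbrev Spinor (R : Type*) [CommRing R] (E : Type*) [AddCommGroup E] [Module R E]
    (P : Type*) [AddCommGroup P] [Module R P] (j : ℕ) : Type _ :=
  (Module.Dual R E) [⋀^Fin j]→ₗ[R] P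

variable {P : Type*} [AddCommGroup P] [Module R P]

/-- `X ∧ a`, that is
`(X ∧ a)(β₀, …, βⱼ) = ∑ᵢ (-1)ⁱ ⟨βᵢ, X⟩ a(…, β̂ᵢ, …)`. -/
def wedge {j : ℕ} (X : E) (a : Spinor R E P j) : Spinor R E P (j + 1) :=
  AlternatingMap.alternatizeUncurryFin ((Module.Dual.eval R E X).smulRight a)

/-- `X₁ ∧ ⋯ ∧ X_k ∧ a`. -/
def wedges {j : ℕ} (a : Spinor R E P j) : (k : ℕ) → (Fin k → E) → Spinor R E P (j + k)
  | 0, _ => a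
  | k + 1, X => wedge (X 0) (wedges a k (Fin.tail X))

/-- For `j + k = n` the rank of `A`: the isomorphism `∧ʲ A ⊗ L ≅ ∧ᵏ A* ⊗ (∧ⁿ A ⊗ L)`, which sends
`a` to the `k`-form `(X₁, …, X_k) ↦ X₁ ∧ ⋯ ∧ X_k ∧ a` on `A`. -/
def star {n j k : ℕ} (h : j + k = n) (a : Spinor R E P j) (X : Fin k → E) : Spinor R E P n :=
  (wedges a k X).domDomCongr (finCongr h)

/-- The operators attached to algebroid structures `S` on `A` and `T` on `A*`, where `A` has
rank `n`, `M` has dimension `m`, `E` and `P` are the sections of `A` and of a line bundle `L`,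
and `q : L ⊗ L ≅ ∧ⁿ A* ⊗ ∧ᵐ T*M`. All fields are determined by their defining properties. -/
@[ext]
structure DiracData {n m : ℕ} (S : SkewAlgebroid R E) (T : SkewAlgebroid R (Module.Dual R E))
    (q : P →ₗ[R] P →ₗ[R] Density R (Module.Dual R E) n m) where
  /-- the `A*`-module structure of `L = (∧ⁿ A* ⊗ ∧ᵐ T*M)^{1/2}` -/
  repL : Representation T P
  repL_root : IsRootOf T q repL
  /-- the product which makes `L' = ∧ⁿ A ⊗ L` the square root of `∧ⁿ A ⊗ ∧ᵐ T*M`, namely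
  `(V ⊗ l)(V' ⊗ l') = V ⊗ ⟨V', l l'⟩`; recall that `V'(γ) ω(X) = ⟨V', ω⟩ det ⟨γᵢ, Xⱼ⟩`
  for `V'` in `∧ⁿ A` and `ω` in `∧ⁿ A*` -/
  q' : Spinor R E P n →ₗ[R] Spinor R E P n →ₗ[R] Density R E n m
  q'_spec : ∀ Φ Ψ (β γ : Fin n → Module.Dual R E) (X : Fin n → E) v,
    Matrix.det (Matrix.of fun i j => γ i (X j)) * q' Φ Ψ β v =
      q (Φ β) (Ψ γ) (fun i => Module.Dual.eval R E (X i)) v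
  /-- the `A`-module structure of `L' = (∧ⁿ A ⊗ ∧ᵐ T*M)^{1/2}` -/
  repL' : Representation S (Spinor R E P n)
  repL'_root : IsRootOf S q' repL'
  /-- the operator of degree `-1` on the sections of `∧ A ⊗ L` which corresponds, under the
  isomorphisms `star`, to the differential of `A` on the sections of `∧ A* ⊗ L'` -/
  del : (j : ℕ) → Spinor R E P (j + 1) →+ Spinor R E P j
  del_spec : ∀ (j k : ℕ) (h : (j + 1) + k = n) (h' : j + (k + 1) = n) (a : Spinor R E P (j + 1))
    (X : Fin (k + 1) → E),
    diffFun S repL' (star h a) X = (-1 : ℤ) ^ k • star h' (del j a) X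

/-- The operator `Ð` on the sections `(ωⱼ)ⱼ` of `∧ A ⊗ L`, the sum of the differential of `A*` with
values in `L` (of degree `1`) and of `del` (of degree `-1`). -/
def DiracData.dirac {n m : ℕ} {S : SkewAlgebroid R E} {T : SkewAlgebroid R (Module.Dual R E)}
    {q : P →ₗ[R] P →ₗ[R] Density R (Module.Dual R E) n m} (D : DiracData S T q)
    (w : (j : ℕ) → Spinor R E P j) : (j : ℕ) → Spinor R E P j
  | 0 => D.del 0 (w 1)
  | j + 1 => diff T D.repL (w j) + D.del (j + 1) (w (j + 2))

end Algebra

/-! ## Smooth sections form a module over smooth functions -/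

section Geometry

variable {m : ℕ} {M : Type*} [TopologicalSpace M] [ChartedSpace (EuclideanSpace ℝ (Fin m)) M]
  {F : Type*} [NormedAddCommGroup F] [NormedSpace ℝ F]
  {V : M → Type*} [∀ x, AddCommGroup (V x)] [∀ x, Module ℝ (V x)]
  [∀ x, TopologicalSpace (V x)] [TopologicalSpace (Bundle.TotalSpace F V)] [FiberBundle F V]
  [VectorBundle ℝ F V]

instance : SMul C^∞⟮𝓡 m, M; ℝ⟯ Cₛ^∞⟮𝓡 m; F, V⟯ :=
  ⟨fun f s => ⟨fun x => f x • s x, f.contMDiff.smul_section s.contMDiff⟩⟩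

theorem section_smul_apply (f : C^∞⟮𝓡 m, M; ℝ⟯) (s : Cₛ^∞⟮𝓡 m; F, V⟯) (x : M) :
    (f • s) x = f x • s x := rfl

instance : Module C^∞⟮𝓡 m, M; ℝ⟯ Cₛ^∞⟮𝓡 m; F, V⟯ where
  one_smul s := by ext x; exact one_smul ℝ (s x)
  mul_smul f g s := by ext x; exact mul_smul (f x) (g x) (s x)
  smul_zero f := by ext x; exact smul_zero (f x)
  smul_add f s t := by ext x; exact smul_add (f x) (s x) (t x)
  add_smul f g s := by ext x; exact add_smul (f x) (g x) (s x)
  zero_smul s := by ext x; exact zero_smul ℝ (s x)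

/-- `q` is an isomorphism of line bundles `L ⊗ L ≅ ∧ⁿ A* ⊗ ∧ᵐ T*M`, i.e. fibrewise non-zero. -/
def IsSquareRoot {E : Type*} [AddCommGroup E] [Module C^∞⟮𝓡 m, M; ℝ⟯ E] {n : ℕ}
    (q : Cₛ^∞⟮𝓡 m; F, V⟯ →ₗ[C^∞⟮𝓡 m, M; ℝ⟯] Cₛ^∞⟮𝓡 m; F, V⟯ →ₗ[C^∞⟮𝓡 m, M; ℝ⟯]
      Density C^∞⟮𝓡 m, M; ℝ⟯ E n m) : Prop :=
  ∀ (l : Cₛ^∞⟮𝓡 m; F, V⟯) (x : M), l x ≠ 0 → ∃ φ v, (q l l φ v) x ≠ 0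

end Geometry

end PNDirac

end

/-! Write d_j for the differential of A_j^* with values in L, B for the operator of degree -1 of
A_l, and D for the one of A itself, so that Ð = d_k + B. For Lie algebroids d_k² = 0, B² = 0 and D²
= 0, hence everything rests on d_k B + B d_k = 0. Let Λ_j also denote exterior multiplication by the
bivector Λ_j. Three facts are combined.

(1) d_j = [Λ_j, D] (`dForm_dual_eq`). This needs no Poisson condition beyond the existence of the
module structures. Cartan's formula, transported to multivectors, says that D(X ∧ ·) + X ∧ D(·) is a
Lie derivative (`IsDiv.wedge_eq_lie`). Therefore both sides have the same anticommutator with X ∧ ·,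
and it suffices to compare them on L, in degree zero. There each side gives a square root of the
same action on densities (`bivAct_root`, a trace computation), and square roots are unique
(`IsRoot.unique`).

(2) The structure induced by Λ_k on the dual of A_l is A_{k+l}^* (`IsPoissonNijenhuis.deform_dual`).
Applying (1) to A and to A_l gives d_{k+l} = [Λ_{k+l}, D] = [Λ_k, B].

(3) DB + BD = 0 (`IsDiv.anticomm`): the operator 1 + N^l is again Nijenhuis, the differential of A
deformed along it is the sum of those of A and A_l, and it squares to zero.

Now D² = 0 makes [Λ_{k+l}, D] anticommute with D. Replacing it by [Λ_k, B] and using DB = -BD, this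
becomes the anticommutation of [Λ_k, D] = d_k with B.

Identities between operators are proved by induction on the degree instead of explicit formulas: an
operator commuting up to sign with all contractions, or with all X ∧ ·, is determined by its lowest
degree (`eq_zero_of_contr`, `eq_zero_of_wedgeOp`). Bundles enter only through modules of sections
with point evaluations `pt`. Local statements are multiplied by a function χ with χ(x) ≠ 0 which
clears denominators; `Separated`, `Glueable` and `LocallyFree` replace the sheaf axioms and local
triviality. The operators themselves are constructed by solving locally and gluing unique solutions
(`exists_of_local`), notably for square roots (`IsRoot.exists_root`) and for the inverse of T
(`star_surjective`). -/

set_option linter.unusedSectionVars false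

noncomputable section

namespace PNDirac

/-! ## Graded operators on forms -/

section Forms

variable {R : Type*} [CommRing R] [Algebra ℝ R]
variable {V : Type*} [AddCommGroup V] [Module R V]
variable {W : Type*} [AddCommGroup W] [Module R W]

/-- Families of alternating forms on `V` with values in `W`, one in each degree. -/
abbrev Forms (R : Type*) [CommRing R] (V : Type*) [AddCommGroup V] [Module R V]
    (W : Type*) [AddCommGroup W] [Module R W] : Type _ :=
  (j : ℕ) → V [⋀^Fin j]→ₗ[R] W

/-- Contraction with a vector. -/
def contr (v : V) : Forms R V W →ₗ[R] Forms R V W where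
  toFun w j := (w (j + 1)).curryLeft v
  map_add' _ _ := rfl
  map_smul' _ _ := rfl

theorem contr_apply (v : V) (w : Forms R V W) (j : ℕ) (y : Fin j → V) :
    contr v w j y = w (j + 1) (Fin.cons v y) := rfl

theorem alt_sum_apply {ι : Type*} (s : Finset ι) {p : ℕ} (κ : ι → V [⋀^Fin p]→ₗ[R] W)
    (y : Fin p → V) : (∑ i ∈ s, κ i) y = ∑ i ∈ s, κ i y :=
  map_sum (AddMonoidHom.mk' (fun u : V [⋀^Fin p]→ₗ[R] W => u y) fun _ _ => rfl) κ s

theorem forms_ext {w w' : Forms R V W} (h0 : w 0 = w' 0) (h : ∀ v, contr v w = contr v w') :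
    w = w' := by
  funext j
  cases j with
  | zero => exact h0
  | succ j =>
    ext y
    have := congrArg (fun u : Forms R V W => u j (Fin.tail y)) (h (y 0))
    simpa only [contr_apply, Fin.cons_self_tail] using this

/-- An operator raising degrees which commutes up to sign with all contractions vanishes. -/
theorem eq_zero_of_contr (O : Forms R V W → Forms R V W) (s : ℤ) (h0 : ∀ w, O w 0 = 0)
    (h : ∀ v w, contr v (O w) = s • O (contr v w)) (w : Forms R V W) : O w = 0 := by
  funext j
  induction j generalizing w with
  | zero => exact h0 w
  | succ j ih =>
    ext y
    have := congrArg (fun u : Forms R V W => u j (Fin.tail y)) (h (y 0) w)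
    simp only [contr_apply, Fin.cons_self_tail] at this
    rw [this, Pi.smul_apply, ih]
    simp

theorem removeNth_succ_cons {p : ℕ} (v : V) (y : Fin (p + 1) → V) (t : Fin (p + 1)) :
    (t.succ).removeNth (Fin.cons v y : Fin (p + 2) → V) = Fin.cons v (t.removeNth y) := by
  funext c
  refine Fin.cases ?_ (fun c => ?_) c <;> simp [Fin.removeNth]

theorem removeNth_zero_cons {p : ℕ} (v : V) (y : Fin p → V) :
    (0 : Fin (p + 1)).removeNth (Fin.cons v y : Fin (p + 1) → V) = y := by
  funext c
  simp [Fin.removeNth]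

/-- The operator attached to `F`, `y ↦ ∑ᵢ (-1)ⁱ F(yᵢ)(…, ŷᵢ, …)`. -/
def altSum (F : V →ₗ[R] Forms R V W) : Forms R V W
  | 0 => 0
  | j + 1 => AlternatingMap.alternatizeUncurryFin (LinearMap.proj j ∘ₗ F)

theorem altSum_succ_apply (F : V →ₗ[R] Forms R V W) (j : ℕ) (y : Fin (j + 1) → V) :
    altSum F (j + 1) y = ∑ i : Fin (j + 1), (-1 : ℤ) ^ (i : ℕ) • F (y i) j (i.removeNth y) := by
  simp only [altSum, AlternatingMap.alternatizeUncurryFin_apply]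
  rfl

/-- The summand with index 0 yields `F v`; in all the others the index shifts by one, which flips
the sign. -/
theorem contr_altSum (F G : V →ₗ[R] Forms R V W) (v : V) (h : ∀ u, G u = contr v (F u)) :
    contr v (altSum F) = F v - altSum G := by
  funext j
  ext y
  rw [contr_apply, altSum_succ_apply, Fin.sum_univ_succ]
  simp only [removeNth_zero_cons, Fin.cons_zero, Fin.val_zero, pow_zero, one_smul, Pi.sub_apply]
  rw [AlternatingMap.sub_apply, sub_eq_add_neg]
  congr 1
  cases j with
  | zero => simp [altSum]
  | succ j =>
    rw [altSum_succ_apply, ← Finset.sum_neg_distrib]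
    refine Finset.sum_congr rfl fun t _ => ?_
    rw [removeNth_succ_cons, Fin.cons_succ, h, contr_apply, Fin.val_succ, pow_succ, mul_neg_one,
      neg_smul]

theorem altSum_add (F G : V →ₗ[R] Forms R V W) : altSum (F + G) = altSum F + altSum G := by
  funext j
  cases j with
  | zero => simp [altSum]
  | succ j => ext y; simp [altSum_succ_apply, Finset.sum_add_distrib]

theorem altSum_smul (f : R) (F : V →ₗ[R] Forms R V W) : altSum (f • F) = f • altSum F := by
  funext j
  cases j with
  | zero => simp [altSum]
  | succ j => ext y; simp [altSum_succ_apply, Finset.smul_sum, smul_comm f]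

/-- Exterior multiplication by a linear form. -/
def extMul (η : Module.Dual R V) : Forms R V W →ₗ[R] Forms R V W where
  toFun w := altSum (η.smulRight w)
  map_add' w w' := by
    rw [← altSum_add]; congr 1; ext u; simp
  map_smul' f w := by
    simp only [RingHom.id_apply]
    rw [← altSum_smul]; congr 1; ext u; simp [smul_comm f]

theorem extMul_def (η : Module.Dual R V) (w : Forms R V W) :
    extMul η w = altSum (η.smulRight w) := rfl

theorem extMul_zero_apply (η : Module.Dual R V) (w : Forms R V W) : extMul η w 0 = 0 := rfl

theorem contr_extMul (η : Module.Dual R V) (v : V) (w : Forms R V W) :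
    contr v (extMul η w) = η v • w - extMul η (contr v w) := by
  rw [extMul_def, extMul_def, contr_altSum _ (η.smulRight (contr v w))]
  · simp
  · intro u; simp

theorem add_extMul (η η' : Module.Dual R V) (w : Forms R V W) :
    extMul (η + η') w = extMul η w + extMul η' w := by
  simp only [extMul_def, ← altSum_add]
  congr 1
  ext u; simp [add_smul]

theorem smul_extMul (f : R) (η : Module.Dual R V) (w : Forms R V W) :
    extMul (f • η) w = f • extMul η w := by
  simp only [extMul_def, ← altSum_smul]
  congr 1
  ext u; simp [mul_smul]

/-- Contracting the anticommutator with v produces the terms η(v) θ ∧ w and θ(v) η ∧ w twice with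
opposite signs, so it commutes with contractions and vanishes in degree zero. -/
theorem extMul_extMul (η θ : Module.Dual R V) (w : Forms R V W) :
    extMul η (extMul θ w) = -extMul θ (extMul η w) := by
  rw [← add_eq_zero_iff_eq_neg]
  refine eq_zero_of_contr (fun w => extMul η (extMul θ w) + extMul θ (extMul η w)) 1
    (fun w => by simp [extMul_zero_apply]) (fun v w => ?_) w
  simp only [map_add, contr_extMul, map_sub, map_smul, one_smul]
  abel

theorem extMul_self (η : Module.Dual R V) (w : Forms R V W) : extMul η (extMul η w) = 0 := by
  have h := extMul_extMul η η w
  have h2 : (algebraMap ℝ R (1 / 2) + algebraMap ℝ R (1 / 2)) • extMul η (extMul η w) =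
      extMul η (extMul η w) := by
    rw [← map_add]; norm_num
  rw [← h2, add_smul]
  nth_rw 2 [h]
  simp

/-! ### Lie derivatives -/

/-- Derivative endomorphisms of `V` and `W` with the same symbol. -/
structure DerPair (R : Type*) [CommRing R] [Algebra ℝ R] (V : Type*) [AddCommGroup V] [Module R V]
    (W : Type*) [AddCommGroup W] [Module R W] where
  sym : Derivation ℝ R R
  onV : V →+ V
  onW : W →+ W
  onV_smul : ∀ (f : R) v, onV (f • v) = f • onV v + sym f • v
  onW_smul : ∀ (f : R) v, onW (f • v) = f • onW v + sym f • v

/-- The derivative `y ↦ δ(κ(y)) - ∑ᵢ κ(…, δyᵢ, …)` of an alternating map. -/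
def DerPair.lieAlt (δ : DerPair R V W) {p : ℕ} (κ : V [⋀^Fin p]→ₗ[R] W) : V [⋀^Fin p]→ₗ[R] W where
  toFun y := δ.onW (κ y) - ∑ i : Fin p, κ (Function.update y i (δ.onV (y i)))
  map_update_add' := by
    intro inst y i a b
    obtain rfl : inst = instDecidableEqFin p := Subsingleton.elim _ _
    rw [κ.map_update_add, map_add, sub_add_sub_comm, ← Finset.sum_add_distrib]
    congr 1
    refine Finset.sum_congr rfl fun j _ => ?_
    by_cases h : j = i
    · subst h; simp
    · simp only [Function.update_of_ne h, Function.update_comm (Ne.symm h)]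
      exact κ.map_update_add _ _ _ _
  map_update_smul' := by
    intro inst y i c a
    obtain rfl : inst = instDecidableEqFin p := Subsingleton.elim _ _
    have hs : ∑ j, κ (Function.update (Function.update y i (c • a)) j
          (δ.onV (Function.update y i (c • a) j))) =
        c • ∑ j, κ (Function.update (Function.update y i a) j (δ.onV (Function.update y i a j)))
          + δ.sym c • κ (Function.update y i a) := by
      rw [Finset.smul_sum, ← Finset.add_sum_erase _ _ (Finset.mem_univ i),
        ← Finset.add_sum_erase _ _ (Finset.mem_univ i), add_right_comm]
      congr 1
      · simp [δ.onV_smul]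
      · refine Finset.sum_congr rfl fun j hj => ?_
        have h : j ≠ i := (Finset.mem_erase.1 hj).1
        simp only [Function.update_of_ne h, Function.update_comm (Ne.symm h)]
        exact κ.map_update_smul _ _ _ _
    rw [hs, κ.map_update_smul, δ.onW_smul, smul_sub]
    abel
  map_eq_zero_of_eq' := by
    intro y a b hab hne
    show δ.onW (κ y) - ∑ j : Fin p, κ (Function.update y j (δ.onV (y j))) = 0
    rw [κ.map_eq_zero_of_eq _ hab hne, map_zero, zero_sub, neg_eq_zero,
      ← Finset.add_sum_erase _ _ (Finset.mem_univ a),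
      ← Finset.add_sum_erase _ _ (Finset.mem_erase.2 ⟨hne.symm, Finset.mem_univ b⟩),
      Finset.sum_eq_zero, add_zero]
    · rw [hab]
      have : Function.update y b (δ.onV (y b)) =
          (Function.update y a (δ.onV (y b))) ∘ Equiv.swap a b := by
        ext c
        by_cases hca : c = a
        · subst hca; simp [Function.update_of_ne hne, Function.update_of_ne hne.symm, hab]
        · by_cases hcb : c = b
          · subst hcb; simp
          · simp [Function.update_of_ne hca, Function.update_of_ne hcb,
              Equiv.swap_apply_of_ne_of_ne hca hcb]
      rw [this, κ.map_swap _ hne, add_neg_cancel]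
    · intro j hj
      simp only [Finset.mem_erase] at hj
      exact κ.map_eq_zero_of_eq _
        (by simp [Function.update_of_ne hj.2.1.symm, Function.update_of_ne hj.1.symm, hab]) hne

theorem DerPair.lieAlt_apply (δ : DerPair R V W) {p : ℕ} (κ : V [⋀^Fin p]→ₗ[R] W) (y : Fin p → V) :
    δ.lieAlt κ y = δ.onW (κ y) - ∑ i : Fin p, κ (Function.update y i (δ.onV (y i))) := rfl

theorem DerPair.lieAlt_add (δ : DerPair R V W) {p : ℕ} (κ κ' : V [⋀^Fin p]→ₗ[R] W) :
    δ.lieAlt (κ + κ') = δ.lieAlt κ + δ.lieAlt κ' := by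
  ext y
  simp only [lieAlt_apply, AlternatingMap.add_apply, map_add, Finset.sum_add_distrib]
  abel

theorem DerPair.lieAlt_smul (δ : DerPair R V W) {p : ℕ} (f : R) (κ : V [⋀^Fin p]→ₗ[R] W) :
    δ.lieAlt (f • κ) = f • δ.lieAlt κ + δ.sym f • κ := by
  ext y
  simp only [lieAlt_apply, AlternatingMap.add_apply, AlternatingMap.smul_apply, δ.onW_smul,
    ← Finset.smul_sum, smul_sub]
  abel

theorem DerPair.lieAlt_comm (δ δ' γ : DerPair R V W)
    (hV : ∀ v, γ.onV v = δ.onV (δ'.onV v) - δ'.onV (δ.onV v))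
    (hW : ∀ v, γ.onW v = δ.onW (δ'.onW v) - δ'.onW (δ.onW v))
    {p : ℕ} (κ : V [⋀^Fin p]→ₗ[R] W) :
    γ.lieAlt κ = δ.lieAlt (δ'.lieAlt κ) - δ'.lieAlt (δ.lieAlt κ) := by
  ext y
  have key : ∑ i, ∑ j, κ (Function.update (Function.update y i (δ.onV (y i))) j
        (δ'.onV (Function.update y i (δ.onV (y i)) j))) -
      ∑ i, ∑ j, κ (Function.update (Function.update y i (δ'.onV (y i))) j
        (δ.onV (Function.update y i (δ'.onV (y i)) j))) =
      -∑ i, κ (Function.update y i (γ.onV (y i))) := by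
    -- After exchanging the order of summation in the first double sum, the terms with i ≠ j cancel
    -- because updates in different slots commute. Only the diagonal survives.
    rw [Finset.sum_comm, ← Finset.sum_sub_distrib, ← Finset.sum_neg_distrib]
    refine Finset.sum_congr rfl fun i _ => ?_
    rw [← Finset.sum_sub_distrib, Finset.sum_eq_single i]
    · simp only [Function.update_self, Function.update_idem]
      rw [hV, κ.map_update_sub]; abel
    · intro j _ hj
      rw [Function.update_of_ne hj, Function.update_of_ne hj.symm, Function.update_comm hj,
        sub_self]
    · simp
  simp only [lieAlt_apply, AlternatingMap.sub_apply, map_sub, map_sum, Finset.sum_sub_distrib, hW]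
  rw [← sub_eq_zero]
  rw [sub_eq_iff_eq_add] at key
  rw [key]
  abel

/-- The Lie derivative on forms. -/
def DerPair.lie (δ : DerPair R V W) : Forms R V W →+ Forms R V W where
  toFun w j := δ.lieAlt (w j)
  map_zero' := by
    funext j; ext y; simp [lieAlt_apply]
  map_add' w w' := by
    funext j; exact δ.lieAlt_add _ _

theorem DerPair.lie_apply (δ : DerPair R V W) (w : Forms R V W) (j : ℕ) :
    δ.lie w j = δ.lieAlt (w j) := rfl

theorem DerPair.lie_smul (δ : DerPair R V W) (f : R) (w : Forms R V W) :
    δ.lie (f • w) = f • δ.lie w + δ.sym f • w := by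
  funext j; exact δ.lieAlt_smul f (w j)

theorem DerPair.lie_comm (δ δ' γ : DerPair R V W)
    (hV : ∀ v, γ.onV v = δ.onV (δ'.onV v) - δ'.onV (δ.onV v))
    (hW : ∀ v, γ.onW v = δ.onW (δ'.onW v) - δ'.onW (δ.onW v)) (w : Forms R V W) :
    γ.lie w = δ.lie (δ'.lie w) - δ'.lie (δ.lie w) := by
  funext j; exact δ.lieAlt_comm δ' γ hV hW (w j)

theorem DerPair.lie_add_pair (δ δ' γ : DerPair R V W)
    (hV : ∀ v, γ.onV v = δ.onV v + δ'.onV v) (hW : ∀ v, γ.onW v = δ.onW v + δ'.onW v)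
    (w : Forms R V W) : γ.lie w = δ.lie w + δ'.lie w := by
  funext j; ext y
  simp only [lie_apply, lieAlt_apply, Pi.add_apply, AlternatingMap.add_apply, hV, hW,
    AlternatingMap.map_update_add, Finset.sum_add_distrib]
  abel

theorem DerPair.contr_lie (δ : DerPair R V W) (v : V) (w : Forms R V W) :
    contr v (δ.lie w) = δ.lie (contr v w) - contr (δ.onV v) w := by
  funext j; ext y
  simp only [contr_apply, lie_apply, lieAlt_apply, Pi.sub_apply, AlternatingMap.sub_apply,
    Fin.sum_univ_succ, Fin.cons_zero, Fin.cons_succ, Fin.update_cons_zero, ← Fin.cons_update]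
  abel

/-- The form η' is the derivative of η along δ, so this is the Leibniz rule for the Lie derivative
of η ∧ w. -/
theorem DerPair.lie_extMul (δ : DerPair R V W) (η η' : Module.Dual R V)
    (h : ∀ v, η' v = δ.sym (η v) - η (δ.onV v)) (w : Forms R V W) :
    δ.lie (extMul η w) = extMul η' w + extMul η (δ.lie w) := by
  rw [← sub_eq_zero]
  refine eq_zero_of_contr (fun w => δ.lie (extMul η w) - (extMul η' w + extMul η (δ.lie w))) (-1)
    (fun w => ?_) (fun v w => ?_) w
  · simp only [Pi.sub_apply, Pi.add_apply, extMul_zero_apply, DerPair.lie_apply]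
    ext y; simp [lieAlt_apply]
  · simp only [map_add, map_sub, contr_extMul, contr_lie, lie_smul, h, sub_smul, neg_smul, one_smul]
    abel

end Forms

/-! ## The differential of a module, and Cartan's formulas -/

section Differential

variable {R : Type*} [CommRing R] [Algebra ℝ R]
variable {E : Type*} [AddCommGroup E] [Module R E]
variable {Q : Type*} [AddCommGroup Q] [Module R Q]

theorem half_add_half {W : Type*} [AddCommGroup W] [Module R W] (q : W) :
    algebraMap ℝ R (1 / 2) • q + algebraMap ℝ R (1 / 2) • q = q := by
  rw [← add_smul, ← map_add]; norm_num

theorem half_smul_add_self {W : Type*} [AddCommGroup W] [Module R W] (q : W) :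
    algebraMap ℝ R (1 / 2) • (q + q) = q := by
  rw [smul_add, half_add_half]

theorem eq_zero_of_add_self {W : Type*} [AddCommGroup W] [Module R W] {q : W} (h : q + q = 0) :
    q = 0 := by
  rw [← half_smul_add_self (R := R) q, h, smul_zero]

theorem diff_add (S : SkewAlgebroid R E) (ρ : Representation S Q) {p : ℕ}
    (w w' : E [⋀^Fin p]→ₗ[R] Q) : diff S ρ (w + w') = diff S ρ w + diff S ρ w' := by
  ext x
  show diffFun S ρ _ x = diffFun S ρ _ x + diffFun S ρ _ x
  simp only [diffFun, AlternatingMap.add_apply, ρ.act_add, Finset.sum_add_distrib, smul_add,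
    smul_sub, Finset.sum_sub_distrib]
  abel

/-- The differential on families of forms. -/
def dForm (S : SkewAlgebroid R E) (ρ : Representation S Q) : Forms R E Q →+ Forms R E Q :=
  AddMonoidHom.mk' (fun w j => match j with
    | 0 => 0
    | j + 1 => diff S ρ (w j)) (fun w w' => by
      funext j
      cases j with
      | zero => exact (add_zero _).symm
      | succ j => exact diff_add S ρ _ _)

theorem dForm_zero (S : SkewAlgebroid R E) (ρ : Representation S Q) (w : Forms R E Q) :
    dForm S ρ w 0 = 0 := rfl

theorem dForm_succ (S : SkewAlgebroid R E) (ρ : Representation S Q) (w : Forms R E Q) (j : ℕ) :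
    dForm S ρ w (j + 1) = diff S ρ (w j) := rfl

/-- The Lie derivative along `X` of forms with values in a module. -/
def repPair (S : SkewAlgebroid R E) (ρ : Representation S Q) (X : E) : DerPair R E Q where
  sym := S.anchor X
  onV := AddMonoidHom.mk' (S.bracket X) (S.bracket_add X)
  onW := AddMonoidHom.mk' (ρ.act X) (ρ.act_add X)
  onV_smul f v := by simp [S.leibniz, add_comm]
  onW_smul f v := by simp [ρ.act_smul]

@[simp]
theorem repPair_sym (S : SkewAlgebroid R E) (ρ : Representation S Q) (X : E) :
    (repPair S ρ X).sym = S.anchor X := rfl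

@[simp]
theorem repPair_onV (S : SkewAlgebroid R E) (ρ : Representation S Q) (X Y : E) :
    (repPair S ρ X).onV Y = S.bracket X Y := rfl

@[simp]
theorem repPair_onW (S : SkewAlgebroid R E) (ρ : Representation S Q) (X : E) (q : Q) :
    (repPair S ρ X).onW q = ρ.act X q := rfl

/-- Cartan's formula ι_v d + d ι_v = ℒ_v evaluated on y. Half of the brackets of v with the yₜ comes
from the index 0; the other half comes from the summands of index t + 1, where v is one of the
remaining arguments. -/
theorem diffFun_cons (S : SkewAlgebroid R E) (ρ : Representation S Q) {p : ℕ}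
    (w : E [⋀^Fin (p + 1)]→ₗ[R] Q) (v : E) (y : Fin (p + 1) → E) :
    diffFun S ρ w (Fin.cons v y : Fin (p + 2) → E) =
      (repPair S ρ v).lieAlt w y - diffFun S ρ (w.curryLeft v) y := by
  have hins : ∀ (t : Fin (p + 1)) (a : E), w (Function.update y t a) =
      (-1 : ℤ) ^ (t : ℕ) • w (Fin.cons a (t.removeNth y) : Fin (p + 1) → E) := by
    intro t a
    rw [← Fin.insertNth_removeNth, w.map_insertNth]
    rfl
  have hwneg : ∀ (a : E) (z : Fin p → E), w (Fin.cons (-a) z : Fin (p + 1) → E) =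
      - w (Fin.cons a z : Fin (p + 1) → E) := by
    intro a z
    exact congrArg (fun u => u z) (map_neg w.curryLeft a)
  have hexp : diffFun S ρ w (Fin.cons v y : Fin (p + 2) → E) =
      (ρ.act v (w y) - algebraMap ℝ R (1 / 2) •
        ∑ j, w (Function.update y j (S.bracket v (y j)))) +
      ∑ t : Fin (p + 1), (-1 : ℤ) ^ ((t : ℕ) + 1) •
        (ρ.act (y t) (w (Fin.cons v (t.removeNth y) : Fin (p + 1) → E)) -
          algebraMap ℝ R (1 / 2) • (w (Fin.cons (S.bracket (y t) v) (t.removeNth y) :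
              Fin (p + 1) → E) +
            ∑ j : Fin p, w (Fin.cons v (Function.update (t.removeNth y) j
              (S.bracket (y t) (t.removeNth y j))) : Fin (p + 1) → E))) := by
    rw [diffFun, Fin.sum_univ_succ]
    congr 1
    · simp
    · refine Finset.sum_congr rfl fun t _ => ?_
      rw [removeNth_succ_cons, Fin.sum_univ_succ]
      simp only [Fin.cons_succ, Fin.val_succ, Fin.cons_zero, Fin.update_cons_zero,
        Fin.cons_update]
  have hsplit : ∑ t : Fin (p + 1), (-1 : ℤ) ^ ((t : ℕ) + 1) •
        (ρ.act (y t) (w (Fin.cons v (t.removeNth y) : Fin (p + 1) → E)) -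
          algebraMap ℝ R (1 / 2) • (w (Fin.cons (S.bracket (y t) v) (t.removeNth y) :
              Fin (p + 1) → E) +
            ∑ j : Fin p, w (Fin.cons v (Function.update (t.removeNth y) j
              (S.bracket (y t) (t.removeNth y j))) : Fin (p + 1) → E))) =
      - (algebraMap ℝ R (1 / 2) • ∑ t, w (Function.update y t (S.bracket v (y t)))) -
        diffFun S ρ (w.curryLeft v) y := by
    rw [diffFun, Finset.smul_sum, ← Finset.sum_neg_distrib, ← Finset.sum_sub_distrib]
    refine Finset.sum_congr rfl fun t _ => ?_
    rw [hins, S.bracket_skew (y t) v, hwneg, pow_succ, mul_neg_one,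
      smul_comm (algebraMap ℝ R (1 / 2)) ((-1 : ℤ) ^ (t : ℕ))]
    simp only [AlternatingMap.curryLeft_apply_apply, Matrix.vecCons, smul_add, smul_sub, neg_smul,
      smul_neg]
    abel
  rw [hexp, hsplit, DerPair.lieAlt_apply]
  simp only [repPair_onV, repPair_onW]
  have h := half_add_half (R := R) (∑ j, w (Function.update y j (S.bracket v (y j))))
  generalize ∑ j, w (Function.update y j (S.bracket v (y j))) = G at h ⊢
  generalize algebraMap ℝ R (1 / 2) • G = K at h ⊢
  subst h
  abel

/-- Together with the vanishing in degree zero this characterises the differential; its explicit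
formula is hardly needed afterwards. -/
theorem contr_dForm (S : SkewAlgebroid R E) (ρ : Representation S Q) (v : E) (w : Forms R E Q) :
    contr v (dForm S ρ w) = (repPair S ρ v).lie w - dForm S ρ (contr v w) := by
  funext j
  cases j with
  | zero =>
    ext y
    rw [contr_apply, dForm_succ, Pi.sub_apply, dForm_zero, sub_zero]
    show diffFun S ρ (w 0) _ = _
    simp [diffFun, DerPair.lie_apply, DerPair.lieAlt_apply]
  | succ j => ext y; exact diffFun_cons S ρ (w (j + 1)) v y

theorem dForm_smul (S : SkewAlgebroid R E) (ρ : Representation S Q) (f : R) (w : Forms R E Q) :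
    dForm S ρ (f • w) = f • dForm S ρ w + extMul (S.dFun f) w := by
  rw [← sub_eq_zero]
  refine eq_zero_of_contr
    (fun w => dForm S ρ (f • w) - (f • dForm S ρ w + extMul (S.dFun f) w)) (-1)
    (fun w => ?_) (fun v w => ?_) w
  · simp [dForm_zero, extMul_zero_apply]
  · have : S.dFun f v = S.anchor v f := rfl
    simp only [map_add, map_sub, contr_extMul, contr_dForm, map_smul, DerPair.lie_smul, this,
      repPair_sym, smul_sub, neg_smul, one_smul]
    abel

/-- Here ζ is the contraction of dη with v. The anticommutator of d and η ∧ · thus contracts like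
multiplication by the two-form dη. -/
theorem dForm_extMul_contr (S : SkewAlgebroid R E) (ρ : Representation S Q)
    (η ζ : Module.Dual R E) (v : E)
    (hζ : ∀ u, ζ u = S.anchor v (η u) - η (S.bracket v u) - S.anchor u (η v))
    (w : Forms R E Q) :
    contr v (dForm S ρ (extMul η w) + extMul η (dForm S ρ w)) =
      (dForm S ρ (extMul η (contr v w)) + extMul η (dForm S ρ (contr v w))) + extMul ζ w := by
  have h1 := (repPair S ρ v).lie_extMul η (S.lieDual v η) (fun u => rfl) w
  have h2 : S.lieDual v η = ζ + S.dFun (η v) := by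
    ext u
    simp only [LinearMap.add_apply, hζ]
    show S.anchor v (η u) - η (S.bracket v u) = _ + S.anchor u (η v)
    abel
  simp only [map_add, contr_dForm, contr_extMul, map_sub, dForm_smul, h1, h2, add_extMul]
  abel

/-- The Jacobi identity and flatness give ℒ_[v,u] = [ℒ_v, ℒ_u]. With Cartan's formula, the
commutator of ℒ_v and d then anticommutes with every contraction. -/
theorem lie_dForm (S : LieAlgebroid R E) (ρ : Representation S.toSkewAlgebroid Q) (v : E)
    (w : Forms R E Q) :
    (repPair S.toSkewAlgebroid ρ v).lie (dForm S.toSkewAlgebroid ρ w) =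
      dForm S.toSkewAlgebroid ρ ((repPair S.toSkewAlgebroid ρ v).lie w) := by
  have hc : ∀ (u v : E) (w : Forms R E Q), (repPair S.toSkewAlgebroid ρ (S.bracket v u)).lie w =
      (repPair S.toSkewAlgebroid ρ v).lie ((repPair S.toSkewAlgebroid ρ u).lie w) -
        (repPair S.toSkewAlgebroid ρ u).lie ((repPair S.toSkewAlgebroid ρ v).lie w) := by
    intro u v w
    refine DerPair.lie_comm _ _ _ (fun z => ?_) (fun z => ?_) w
    · simp only [repPair_onV]
      rw [S.jacobi v u z]; abel
    · exact ρ.flat v u z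
  rw [← sub_eq_zero]
  refine eq_zero_of_contr (fun w => (repPair S.toSkewAlgebroid ρ v).lie
    (dForm S.toSkewAlgebroid ρ w) -
      dForm S.toSkewAlgebroid ρ ((repPair S.toSkewAlgebroid ρ v).lie w)) (-1)
    (fun w => ?_) (fun u w => ?_) w
  · simp only [Pi.sub_apply, dForm_zero, DerPair.lie_apply]
    ext y; simp [DerPair.lieAlt_apply, -repPair_onW]
  · simp only [map_sub, DerPair.contr_lie, contr_dForm, repPair_onV, hc, neg_smul, one_smul]
    abel

/-- By Cartan's formula and [ℒ_v, d] = 0, d² commutes with contractions, and it has no component in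
degree zero. -/
theorem dForm_dForm (S : LieAlgebroid R E) (ρ : Representation S.toSkewAlgebroid Q)
    (w : Forms R E Q) : dForm S.toSkewAlgebroid ρ (dForm S.toSkewAlgebroid ρ w) = 0 := by
  refine eq_zero_of_contr (fun w => dForm S.toSkewAlgebroid ρ (dForm S.toSkewAlgebroid ρ w)) 1
    (fun w => rfl) (fun v w => ?_) w
  simp only [contr_dForm, map_sub, lie_dForm, one_smul]
  abel

end Differential

/-! ### Exterior multiplication by a two-form -/

section TwoForm

variable {R : Type*} [CommRing R] [Algebra ℝ R]
variable {V : Type*} [AddCommGroup V] [Module R V]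
variable {W : Type*} [AddCommGroup W] [Module R W]

/-- `u ↦ F(u) ∧ w`. -/
def extMulFam (F : V →ₗ[R] Module.Dual R V) (w : Forms R V W) : V →ₗ[R] Forms R V W where
  toFun u := extMul (F u) w
  map_add' u v := by rw [map_add, add_extMul]
  map_smul' f u := by rw [map_smul, smul_extMul]; rfl

/-- Exterior multiplication by a two-form, given as a linear map to the dual. -/
def twoMul (F : V →ₗ[R] Module.Dual R V) : Forms R V W →ₗ[R] Forms R V W where
  toFun w := algebraMap ℝ R (1 / 2) • altSum (extMulFam F w)
  map_add' w w' := by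
    rw [← smul_add, ← altSum_add]; congr 2
    exact LinearMap.ext fun u => map_add (extMul (F u)) w w'
  map_smul' f w := by
    simp only [RingHom.id_apply]
    rw [smul_comm f, ← altSum_smul f]; congr 2
    exact LinearMap.ext fun u => map_smul (extMul (F u)) f w

theorem twoMul_zero (F : V →ₗ[R] Module.Dual R V) (w : Forms R V W) : twoMul F w 0 = 0 :=
  smul_zero (algebraMap ℝ R (1 / 2))

theorem contr_twoMul (F : V →ₗ[R] Module.Dual R V) (hF : ∀ u v, F u v = -F v u) (v : V)
    (w : Forms R V W) : contr v (twoMul F w) = extMul (F v) w + twoMul F (contr v w) := by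
  show contr v (algebraMap ℝ R (1 / 2) • altSum (extMulFam F w)) =
    _ + algebraMap ℝ R (1 / 2) • altSum (extMulFam F (contr v w))
  -- Contracting F(u) ∧ w with v gives F(u)(v) w = -F(v)(u) w, whence a second copy of F(v) ∧ w; the
  -- factor 1/2 absorbs the doubling.
  rw [map_smul, contr_altSum _ ((-1 : R) • ((F v).smulRight w + extMulFam F (contr v w)))]
  · rw [altSum_smul, altSum_add, ← extMul_def, neg_one_smul, sub_neg_eq_add, ← add_assoc]
    have : extMulFam F w v = extMul (F v) w := rfl
    rw [this, smul_add, half_smul_add_self]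
  · intro u
    have : extMulFam F w u = extMul (F u) w := rfl
    rw [this, contr_extMul]
    simp only [LinearMap.smul_apply, LinearMap.add_apply, LinearMap.smulRight_apply]
    rw [hF u v]
    show (-1 : R) • (F v u • w + extMul (F u) (contr v w)) = _
    module

theorem twoMul_extMul (F : V →ₗ[R] Module.Dual R V) (hF : ∀ u v, F u v = -F v u)
    (η : Module.Dual R V) (w : Forms R V W) : twoMul F (extMul η w) = extMul η (twoMul F w) := by
  rw [← sub_eq_zero]
  refine eq_zero_of_contr (fun w => twoMul F (extMul η w) - extMul η (twoMul F w)) (-1)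
    (fun w => ?_) (fun v w => ?_) w
  · simp [twoMul_zero, extMul_zero_apply]
  · simp only [map_sub, map_add, contr_twoMul F hF, contr_extMul, map_smul, neg_smul, one_smul]
    rw [extMul_extMul (F v) η]
    abel

end TwoForm

/-! ## Localisation at points -/

section Local

variable {R : Type*} [CommRing R] [Algebra ℝ R] {M : Type*} (pt : M → R →+* ℝ)
variable {V : Type*} [AddCommGroup V] [Module R V]
variable {W : Type*} [AddCommGroup W] [Module R W]

/-- An element vanishing near every point is zero. -/
def Separated (W : Type*) [AddCommGroup W] [Module R W] : Prop :=
  ∀ q : W, (∀ x, ∃ χ : R, pt x χ ≠ 0 ∧ χ • q = 0) → q = 0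

/-- Compatible local fractions `p x / χ x` come from a global element. -/
def Glueable (W : Type*) [AddCommGroup W] [Module R W] : Prop :=
  ∀ (χ : M → R) (p : M → W), (∀ x, pt x (χ x) ≠ 0) → (∀ x y, χ y • p x = χ x • p y) →
    ∃ q, ∀ x, χ x • q = p x

variable {pt}

theorem Separated.eq (h : Separated pt W) {a b : W}
    (H : ∀ x, ∃ χ : R, pt x χ ≠ 0 ∧ χ • a = χ • b) : a = b := by
  rw [← sub_eq_zero]
  refine h _ fun x => ?_
  obtain ⟨χ, h1, h2⟩ := H x
  exact ⟨χ, h1, by rw [smul_sub, h2, sub_self]⟩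

theorem Separated.alt (h : Separated pt W) (p : ℕ) : Separated pt (V [⋀^Fin p]→ₗ[R] W) := by
  intro κ H
  ext y
  refine h _ fun x => ?_
  obtain ⟨χ, h1, h2⟩ := H x
  exact ⟨χ, h1, by rw [← AlternatingMap.smul_apply, h2]; rfl⟩

theorem Separated.pi {ι : Type*} {Z : ι → Type*} [∀ i, AddCommGroup (Z i)] [∀ i, Module R (Z i)]
    (h : ∀ i, Separated pt (Z i)) : Separated pt (∀ i, Z i) := by
  intro w H
  funext i
  refine h i _ fun x => ?_
  obtain ⟨χ, h1, h2⟩ := H x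
  exact ⟨χ, h1, congrFun h2 i⟩

/-- The values are glued separately for each argument. Multilinearity and alternation may then be
tested after multiplication by each `χ x`. -/
theorem Glueable.alt (h : Glueable pt W) (hs : Separated pt W) (p : ℕ) :
    Glueable pt (V [⋀^Fin p]→ₗ[R] W) := by
  intro χ κ h1 h2
  have H : ∀ y, ∃ q, ∀ x, χ x • q = κ x y := fun y =>
    h χ (fun x => κ x y) h1 fun a b => by
      simpa using congrArg (fun u : V [⋀^Fin p]→ₗ[R] W => u y) (h2 a b)
  choose g hg using H
  have hsep : ∀ {a b : W}, (∀ x, χ x • a = χ x • b) → a = b := fun H =>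
    hs.eq fun x => ⟨χ x, h1 x, H x⟩
  refine ⟨{ toFun := g, map_update_add' := ?_, map_update_smul' := ?_,
            map_eq_zero_of_eq' := ?_ }, fun x => ?_⟩
  · intro _ m i a b
    refine hsep fun x => ?_
    rw [smul_add, hg, hg, hg, AlternatingMap.map_update_add]
  · intro _ m i c a
    refine hsep fun x => ?_
    rw [smul_comm, hg, hg, AlternatingMap.map_update_smul]
  · intro v i j hv hij
    refine hsep fun x => ?_
    rw [hg, smul_zero, AlternatingMap.map_eq_zero_of_eq _ _ hv hij]
  · ext y
    exact hg y x

/-- Injectivity of F forces the local solutions p x / χ x to agree, so they glue, and the glued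
element solves the equation because `Z` is separated. -/
theorem exists_of_local {Z : Type*} [AddCommGroup Z] [Module R Z] (hW : Glueable pt W)
    (hZ : Separated pt Z) (F : W →ₗ[R] Z) (hF : ∀ p, F p = 0 → p = 0) (z : Z)
    (H : ∀ x, ∃ (χ : R) (p : W), pt x χ ≠ 0 ∧ F p = χ • z) : ∃ p, F p = z := by
  choose χ p h1 h2 using H
  obtain ⟨q, hq⟩ := hW χ p h1 fun x y => by
    rw [← sub_eq_zero]
    apply hF
    rw [map_sub, map_smul, map_smul, h2, h2, smul_comm, sub_self]
  refine ⟨q, hZ.eq fun x => ⟨χ x, h1 x, ?_⟩⟩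
  rw [← map_smul, hq, h2]

variable (pt) in
/-- A local frame near `x`: elements `e i` and linear forms `coord i` with
`χ • v = ∑ i, coord i v • e i` and `coord i (e j) = χ δ_ij`, where `χ` does not vanish at `x`. -/
structure Frame (x : M) (V : Type*) [AddCommGroup V] [Module R V] (n : ℕ) where
  χ : R
  e : Fin n → V
  coord : Fin n → Module.Dual R V
  pt_ne : pt x χ ≠ 0
  expand : ∀ v, χ • v = ∑ i, coord i v • e i
  coord_e : ∀ i j, coord i (e j) = if i = j then χ else 0

/-- The dual frame. -/
def Frame.dual {x : M} {n : ℕ} (F : Frame pt x V n) : Frame pt x (Module.Dual R V) n where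
  χ := F.χ
  e := F.coord
  coord i := Module.Dual.eval R V (F.e i)
  pt_ne := F.pt_ne
  expand η := by
    ext v
    have := congrArg η (F.expand v)
    simp only [map_smul, map_sum, smul_eq_mul] at this
    simp [this, mul_comm, LinearMap.sum_apply]
  coord_e i j := by
    simp [Module.Dual.eval_apply, F.coord_e, eq_comm]

/-- All the points have a frame. -/
def LocallyFree (pt : M → R →+* ℝ) (V : Type*) [AddCommGroup V] [Module R V] (n : ℕ) : Prop :=
  ∀ x, Nonempty (Frame pt x V n)

theorem LocallyFree.dual {n : ℕ} (h : LocallyFree pt V n) :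
    LocallyFree pt (Module.Dual R V) n := fun x => (h x).map Frame.dual

theorem LocallyFree.eq_zero {n : ℕ} (h : LocallyFree pt V n) (hV : Separated pt V) {v : V}
    (hv : ∀ η : Module.Dual R V, η v = 0) : v = 0 := by
  refine hV v fun x => ?_
  obtain ⟨F⟩ := h x
  exact ⟨F.χ, F.pt_ne, by simp [F.expand, hv]⟩

theorem Frame.pow_smul_apply {x : M} {n p : ℕ} (F : Frame pt x V n) (κ : V [⋀^Fin p]→ₗ[R] W)
    (φ : Fin p → V) :
    F.χ ^ p • κ φ = κ (fun i => ∑ j, F.coord j (φ i) • F.e j) := by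
  have := κ.map_smul_univ (fun _ => F.χ) φ
  simp only [Finset.prod_const, Finset.card_univ, Fintype.card_fin] at this
  rw [← this]
  simp only [F.expand]

/-- Pulled back to the free module on n generators, both sides are top forms, and these are
determined by their value on the standard basis. -/
theorem alt_comb_eq_det {n : ℕ} (κ : V [⋀^Fin n]→ₗ[R] W) (A : Fin n → Fin n → R) (e : Fin n → V) :
    κ (fun i => ∑ j, A i j • e j) = Matrix.det (Matrix.of A) • κ e := by
  let b := Pi.basisFun R (Fin n)
  let c : (Fin n → R) →ₗ[R] V := Fintype.linearCombination R e
  have hc : ∀ i, c (b i) = e i := fun i => by simp [b, c, Fintype.linearCombination_apply_single]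
  have H : κ.compLinearMap c =
      (LinearMap.toSpanSingleton R W (κ e)).compAlternatingMap b.det := by
    refine b.ext_alternating fun v hv => ?_
    let σ : Equiv.Perm (Fin n) := Equiv.ofBijective v (Finite.injective_iff_bijective.1 hv)
    have h1 : (fun i => b (v i)) = b ∘ σ := rfl
    rw [h1, AlternatingMap.map_perm, AlternatingMap.map_perm]
    congr 1
    simp [AlternatingMap.compLinearMap_apply, hc, b.det_self]
  have h2 := congrArg (fun u : (Fin n → R) [⋀^Fin n]→ₗ[R] W => u A) H
  simp only [AlternatingMap.compLinearMap_apply, LinearMap.compAlternatingMap_apply,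
    LinearMap.toSpanSingleton_apply] at h2
  have h3 : b.det A = Matrix.det (Matrix.of A) := by
    rw [Pi.basisFun_det_apply]
  rw [h3] at h2
  rw [← h2]
  rfl

theorem Frame.pow_smul_top {x : M} {n : ℕ} (F : Frame pt x V n) (κ : V [⋀^Fin n]→ₗ[R] W)
    (φ : Fin n → V) :
    F.χ ^ n • κ φ = Matrix.det (Matrix.of fun i j => F.coord j (φ i)) • κ F.e := by
  rw [F.pow_smul_apply, alt_comb_eq_det κ (fun i j => F.coord j (φ i)) F.e]

theorem pt_pow_ne {x : M} {χ : R} (h : pt x χ ≠ 0) (n : ℕ) : pt x (χ ^ n) ≠ 0 := by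
  rw [map_pow]; exact pow_ne_zero n h

theorem pt_mul_ne {x : M} {χ ψ : R} (h : pt x χ ≠ 0) (h' : pt x ψ ≠ 0) : pt x (χ * ψ) ≠ 0 := by
  rw [map_mul]; exact mul_ne_zero h h'

/-- After multiplication by χ^p the arguments are combinations of n vectors, and there is no
injection from p > n slots into n basis vectors. -/
theorem alt_eq_zero_of_lt {n p : ℕ} (hV : LocallyFree pt V n) (hW : Separated pt W) (h : n < p)
    (κ : V [⋀^Fin p]→ₗ[R] W) : κ = 0 := by
  ext φ
  refine hW _ fun x => ?_
  obtain ⟨F⟩ := hV x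
  refine ⟨F.χ ^ p, pt_pow_ne F.pt_ne p, ?_⟩
  have h0 : κ.compLinearMap (Fintype.linearCombination R F.e) = 0 := by
    refine (Pi.basisFun R (Fin n)).ext_alternating fun v hv => ?_
    have := Fintype.card_le_of_injective v hv
    simp only [Fintype.card_fin] at this
    omega
  rw [F.pow_smul_apply]
  exact congrArg (fun u : (Fin n → R) [⋀^Fin p]→ₗ[R] W => u fun i j => F.coord j (φ i)) h0

/-- The endomorphism u ↦ η(u) v acts on top forms by its trace η(v). The identity is the vanishing
of the (n+1)-form η ∧ κ on (v, φ₁, …, φₙ). -/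
theorem sum_update_rankOne {n : ℕ} (hV : LocallyFree pt V n) (hW : Separated pt W)
    (κ : V [⋀^Fin n]→ₗ[R] W) (η : Module.Dual R V) (v : V) (φ : Fin n → V) :
    ∑ i, κ (Function.update φ i (η (φ i) • v)) = η v • κ φ := by
  have h0 := alt_eq_zero_of_lt hV hW (Nat.lt_succ_self n)
    (AlternatingMap.alternatizeUncurryFin (η.smulRight κ))
  have h1 := congrArg (fun u : V [⋀^Fin (n + 1)]→ₗ[R] W => u (Fin.cons v φ)) h0
  simp only [AlternatingMap.alternatizeUncurryFin_apply, Fin.sum_univ_succ, AlternatingMap.zero_apply,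
    Fin.cons_zero, Fin.cons_succ, removeNth_zero_cons, Fin.val_zero, pow_zero, one_smul,
    LinearMap.smulRight_apply, AlternatingMap.smul_apply] at h1
  rw [add_eq_zero_iff_eq_neg] at h1
  rw [h1, ← Finset.sum_neg_distrib]
  refine Finset.sum_congr rfl fun i _ => ?_
  cases n with
  | zero => exact i.elim0
  | succ n =>
    rw [removeNth_succ_cons, κ.map_update_smul, ← Fin.insertNth_removeNth, κ.map_insertNth,
      Fin.val_succ, pow_succ, mul_neg_one, neg_smul, neg_neg, smul_comm]
    rfl

/-- Any two elements are proportional. -/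
def IsLine (R : Type*) [CommRing R] (W : Type*) [AddCommGroup W] [Module R W] : Prop :=
  ∀ (f : Module.Dual R W) (a b : W), f a • b = f b • a

theorem LocallyFree.isLine (h : LocallyFree pt W 1) (hW : Separated pt W) : IsLine R W := by
  intro f a b
  refine hW.eq fun x => ?_
  obtain ⟨F⟩ := h x
  have hx : ∀ v, F.χ • v = F.coord 0 v • F.e 0 := fun v => by simpa using F.expand v
  refine ⟨F.χ * F.χ, pt_mul_ne F.pt_ne F.pt_ne, ?_⟩
  have key : ∀ a b, (F.χ * F.χ) • f a • b = (F.coord 0 a * F.coord 0 b * f (F.e 0)) • F.e 0 := by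
    intro a b
    have h1 : (F.χ * F.χ) • f a • b = f (F.χ • a) • (F.χ • b) := by
      simp only [map_smul, smul_smul, smul_eq_mul]; congr 1; ring
    rw [h1, hx, hx, map_smul, smul_smul, smul_eq_mul]; congr 1; ring
  rw [key, key, mul_comm (F.coord 0 a)]

/-- Top degree forms with values in a line form a line. -/
def Frame.top {x : M} {n : ℕ} (F : Frame pt x V n) (G : Frame pt x W 1) :
    Frame pt x (V [⋀^Fin n]→ₗ[R] W) 1 where
  χ := G.χ * F.χ ^ n
  e _ := (LinearMap.toSpanSingleton R W (G.e 0)).compAlternatingMap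
    ((Matrix.detRowAlternating (n := Fin n) (R := R)).compLinearMap
      (LinearMap.pi F.coord))
  coord _ :=
    { toFun := fun κ => G.coord 0 (κ F.e)
      map_add' := fun κ κ' => by simp
      map_smul' := fun f κ => by simp }
  pt_ne := pt_mul_ne G.pt_ne (pt_pow_ne F.pt_ne n)
  expand κ := by
    ext φ
    have h1 : G.χ • κ F.e = G.coord 0 (κ F.e) • G.e 0 := by simpa using G.expand (κ F.e)
    have h2 : (Matrix.detRowAlternating (n := Fin n) (R := R)) (fun i j => F.coord j (φ i)) =
      Matrix.det (Matrix.of fun i j => F.coord j (φ i)) := rfl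
    simp only [Finset.univ_unique, Finset.sum_singleton, AlternatingMap.smul_apply,
      LinearMap.compAlternatingMap_apply, AlternatingMap.compLinearMap_apply, LinearMap.coe_mk,
      AddHom.coe_mk, LinearMap.toSpanSingleton_apply]
    rw [mul_smul, F.pow_smul_top, smul_comm, h1, smul_comm]
    rfl
  coord_e i j := by
    have h : (Matrix.detRowAlternating (n := Fin n) (R := R)) (fun i j => F.coord j (F.e i)) =
        F.χ ^ n := by
      have : (fun i j => F.coord j (F.e i)) = F.χ • (1 : Matrix (Fin n) (Fin n) R) := by
        funext i j
        simp [F.coord_e, Matrix.one_apply, eq_comm]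
      rw [this]
      exact (Matrix.det_smul (1 : Matrix (Fin n) (Fin n) R) F.χ).trans (by simp)
    have h2 : ((Matrix.detRowAlternating (n := Fin n) (R := R)).compLinearMap
      (LinearMap.pi F.coord)) F.e = F.χ ^ n := h
    have hG : G.coord 0 (G.e 0) = G.χ := by simpa using G.coord_e 0 0
    simp [Subsingleton.elim i j, h2, hG, mul_comm]

theorem LocallyFree.top {n : ℕ} (hV : LocallyFree pt V n) (hW : LocallyFree pt W 1) :
    LocallyFree pt (V [⋀^Fin n]→ₗ[R] W) 1 := fun x =>
  ⟨(hV x).some.top (hW x).some⟩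

/-- The forms of top degree in two groups of variables are proportional. -/
theorem top_mul_comm {V' : Type*} [AddCommGroup V'] [Module R V'] {n m : ℕ}
    (hV : LocallyFree pt V n) (hV' : LocallyFree pt V' m) (hR : Separated pt R)
    (κ κ' : V [⋀^Fin n]→ₗ[R] V' [⋀^Fin m]→ₗ[R] R) (φ φ' : Fin n → V) (v v' : Fin m → V') :
    κ φ v * κ' φ' v' = κ φ' v' * κ' φ v := by
  refine hR.eq fun x => ?_
  obtain ⟨F⟩ := hV x
  obtain ⟨G⟩ := hV' x
  have key : ∀ (κ : V [⋀^Fin n]→ₗ[R] V' [⋀^Fin m]→ₗ[R] R) φ v,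
      G.χ ^ m * F.χ ^ n * κ φ v = Matrix.det (Matrix.of fun i j => F.coord j (φ i)) *
        (Matrix.det (Matrix.of fun i j => G.coord j (v i)) * κ F.e G.e) := by
    intro κ φ v
    have h1 := congrArg (fun u : V' [⋀^Fin m]→ₗ[R] R => u v) (F.pow_smul_top κ φ)
    simp only [AlternatingMap.smul_apply, smul_eq_mul] at h1
    have h2 := G.pow_smul_top (κ F.e) v
    simp only [smul_eq_mul] at h2
    rw [mul_assoc, h1, mul_left_comm, h2]
  have hχ : pt x (G.χ ^ m * F.χ ^ n) ≠ 0 :=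
    pt_mul_ne (pt_pow_ne G.pt_ne m) (pt_pow_ne F.pt_ne n)
  refine ⟨(G.χ ^ m * F.χ ^ n) * (G.χ ^ m * F.χ ^ n), pt_mul_ne hχ hχ, ?_⟩
  have h3 : ∀ a b c : R, (c * c) * (a * b) = (c * a) * (c * b) := fun a b c => by ring
  rw [smul_eq_mul, smul_eq_mul, h3, h3, key, key, key, key]
  ring

end Local

/-! ## Square roots of the density modules -/

section Root

variable {R : Type*} [CommRing R] [Algebra ℝ R] {M : Type*} {pt : M → R →+* ℝ}
variable {E : Type*} [AddCommGroup E] [Module R E]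
variable {Q : Type*} [AddCommGroup Q] [Module R Q]
variable {n m : ℕ}

/-- The Lie derivative along a vector field. -/
def fieldPair (D : Derivation ℝ R R) : DerPair R (Derivation ℝ R R) R where
  sym := D
  onV := AddMonoidHom.mk' (fun v => ⁅D, v⁆) (fun v w => lie_add D v w)
  onW := AddMonoidHom.mk' (fun f => D f) (fun f g => map_add D f g)
  onV_smul f v := by
    ext g
    simp only [AddMonoidHom.mk'_apply, Derivation.commutator_apply, Derivation.smul_apply,
      Derivation.add_apply, smul_eq_mul, Derivation.leibniz]
    ring
  onW_smul f v := by simp [mul_comm]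

/-- The natural action of `X` on densities. -/
def densPair (S : SkewAlgebroid R E) (m : ℕ) (X : E) :
    DerPair R (Module.Dual R E) ((Derivation ℝ R R) [⋀^Fin m]→ₗ[R] R) where
  sym := S.anchor X
  onV := AddMonoidHom.mk' (S.lieDual X) (fun θ θ' => by
    ext Y; simp only [SkewAlgebroid.lieDual, LinearMap.coe_mk, AddHom.coe_mk, LinearMap.add_apply,
      map_add]; ring)
  onW := AddMonoidHom.mk' (fieldPair (S.anchor X)).lieAlt (DerPair.lieAlt_add _)
  onV_smul f θ := by
    ext Y
    simp only [SkewAlgebroid.lieDual, AddMonoidHom.mk'_apply, LinearMap.coe_mk, AddHom.coe_mk,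
      LinearMap.add_apply, LinearMap.smul_apply, smul_eq_mul, Derivation.leibniz]
    ring
  onW_smul f μ := DerPair.lieAlt_smul _ f μ

theorem densPair_apply (S : SkewAlgebroid R E) (X : E) (κ : Density R E n m) (φ v) :
    (densPair S m X).lieAlt κ φ v = densityAct S X κ φ v := by
  have h : (∑ i, κ (Function.update φ i ((densPair S m X).onV (φ i)))) v =
      ∑ i, κ (Function.update φ i (S.lieDual X (φ i))) v := by
    rw [alt_sum_apply]; rfl
  rw [DerPair.lieAlt_apply, AlternatingMap.sub_apply, h]
  show S.anchor X (κ φ v) - ∑ j, κ φ (Function.update v j ⁅S.anchor X, v j⁆) - _ = _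
  rw [densityAct]
  abel

/-- The hypotheses on a square root `q : Q ⊗ Q → D` of a module of densities
`D = ∧ⁿ V* ⊗ ∧ᵐ T*M`: the module `Q` is a line, and `q` does not vanish at any point. -/
structure IsRoot (pt : M → R →+* ℝ) {V : Type*} [AddCommGroup V] [Module R V]
    (q : Q →ₗ[R] Q →ₗ[R] V [⋀^Fin n]→ₗ[R] (Derivation ℝ R R) [⋀^Fin m]→ₗ[R] R) : Prop where
  sepR : Separated pt R
  sepQ : Separated pt Q
  line : IsLine R Q
  free : LocallyFree pt V n
  freeDer : LocallyFree pt (Derivation ℝ R R) m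
  nondeg : ∀ x, ∃ Φ φ v, pt x (q Φ Φ φ v) ≠ 0

section Abstract

variable {V : Type*} [AddCommGroup V] [Module R V]
  {q : Q →ₗ[R] Q →ₗ[R] V [⋀^Fin n]→ₗ[R] (Derivation ℝ R R) [⋀^Fin m]→ₗ[R] R}

/-- The function `Ψ ↦ q Ψ Φ φ v`. -/
def rootCoord (q : Q →ₗ[R] Q →ₗ[R] V [⋀^Fin n]→ₗ[R] (Derivation ℝ R R) [⋀^Fin m]→ₗ[R] R)
    (Φ : Q) (φ : Fin n → V) (v : Fin m → Derivation ℝ R R) : Module.Dual R Q where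
  toFun Ψ := q Ψ Φ φ v
  map_add' a b := by simp
  map_smul' f a := by simp

theorem bilin_sub_left {V' : Type*} [AddCommGroup V'] [Module R V']
    {Z : Type*} [AddCommGroup Z] [Module R Z]
    (q : Q →ₗ[R] Q →ₗ[R] V' [⋀^Fin n]→ₗ[R] Z) (a b c : Q) :
    q (a - b) c = q a c - q b c :=
  map_sub (q.flip c) a b

theorem IsRoot.exists_coord (h : IsRoot pt q) (x : M) :
    ∃ (f : Module.Dual R Q) (U : Q), pt x (f U) ≠ 0 := by
  obtain ⟨Φ, φ, v, H⟩ := h.nondeg x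
  exact ⟨rootCoord q Φ φ v, Φ, H⟩

/-- Near each point a and b are multiples of one element U, so both values are the same multiple of
B(U, U). -/
theorem IsRoot.bilin_symm (h : IsRoot pt q) {Z : Type*} [AddCommGroup Z] [Module R Z]
    (hZ : Separated pt Z) (B : Q →ₗ[R] Q →ₗ[R] Z) (a b : Q) : B a b = B b a := by
  refine hZ.eq fun x => ?_
  obtain ⟨f, U, H⟩ := h.exists_coord x
  refine ⟨f U * f U, pt_mul_ne H H, ?_⟩
  have key : ∀ a b, (f U * f U) • B a b = (f a * f b) • B U U := by
    intro a b
    have : (f U * f U) • B a b = B (f U • a) (f U • b) := by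
      simp [mul_smul]
    rw [this, h.line f U a, h.line f U b, map_smul, map_smul, LinearMap.smul_apply, smul_smul,
      mul_comm]
  rw [key, key, mul_comm]

theorem IsRoot.sepDensity (h : IsRoot pt q) :
    Separated pt (V [⋀^Fin n]→ₗ[R] (Derivation ℝ R R) [⋀^Fin m]→ₗ[R] R) :=
  (h.sepR.alt m).alt n

theorem IsRoot.symm (h : IsRoot pt q) (a b : Q) : q a b = q b a :=
  h.bilin_symm h.sepDensity q a b

theorem IsRoot.eq_zero (h : IsRoot pt q) {a : Q} (ha : ∀ b, q a b = 0) : a = 0 := by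
  refine h.sepQ _ fun x => ?_
  obtain ⟨Φ, φ, v, H⟩ := h.nondeg x
  refine ⟨_, H, ?_⟩
  have := h.line (rootCoord q Φ φ v) Φ a
  rw [show rootCoord q Φ φ v Φ = q Φ Φ φ v from rfl,
    show rootCoord q Φ φ v a = q a Φ φ v from rfl, ha] at this
  rw [this]
  simp

/-- The form q(Ka, b) is symmetric, being bilinear on a line, so skewness of K gives 2 q(Ka, b) = 0.
-/
theorem IsRoot.skew_eq_zero (h : IsRoot pt q) (K : Q →ₗ[R] Q)
    (hK : ∀ a b, q (K a) b + q a (K b) = 0) (a : Q) : K a = 0 := by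
  refine h.eq_zero fun b => ?_
  have h1 := h.bilin_symm h.sepDensity (q ∘ₗ K) a b
  simp only [LinearMap.comp_apply] at h1
  have h2 := hK a b
  rw [h.symm a, ← h1] at h2
  ext φ v
  exact eq_zero_of_add_self (R := R)
    (congrArg (fun κ : V [⋀^Fin n]→ₗ[R] (Derivation ℝ R R) [⋀^Fin m]→ₗ[R] R => κ φ v) h2)

/-- With equal symbols the difference of the two operators is linear over functions, and it is skew
for q. -/
theorem IsRoot.unique (h : IsRoot pt q) (σ : R → R) (T T' : Q →+ Q)
    (hT : ∀ (f : R) a, T (f • a) = f • T a + σ f • a)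
    (hT' : ∀ (f : R) a, T' (f • a) = f • T' a + σ f • a)
    (H : ∀ a b, q (T a) b + q a (T b) = q (T' a) b + q a (T' b)) : T = T' := by
  let K : Q →ₗ[R] Q :=
    { toFun := fun a => T a - T' a
      map_add' := fun a b => by simp only [map_add]; abel
      map_smul' := fun f a => by simp only [hT, hT', RingHom.id_apply, smul_sub]; abel }
  ext a
  have := h.skew_eq_zero K (fun a b => by
    show q (T a - T' a) b + q a (T b - T' b) = 0
    ext φ v
    have e := congrArg
      (fun κ : V [⋀^Fin n]→ₗ[R] (Derivation ℝ R R) [⋀^Fin m]→ₗ[R] R => κ φ v) (H a b)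
    simp only [bilin_sub_left, map_sub, AlternatingMap.add_apply, AlternatingMap.sub_apply] at e ⊢
    simp only [AlternatingMap.zero_apply]
    linear_combination e) a
  exact sub_eq_zero.1 this

/-- The defining expression for the root of a derivative endomorphism. -/
def rootTarget (q : Q →ₗ[R] Q →ₗ[R] V [⋀^Fin n]→ₗ[R] (Derivation ℝ R R) [⋀^Fin m]→ₗ[R] R)
    (δ : DerPair R V ((Derivation ℝ R R) [⋀^Fin m]→ₗ[R] R)) (Φ Ψ : Q) (φ : Fin n → V)
    (v : Fin m → Derivation ℝ R R) : R :=
  2 * δ.lieAlt (q Φ Ψ) φ v * q Ψ Ψ φ v - q Φ Ψ φ v * δ.lieAlt (q Ψ Ψ) φ v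

/-- The two terms containing the derivative of f cancel: the expression is cubic in Ψ and does not
differentiate it. -/
theorem rootTarget_smul
    (δ : DerPair R V ((Derivation ℝ R R) [⋀^Fin m]→ₗ[R] R)) (f : R) (Φ Ψ : Q) (φ v) :
    rootTarget q δ Φ (f • Ψ) φ v = f ^ 3 * rootTarget q δ Φ Ψ φ v := by
  simp only [rootTarget, map_smul, LinearMap.smul_apply, δ.lieAlt_smul, AlternatingMap.smul_apply,
    AlternatingMap.add_apply, smul_eq_mul]
  ring

/-- The fraction determined by one choice (Φ₀, φ₀, v₀) solves the defining equations for all other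
choices (Ψ, φ, v). Everything is reduced to a single local generator U and to the proportionality of
top forms. -/
theorem IsRoot.target_prop (h : IsRoot pt q)
    (δ : DerPair R V ((Derivation ℝ R R) [⋀^Fin m]→ₗ[R] R)) (Φ Φ₀ Ψ : Q) (φ φ₀ v v₀) :
    rootTarget q δ Φ Φ₀ φ₀ v₀ * (q Φ₀ Ψ φ v * q Ψ Ψ φ v) =
      rootTarget q δ Φ Ψ φ v * q Φ₀ Φ₀ φ₀ v₀ ^ 2 := by
  refine h.sepR.eq fun x => ?_
  obtain ⟨f, U, H⟩ := h.exists_coord x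
  -- The exponent is 3 for the cubic target plus 2 for each of the two values of q.
  refine ⟨f U ^ 7, pt_pow_ne H 7, ?_⟩
  have hz : ∀ Ψ φ v, f U ^ 3 * rootTarget q δ Φ Ψ φ v = f Ψ ^ 3 * rootTarget q δ Φ U φ v := by
    intro Ψ φ v
    rw [← rootTarget_smul, ← rootTarget_smul, h.line f U Ψ]
  have hq : ∀ a b φ v, f U ^ 2 * q a b φ v = f a * f b * q U U φ v := by
    intro a b φ v
    have : f U ^ 2 * q a b φ v = q (f U • a) (f U • b) φ v := by simp; ring
    rw [this, h.line f U a, h.line f U b]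
    simp; ring
  have hu : rootTarget q δ Φ U φ₀ v₀ * q U U φ v ^ 2 =
      rootTarget q δ Φ U φ v * q U U φ₀ v₀ ^ 2 := by
    have e1 := top_mul_comm h.free h.freeDer h.sepR (δ.lieAlt (q Φ U)) (q U U) φ₀ φ v₀ v
    have e3 := top_mul_comm h.free h.freeDer h.sepR (q Φ U) (q U U) φ₀ φ v₀ v
    have e4 := top_mul_comm h.free h.freeDer h.sepR (δ.lieAlt (q U U)) (q U U) φ₀ φ v₀ v
    simp only [rootTarget]
    linear_combination (2 * q U U φ₀ v₀ * q U U φ v) * e1 -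
      (δ.lieAlt (q U U) φ₀ v₀ * q U U φ v) * e3 - (q Φ U φ v * q U U φ₀ v₀) * e4
  simp only [smul_eq_mul]
  calc f U ^ 7 * (rootTarget q δ Φ Φ₀ φ₀ v₀ * (q Φ₀ Ψ φ v * q Ψ Ψ φ v))
      = (f U ^ 3 * rootTarget q δ Φ Φ₀ φ₀ v₀) * ((f U ^ 2 * q Φ₀ Ψ φ v) *
          (f U ^ 2 * q Ψ Ψ φ v)) := by ring
    _ = (f Ψ ^ 3 * f Φ₀ ^ 4) * (rootTarget q δ Φ U φ₀ v₀ * q U U φ v ^ 2) := by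
        rw [hz, hq, hq]; ring
    _ = (f Ψ ^ 3 * rootTarget q δ Φ U φ v) * (f Φ₀ * f Φ₀ * q U U φ₀ v₀) ^ 2 := by
        rw [hu]; ring
    _ = _ := by rw [← hz, ← hq]; ring

/-- The linear map `p ↦ 2 q(p, Ψ) q(Ψ, Ψ)`. -/
def rootMap (q : Q →ₗ[R] Q →ₗ[R] V [⋀^Fin n]→ₗ[R] (Derivation ℝ R R) [⋀^Fin m]→ₗ[R] R) :
    Q →ₗ[R] (Q × (Fin n → V) × (Fin m → Derivation ℝ R R) → R) where
  toFun p t := 2 * (q p t.1 t.2.1 t.2.2 * q t.1 t.1 t.2.1 t.2.2)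
  map_add' a b := by funext t; simp; ring
  map_smul' f a := by funext t; simp; ring

theorem pt_two_ne (x : M) : pt x 2 ≠ 0 := by rw [map_ofNat]; norm_num

theorem IsRoot.rootMap_injective (h : IsRoot pt q) (p : Q) (hp : rootMap q p = 0) : p = 0 := by
  refine h.sepQ _ fun x => ?_
  obtain ⟨Φ, φ, v, H⟩ := h.nondeg x
  have h1 : 2 * (q p Φ φ v * q Φ Φ φ v) = 0 := congrFun hp (Φ, φ, v)
  have h2 : q Φ Φ φ v • p = q p Φ φ v • Φ := h.line (rootCoord q Φ φ v) Φ p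
  refine ⟨2 * (q Φ Φ φ v * q Φ Φ φ v), pt_mul_ne (pt_two_ne x) (pt_mul_ne H H), ?_⟩
  rw [mul_smul, mul_smul, h2, smul_smul, smul_smul, mul_assoc, mul_comm (q Φ Φ φ v), h1, zero_smul]

/-- A root T must satisfy δq(Φ,Ψ) = q(TΦ,Ψ) + q(Φ,TΨ) and δq(Ψ,Ψ) = 2 q(Ψ,TΨ). Proportionality on a
line eliminates TΨ and leaves 2 q(TΦ,Ψ) q(Ψ,Ψ) = `rootTarget q δ Φ Ψ`. This equation is linear in TΦ
with at most one solution, so it is solved locally and glued. -/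
theorem IsRoot.exists_root (h : IsRoot pt q) (hg : Glueable pt Q)
    (δ : DerPair R V ((Derivation ℝ R R) [⋀^Fin m]→ₗ[R] R)) :
    ∃ T : Q →+ Q, (∀ (f : R) a, T (f • a) = f • T a + δ.sym f • a) ∧
      ∀ a b, q (T a) b + q a (T b) = δ.lieAlt (q a b) := by
  have hex : ∀ Φ : Q, ∃ p, rootMap q p = fun t => rootTarget q δ Φ t.1 t.2.1 t.2.2 := by
    intro Φ
    refine exists_of_local hg (Separated.pi fun _ => h.sepR) (rootMap q) h.rootMap_injective _
      fun x => ?_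
    obtain ⟨Φ₀, φ₀, v₀, H⟩ := h.nondeg x
    -- Writing TΦ = c Φ₀ and testing against Φ₀ gives c = `rootTarget q δ Φ Φ₀ φ₀ v₀` / (2
    -- q(Φ₀,Φ₀)²).
    refine ⟨2 * q Φ₀ Φ₀ φ₀ v₀ ^ 2, rootTarget q δ Φ Φ₀ φ₀ v₀ • Φ₀,
      pt_mul_ne (pt_two_ne x) (pt_pow_ne H 2), ?_⟩
    funext t
    have := h.target_prop δ Φ Φ₀ t.1 t.2.1 φ₀ t.2.2 v₀
    rw [map_smul]
    show rootTarget q δ Φ Φ₀ φ₀ v₀ * (2 * (q Φ₀ t.1 t.2.1 t.2.2 * q t.1 t.1 t.2.1 t.2.2)) =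
      2 * q Φ₀ Φ₀ φ₀ v₀ ^ 2 * rootTarget q δ Φ t.1 t.2.1 t.2.2
    linear_combination 2 * this
  choose T hT using hex
  have hinj : ∀ {a b : Q}, rootMap q a = rootMap q b → a = b := fun {a b} H => by
    rw [← sub_eq_zero]; exact h.rootMap_injective _ (by rw [map_sub, H, sub_self])
  let T' : Q →+ Q := AddMonoidHom.mk' T fun a b => hinj (by
    rw [map_add, hT, hT, hT]
    funext t
    simp only [rootTarget, Pi.add_apply, map_add, LinearMap.add_apply, δ.lieAlt_add,
      AlternatingMap.add_apply]
    ring)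
  have hleib : ∀ (f : R) a, T (f • a) = f • T a + δ.sym f • a := fun f a => hinj (by
    rw [map_add, map_smul, map_smul, hT, hT]
    funext t
    simp only [rootTarget, rootMap, Pi.add_apply, map_smul, LinearMap.smul_apply, δ.lieAlt_smul,
      AlternatingMap.smul_apply, AlternatingMap.add_apply, smul_eq_mul, LinearMap.coe_mk,
      AddHom.coe_mk, Pi.smul_apply]
    ring)
  refine ⟨T', hleib, ?_⟩
  have hT2 : ∀ Φ Ψ φ v, 2 * (q (T Φ) Ψ φ v * q Ψ Ψ φ v) = rootTarget q δ Φ Ψ φ v :=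
    fun Φ Ψ φ v => congrFun (hT Φ) (Ψ, φ, v)
  -- On the diagonal the defining equation of T gives the root property at (φ', v'); proportionality
  -- of top forms carries it to every (φ, v).
  have hdiag : ∀ U φ v φ' v',
      (q (T U) U + q U (T U) - δ.lieAlt (q U U)) φ v * q U U φ' v' ^ 2 = 0 := by
    intro U φ v φ' v'
    have e := hT2 U U φ' v'
    rw [rootTarget] at e
    have e2 := top_mul_comm h.free h.freeDer h.sepR
      (q (T U) U + q U (T U) - δ.lieAlt (q U U)) (q U U) φ φ' v v'
    have e3 : (q (T U) U + q U (T U) - δ.lieAlt (q U U)) φ' v' =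
      2 * q (T U) U φ' v' - δ.lieAlt (q U U) φ' v' := by
      rw [h.symm U (T U)]
      simp only [AlternatingMap.sub_apply, AlternatingMap.add_apply]
      ring
    rw [e3] at e2
    linear_combination q U U φ' v' * e2 + q U U φ v * e
  intro a b
  refine h.sepDensity.eq fun x => ?_
  obtain ⟨U, φ', v', H⟩ := h.nondeg x
  have hU : ∀ a, q U U φ' v' • a = q a U φ' v' • U := fun a => h.line (rootCoord q U φ' v') U a
  set k := q U U φ' v' with hk
  -- One factor k² turns a and b into multiples of U, the defect being bilinear over functions; the
  -- other one is consumed by `hdiag`.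
  refine ⟨k ^ 2 * k ^ 2, pt_mul_ne (pt_pow_ne H 2) (pt_pow_ne H 2), ?_⟩
  rw [← sub_eq_zero, ← smul_sub]
  have hbil : ∀ (f g : R) a b, q (T (f • a)) (g • b) + q (f • a) (T (g • b)) -
      δ.lieAlt (q (f • a) (g • b)) = (f * g) • (q (T a) b + q a (T b) - δ.lieAlt (q a b)) := by
    intro f g a b
    ext φ v
    simp only [hleib, map_smul, map_add, LinearMap.smul_apply, LinearMap.add_apply, δ.lieAlt_smul,
      AlternatingMap.smul_apply, AlternatingMap.add_apply, AlternatingMap.sub_apply, smul_eq_mul]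
    ring
  have h1 := hbil k k a b
  rw [hU a, hU b, hbil] at h1
  show (k ^ 2 * k ^ 2) • (q (T a) b + q a (T b) - δ.lieAlt (q a b)) = 0
  rw [mul_smul, sq k, ← h1]
  ext φ v
  have h2 := hdiag U φ v φ' v'
  simp only [AlternatingMap.smul_apply, smul_eq_mul, AlternatingMap.zero_apply]
  linear_combination (q a U φ' v' * q b U φ' v') * h2

end Abstract

section Rep

variable {q : Q →ₗ[R] Q →ₗ[R] Density R E n m}

theorem isRootOf_iff (S : SkewAlgebroid R E) (ρ : Representation S Q) :
    IsRootOf S q ρ ↔ ∀ X a b,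
      q (ρ.act X a) b + q a (ρ.act X b) = (densPair S m X).lieAlt (q a b) := by
  constructor
  · intro h X a b
    ext φ v
    rw [densPair_apply, ← h X a b φ v]
    rfl
  · intro h X a b φ v
    rw [← densPair_apply, ← h X a b]
    rfl

/-- The Lie derivatives along fX and f times that along X differ by rank-one endomorphisms. Their
traces on the two factors contribute X(f) with opposite signs; the twist by ∧ᵐ T*M is what makes the
action linear over functions. -/
theorem IsRoot.densPair_smul (h : IsRoot pt q) (S : SkewAlgebroid R E) (f : R) (X : E)
    (κ : Density R E n m) :
    (densPair S m (f • X)).lieAlt κ = f • (densPair S m X).lieAlt κ := by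
  ext φ v
  rw [densPair_apply, AlternatingMap.smul_apply, AlternatingMap.smul_apply, densPair_apply]
  simp only [densityAct]
  have h1 : ∀ θ, S.lieDual (f • X) θ = f • S.lieDual X θ +
      Module.Dual.eval R E X θ • S.dFun f := by
    intro θ
    ext Y
    simp only [SkewAlgebroid.lieDual, SkewAlgebroid.dFun, S.smul_bracket, LinearMap.coe_mk,
      AddHom.coe_mk, LinearMap.add_apply, LinearMap.smul_apply, map_smul, map_sub, smul_eq_mul,
      Derivation.smul_apply, Module.Dual.eval_apply]
    ring
  let η : Module.Dual R (Derivation ℝ R R) :=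
    { toFun := fun D => D f, map_add' := fun _ _ => rfl, map_smul' := fun _ _ => rfl }
  have h2 : ∀ D : Derivation ℝ R R, ⁅S.anchor (f • X), D⁆ =
      f • ⁅S.anchor X, D⁆ - η D • S.anchor X := by
    intro D
    ext g
    simp only [map_smul, Derivation.commutator_apply, Derivation.smul_apply, smul_eq_mul,
      Derivation.leibniz, Derivation.sub_apply]
    show _ = _ - D f * _
    ring
  have t1 := congrArg (fun u : (Derivation ℝ R R) [⋀^Fin m]→ₗ[R] R => u v)
    (sum_update_rankOne h.free (h.sepR.alt m) κ (Module.Dual.eval R E X) (S.dFun f) φ)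
  have t2 := sum_update_rankOne h.freeDer h.sepR (κ φ) η (S.anchor X) v
  have e1 : Module.Dual.eval R E X (S.dFun f) = S.anchor X f := rfl
  have e2 : η (S.anchor X) = S.anchor X f := rfl
  simp only [alt_sum_apply, AlternatingMap.smul_apply, smul_eq_mul, e1] at t1
  simp only [e2, smul_eq_mul] at t2
  simp only [h1, h2, AlternatingMap.map_update_add, AlternatingMap.map_update_sub,
    AlternatingMap.add_apply, Finset.sum_add_distrib, Finset.sum_sub_distrib, t1, t2]
  simp only [AlternatingMap.map_update_smul, AlternatingMap.smul_apply,
    smul_eq_mul, map_smul, Derivation.smul_apply, ← Finset.mul_sum]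
  ring

theorem densPair_add (S : SkewAlgebroid R E) (X Y : E) (κ : Density R E n m) :
    (densPair S m (X + Y)).lieAlt κ =
      (densPair S m X).lieAlt κ + (densPair S m Y).lieAlt κ := by
  ext φ v
  have h1 : ∀ θ, S.lieDual (X + Y) θ = S.lieDual X θ + S.lieDual Y θ := by
    intro θ
    ext Z
    simp only [SkewAlgebroid.lieDual, S.add_bracket, LinearMap.coe_mk, AddHom.coe_mk,
      LinearMap.add_apply, map_add, Derivation.add_apply]
    ring
  simp only [AlternatingMap.add_apply, densPair_apply, densityAct, h1, map_add, add_lie,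
    AlternatingMap.map_update_add, Finset.sum_add_distrib, Derivation.add_apply]
  ring

theorem densPair_bracket (S : LieAlgebroid R E) (X Y : E) (κ : Density R E n m) :
    (densPair S.toSkewAlgebroid m (S.bracket X Y)).lieAlt κ =
      (densPair S.toSkewAlgebroid m X).lieAlt ((densPair S.toSkewAlgebroid m Y).lieAlt κ) -
      (densPair S.toSkewAlgebroid m Y).lieAlt ((densPair S.toSkewAlgebroid m X).lieAlt κ) := by
  refine DerPair.lieAlt_comm _ _ _ (fun θ => ?_) (fun μ => ?_) κ
  · ext Z
    simp only [densPair, AddMonoidHom.mk'_apply, SkewAlgebroid.lieDual, LinearMap.coe_mk,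
      AddHom.coe_mk, LinearMap.sub_apply, S.anchor_bracket, Derivation.commutator_apply, map_sub,
      S.jacobi X Y Z, map_add]
    ring
  · refine DerPair.lieAlt_comm _ _ _ (fun D => ?_) (fun f => ?_) μ
    · simp only [fieldPair, AddMonoidHom.mk'_apply, S.anchor_bracket, lie_lie]
    · simp only [fieldPair, AddMonoidHom.mk'_apply, S.anchor_bracket, Derivation.commutator_apply]

/-- The square root of the natural representation on densities. -/
theorem IsRoot.exists_rep (h : IsRoot pt q) (hg : Glueable pt Q) (S : LieAlgebroid R E) :
    ∃ ρ : Representation S.toSkewAlgebroid Q, IsRootOf S.toSkewAlgebroid q ρ := by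
  have hex := fun X => h.exists_root hg (densPair S.toSkewAlgebroid m X)
  choose T hT1 hT2 using hex
  have hsym : ∀ X, (densPair S.toSkewAlgebroid m X).sym = S.anchor X := fun X => rfl
  simp only [hsym] at hT1
  -- Each axiom equates two operators with the same symbol which are roots of the same derivative of
  -- densities, so uniqueness of roots proves it.
  refine ⟨{ act := fun X => T X, add_act := ?_, smul_act := ?_, act_add := fun X => map_add _,
            act_smul := fun X => hT1 X, flat := ?_ }, (isRootOf_iff _ _).2 hT2⟩
  · intro X Y
    refine DFunLike.congr_fun (h.unique (S.anchor (X + Y)) (T (X + Y)) (T X + T Y) (hT1 _)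
      (fun f a => ?_) (fun a b => ?_))
    · simp only [AddMonoidHom.add_apply, hT1, map_add, Derivation.add_apply, add_smul, smul_add]
      abel
    · rw [hT2, densPair_add, ← hT2, ← hT2]
      simp only [AddMonoidHom.add_apply, map_add, LinearMap.add_apply]
      abel
  · intro f X
    refine DFunLike.congr_fun (h.unique (S.anchor (f • X)) (T (f • X))
      (AddMonoidHom.mk' (fun a => f • T X a) fun a b => by rw [map_add, smul_add]) (hT1 _)
      (fun g a => ?_) (fun a b => ?_))
    · simp only [AddMonoidHom.mk'_apply, hT1, map_smul, Derivation.smul_apply, smul_add, smul_eq_mul,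
        mul_smul, smul_comm f g]
    · rw [hT2, h.densPair_smul, ← hT2]
      simp [smul_add]
  · intro X Y
    refine DFunLike.congr_fun (h.unique (S.anchor (S.bracket X Y)) (T (S.bracket X Y))
      ((T X).comp (T Y) - (T Y).comp (T X)) (hT1 _)
      (fun g a => ?_) (fun a b => ?_))
    · simp only [AddMonoidHom.sub_apply, AddMonoidHom.comp_apply, hT1, map_add, S.anchor_bracket,
        Derivation.commutator_apply, sub_smul, smul_sub]
      abel
    · rw [hT2, densPair_bracket, ← hT2 Y, ← hT2 X a, DerPair.lieAlt_add, DerPair.lieAlt_add,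
        ← hT2, ← hT2, ← hT2, ← hT2]
      simp only [AddMonoidHom.sub_apply, AddMonoidHom.comp_apply, map_sub, bilin_sub_left]
      abel

theorem IsRoot.rep_unique (h : IsRoot pt q) (S : SkewAlgebroid R E) (ρ ρ' : Representation S Q)
    (hρ : IsRootOf S q ρ) (hρ' : IsRootOf S q ρ') : ρ = ρ' := by
  rw [isRootOf_iff] at hρ hρ'
  ext X a
  exact DFunLike.congr_fun (h.unique (S.anchor X) (AddMonoidHom.mk' (ρ.act X) (ρ.act_add X))
    (AddMonoidHom.mk' (ρ'.act X) (ρ'.act_add X)) (fun f a => ρ.act_smul X f a)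
    (fun f a => ρ'.act_smul X f a) (fun a b => (hρ X a b).trans (hρ' X a b).symm)) a

end Rep

end Root

/-! ## The duality between multivectors and forms -/

section Frames

variable {R : Type*} [CommRing R] [Algebra ℝ R] {M : Type*} {pt : M → R →+* ℝ}
variable {V : Type*} [AddCommGroup V] [Module R V]
variable {W : Type*} [AddCommGroup W] [Module R W]

/-- The family concentrated in degree `j`. -/
def homog (j : ℕ) (a : V [⋀^Fin j]→ₗ[R] W) : Forms R V W := Pi.single j a

theorem homog_same (j : ℕ) (a : V [⋀^Fin j]→ₗ[R] W) : homog j a j = a := by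
  rw [homog, Pi.single_eq_same]

theorem homog_ne {j k : ℕ} (h : k ≠ j) (a : V [⋀^Fin j]→ₗ[R] W) : homog j a k = 0 := by
  rw [homog, Pi.single_eq_of_ne h]

theorem homog_smul (f : R) (j : ℕ) (a : V [⋀^Fin j]→ₗ[R] W) :
    homog j (f • a) = f • homog j a := by
  rw [homog, homog, ← Pi.single_smul]

theorem homog_add (j : ℕ) (a b : V [⋀^Fin j]→ₗ[R] W) :
    homog j (a + b) = homog j a + homog j b := by
  rw [homog, homog, homog, ← Pi.single_add]

theorem homog_zero (j : ℕ) : homog (R := R) (V := V) (W := W) j 0 = 0 := by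
  rw [homog, Pi.single_zero]

theorem contr_homog_succ (v : V) (j : ℕ) (a : V [⋀^Fin (j + 1)]→ₗ[R] W) :
    contr v (homog (j + 1) a) = homog j (a.curryLeft v) := by
  funext k
  show (homog (j + 1) a (k + 1)).curryLeft v = _
  by_cases h : k = j
  · subst h; rw [homog_same, homog_same]
  · rw [homog_ne (by omega), homog_ne h]; rfl

theorem contr_homog_zero (v : V) (a : V [⋀^Fin 0]→ₗ[R] W) : contr v (homog 0 a) = 0 := by
  funext k
  show (homog 0 a (k + 1)).curryLeft v = _
  rw [homog_ne (by omega)]; rfl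

theorem extMul_succ (η : Module.Dual R V) (w : Forms R V W) (j : ℕ) :
    extMul η w (j + 1) = AlternatingMap.alternatizeUncurryFin (η.smulRight (w j)) := rfl

theorem extMul_homog (η : Module.Dual R V) (j : ℕ) (a : V [⋀^Fin j]→ₗ[R] W) :
    extMul η (homog j a) =
      homog (j + 1) (AlternatingMap.alternatizeUncurryFin (η.smulRight a)) := by
  funext k
  cases k with
  | zero => rw [extMul_zero_apply, homog_ne (by omega)]
  | succ k =>
    rw [extMul_succ]
    by_cases h : k = j
    · subst h; rw [homog_same, homog_same]
    · rw [homog_ne h, homog_ne (by omega), LinearMap.smulRight_zero]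
      exact map_zero AlternatingMap.alternatizeUncurryFinLM

theorem separated_forms (hW : Separated pt W) : Separated pt (Forms R V W) :=
  Separated.pi fun _ => hW.alt _

/-- Euler's formula: up to χ, the sum of eⁱ ∧ ι_{eᵢ} is the degree operator, since each of the j
slots reproduces the form once. -/
theorem Frame.sum_extMul_contr {x : M} {n : ℕ} (F : Frame pt x V n) (w : Forms R V W) (j : ℕ) :
    (∑ i, extMul (F.coord i) (contr (F.e i) w)) j = ((j : R) * F.χ) • w j := by
  cases j with
  | zero => simp [Finset.sum_apply, extMul_zero_apply]
  | succ j =>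
    ext y
    rw [Finset.sum_apply, alt_sum_apply]
    simp only [extMul_def, altSum_succ_apply, LinearMap.smulRight_apply, Pi.smul_apply,
      AlternatingMap.smul_apply, contr_apply]
    rw [Finset.sum_comm]
    have key : ∀ t : Fin (j + 1), ∑ i, (-1 : ℤ) ^ (t : ℕ) • F.coord i (y t) •
        w (j + 1) (Fin.cons (F.e i) (t.removeNth y) : Fin (j + 1) → V) =
        F.χ • w (j + 1) y := by
      intro t
      have h1 : ∀ v, w (j + 1) (Fin.cons v (t.removeNth y) : Fin (j + 1) → V) =
        (w (j + 1)).curryLeft v (t.removeNth y) := fun v => rfl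
      have h2 : ∑ i, F.coord i (y t) • (w (j + 1)).curryLeft (F.e i) (t.removeNth y) =
          F.χ • (w (j + 1)).curryLeft (y t) (t.removeNth y) := by
        simp only [← AlternatingMap.smul_apply, ← map_smul]
        rw [← alt_sum_apply, ← map_sum, ← F.expand]
      rw [← Finset.smul_sum]
      simp only [h1]
      rw [h2, smul_comm]
      congr 1
      have := (w (j + 1)).neg_one_pow_smul_map_insertNth t (y t) (t.removeNth y)
      rw [Fin.insertNth_self_removeNth] at this
      rw [AlternatingMap.curryLeft_apply_apply, ← this, smul_smul, ← pow_add,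
        Even.neg_one_pow ⟨_, rfl⟩, one_smul]
    rw [Finset.sum_congr rfl fun t _ => key t]
    rw [Finset.sum_const, Finset.card_univ, Fintype.card_fin, mul_smul, ← Nat.cast_smul_eq_nsmul R]

theorem Frame.sum_contr_extMul {x : M} {n : ℕ} (F : Frame pt x V n) (w : Forms R V W) (j : ℕ) :
    (∑ i, contr (F.e i) (extMul (F.coord i) w)) j = (((n : R) - j) * F.χ) • w j := by
  simp only [contr_extMul, Finset.sum_sub_distrib, F.coord_e, if_true, Finset.sum_const,
    Finset.card_univ, Fintype.card_fin]
  rw [Pi.sub_apply, F.sum_extMul_contr, sub_mul, sub_smul, ← Nat.cast_smul_eq_nsmul R]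
  simp only [mul_smul, Pi.smul_apply]

theorem sum_homog {n : ℕ} (hV : LocallyFree pt V n) (hW : Separated pt W) (w : Forms R V W) :
    w = ∑ j ∈ Finset.range (n + 1), homog j (w j) := by
  funext k
  rw [Finset.sum_apply]
  by_cases h : k ∈ Finset.range (n + 1)
  · rw [Finset.sum_eq_single k (fun j _ hj => homog_ne (Ne.symm hj) _) (fun h' => absurd h h'),
      homog_same]
  · rw [Finset.mem_range] at h
    rw [alt_eq_zero_of_lt hV hW (by omega) (w k)]
    exact (alt_eq_zero_of_lt hV hW (by omega) _).symm

theorem pt_natCast_ne (x : M) {j : ℕ} (h : j ≠ 0) : pt x (j : R) ≠ 0 := by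
  rw [map_natCast]; exact_mod_cast h

/-- The sign operator `w ↦ ((-1)ʲ wⱼ)ⱼ`. -/
def sgn : Forms R V W →ₗ[R] Forms R V W where
  toFun w j := (-1 : ℤ) ^ j • w j
  map_add' w w' := by funext j; exact smul_add _ _ _
  map_smul' f w := by funext j; exact smul_comm ((-1 : ℤ) ^ j) f (w j)

theorem sgn_apply (w : Forms R V W) (j : ℕ) : sgn w j = (-1 : ℤ) ^ j • w j := rfl

theorem sgn_sgn (w : Forms R V W) : sgn (sgn w) = w := by
  funext j
  rw [sgn_apply, sgn_apply, smul_smul, ← pow_add, Even.neg_one_pow ⟨_, rfl⟩, one_smul]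

theorem sgn_contr (v : V) (w : Forms R V W) : sgn (contr v w) = -contr v (sgn w) := by
  funext j; ext y
  rw [sgn_apply, AlternatingMap.smul_apply, contr_apply, Pi.neg_apply, AlternatingMap.neg_apply,
    contr_apply, sgn_apply, AlternatingMap.smul_apply, pow_succ, mul_neg_one, neg_smul, neg_neg]

theorem contr_sgn (v : V) (w : Forms R V W) : contr v (sgn w) = -sgn (contr v w) := by
  rw [sgn_contr, neg_neg]

theorem sgn_lie (δ : DerPair R V W) (w : Forms R V W) : sgn (δ.lie w) = δ.lie (sgn w) := by
  funext j; ext y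
  simp only [sgn_apply, AlternatingMap.smul_apply, DerPair.lie_apply, DerPair.lieAlt_apply,
    smul_sub, map_zsmul, Finset.smul_sum]

theorem sgn_extMul (η : Module.Dual R V) (w : Forms R V W) :
    sgn (extMul η w) = -extMul η (sgn w) := by
  rw [← add_eq_zero_iff_eq_neg]
  refine eq_zero_of_contr (fun w => sgn (extMul η w) + extMul η (sgn w)) 1
    (fun w => ?_) (fun v w => ?_) w
  · simp [sgn_apply, extMul_zero_apply]
  · simp only [map_add, contr_sgn, contr_extMul, map_sub, map_smul, one_smul, map_neg]
    abel

theorem sgn_dForm {E : Type*} [AddCommGroup E] [Module R E] (S : SkewAlgebroid R E)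
    (ρ : Representation S W) (w : Forms R E W) :
    sgn (dForm S ρ w) = -dForm S ρ (sgn w) := by
  rw [← add_eq_zero_iff_eq_neg]
  refine eq_zero_of_contr (fun w => sgn (dForm S ρ w) + dForm S ρ (sgn w)) 1
    (fun w => ?_) (fun v w => ?_) w
  · simp [sgn_apply, dForm_zero]
  · simp only [map_add, contr_sgn, contr_dForm, map_sub, sgn_lie, map_neg, one_smul]
    abel

end Frames

/-! ### The isomorphism T from multivectors to forms -/

section Star

variable {R : Type*} [CommRing R] [Algebra ℝ R] {M : Type*} {pt : M → R →+* ℝ}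
variable {E : Type*} [AddCommGroup E] [Module R E]
variable {P : Type*} [AddCommGroup P] [Module R P]
variable {n : ℕ}

/-- The operator `X ∧ ·` on families of multivectors. -/
abbrev wedgeOp (X : E) : Forms R (Module.Dual R E) P →ₗ[R] Forms R (Module.Dual R E) P :=
  extMul (Module.Dual.eval R E X)

theorem wedgeOp_succ (X : E) (w : Forms R (Module.Dual R E) P) (j : ℕ) :
    wedgeOp X w (j + 1) = wedge X (w j) := rfl

theorem wedgeOp_homog (X : E) (j : ℕ) (a : Spinor R E P j) :
    wedgeOp X (homog j a) = homog (j + 1) (wedge X a) := extMul_homog _ _ _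

theorem wedgeOp_add (X Y : E) (w : Forms R (Module.Dual R E) P) :
    wedgeOp (X + Y) w = wedgeOp X w + wedgeOp Y w := by
  simp only [wedgeOp, map_add]; exact add_extMul _ _ _

theorem wedgeOp_smul (f : R) (X : E) (w : Forms R (Module.Dual R E) P) :
    wedgeOp (f • X) w = f • wedgeOp X w := by
  simp only [wedgeOp, map_smul]; exact smul_extMul _ _ _

/-- `X ∧ ·`, as a linear function of `X`. -/
def wedgeLin : E →ₗ[R] Module.End R (Forms R (Module.Dual R E) P) where
  toFun X := wedgeOp X
  map_add' X Y := LinearMap.ext fun w => wedgeOp_add X Y w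
  map_smul' f X := LinearMap.ext fun w => wedgeOp_smul f X w

theorem wedgeLin_apply (X : E) (w : Forms R (Module.Dual R E) P) :
    wedgeLin X w = wedgeOp X w := rfl

theorem wedgeLin_mul_self (X : E) :
    wedgeLin X * wedgeLin X = (0 : Module.End R (Forms R (Module.Dual R E) P)) := by
  apply LinearMap.ext
  intro w
  rw [Module.End.mul_apply, wedgeLin_apply, wedgeLin_apply, wedgeOp, extMul_self]
  rfl

/-- The action of the exterior algebra on multivectors. -/
def wedgeLift : ExteriorAlgebra R E →ₐ[R] Module.End R (Forms R (Module.Dual R E) P) :=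
  ExteriorAlgebra.lift R ⟨wedgeLin, wedgeLin_mul_self⟩

theorem wedgeLift_ι (X : E) (w : Forms R (Module.Dual R E) P) :
    wedgeLift (ExteriorAlgebra.ι R X) w = wedgeOp X w := by
  rw [wedgeLift, ExteriorAlgebra.lift_ι_apply]; rfl

theorem wedgeLift_succ {k : ℕ} (X : Fin (k + 1) → E) (w : Forms R (Module.Dual R E) P) :
    wedgeLift (ExteriorAlgebra.ιMulti R (k + 1) X) w =
      wedgeOp (X 0) (wedgeLift (ExteriorAlgebra.ιMulti R k (Fin.tail X)) w) := by
  rw [ExteriorAlgebra.ιMulti_succ_apply, map_mul, Module.End.mul_apply, wedgeLift_ι]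
  rfl

theorem wedgeLift_zero (X : Fin 0 → E) (w : Forms R (Module.Dual R E) P) :
    wedgeLift (ExteriorAlgebra.ιMulti R 0 X) w = w := by
  rw [ExteriorAlgebra.ιMulti_zero_apply, map_one]; rfl

theorem wedgeLift_wedgeOp {k : ℕ} (Y : Fin k → E) (X : E) (w : Forms R (Module.Dual R E) P) :
    wedgeLift (ExteriorAlgebra.ιMulti R k Y) (wedgeOp X w) =
      (-1 : ℤ) ^ k • wedgeOp X (wedgeLift (ExteriorAlgebra.ιMulti R k Y) w) := by
  induction k with
  | zero => simp
  | succ k ih =>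
    rw [wedgeLift_succ, wedgeLift_succ, ih, map_zsmul, wedgeOp, wedgeOp, extMul_extMul, pow_succ,
      mul_neg_one, neg_smul, smul_neg]

variable (n) in
/-- The isomorphism `T`, on families. -/
def starForm : Forms R (Module.Dual R E) P →ₗ[R] Forms R E (Spinor R E P n) where
  toFun w k := (LinearMap.proj n ∘ₗ LinearMap.applyₗ w ∘ₗ wedgeLift.toLinearMap).compAlternatingMap
    (ExteriorAlgebra.ιMulti R k)
  map_add' w w' := by
    funext k; ext1 Y
    exact congrFun (map_add (wedgeLift (ExteriorAlgebra.ιMulti R k Y)) w w') n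
  map_smul' f w := by
    funext k; ext1 Y
    exact congrFun (map_smul (wedgeLift (ExteriorAlgebra.ιMulti R k Y)) f w) n

theorem starForm_apply (w : Forms R (Module.Dual R E) P) (k : ℕ) (Y : Fin k → E) :
    starForm n w k Y = wedgeLift (ExteriorAlgebra.ιMulti R k Y) w n := rfl

/-- T turns X ∧ · into contraction with X; the sign comes from moving X in front of the k vectors
Yᵢ. -/
theorem starForm_wedgeOp (X : E) (w : Forms R (Module.Dual R E) P) :
    starForm n (wedgeOp X w) = sgn (contr X (starForm n w)) := by
  funext k; ext1 Y
  rw [starForm_apply, wedgeLift_wedgeOp, sgn_apply, AlternatingMap.smul_apply, contr_apply,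
    starForm_apply, wedgeLift_succ]
  rfl

theorem wedgeLift_wedges {k : ℕ} (X : Fin k → E) (w : Forms R (Module.Dual R E) P) (j : ℕ) :
    wedgeLift (ExteriorAlgebra.ιMulti R k X) w (j + k) = wedges (w j) k X := by
  induction k with
  | zero => rw [wedgeLift_zero]; rfl
  | succ k ih =>
    rw [wedgeLift_succ]
    show wedge (X 0) (wedgeLift (ExteriorAlgebra.ιMulti R k (Fin.tail X)) w (j + k)) = _
    rw [ih]; rfl

theorem starForm_eq_star {j k : ℕ} (h : j + k = n) (w : Forms R (Module.Dual R E) P)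
    (X : Fin k → E) : starForm n w k X = star h (w j) X := by
  subst h
  rw [starForm_apply, wedgeLift_wedges]
  rfl

theorem star_wedge {j k : ℕ} (h : (j + 1) + k = n) (h' : j + (k + 1) = n) (a : Spinor R E P j)
    (X : E) (Y : Fin k → E) :
    star h (wedge X a) Y = (-1 : ℤ) ^ k • star h' a (Fin.cons X Y : Fin (k + 1) → E) := by
  have h1 := starForm_eq_star h (wedgeOp X (homog j a)) Y
  rw [wedgeOp_succ, homog_same, starForm_wedgeOp, sgn_apply, AlternatingMap.smul_apply,
    contr_apply, starForm_eq_star h', homog_same] at h1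
  exact h1.symm

/-- Summing the contractions of e_i ∧ a with the dual frame gives (n - j) χ a, and n - j is
invertible because j < n. -/
theorem wedge_injective (hE : LocallyFree pt E n) (hP : Separated pt P) {j : ℕ} (hj : j < n)
    (a : Spinor R E P j) (ha : ∀ X, wedge X a = 0) : a = 0 := by
  refine hP.alt j _ fun x => ?_
  obtain ⟨F⟩ := hE x
  have h := F.dual.sum_contr_extMul (homog j a) j
  have h0 : ∀ i, extMul (F.dual.coord i) (homog j a) = 0 := fun i => by
    have := wedgeOp_homog (F.e i) j a
    rw [ha] at this
    exact this.trans (homog_zero _)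
  simp only [h0, map_zero, Finset.sum_const_zero, homog_same] at h
  refine ⟨_, ?_, h.symm⟩
  refine pt_mul_ne ?_ F.pt_ne
  rw [← Nat.cast_sub hj.le]
  exact pt_natCast_ne x (by omega)

theorem star_injective (hE : LocallyFree pt E n) (hP : Separated pt P) {k j : ℕ} (h : j + k = n)
    (a : Spinor R E P j) (ha : ∀ X, star h a X = 0) : a = 0 := by
  induction k generalizing j with
  | zero => subst h; exact ha ![]
  | succ k ih =>
    refine wedge_injective hE hP (by omega) a fun X => ?_
    refine ih (by omega) _ fun Y => ?_
    rw [star_wedge _ h, ha, smul_zero]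

theorem star_sub {j k : ℕ} (h : j + k = n) (a b : Spinor R E P j) (X : Fin k → E) :
    star h (a - b) X = star h a X - star h b X := by
  have h1 := starForm_eq_star h (homog j a - homog j b) X
  have e : starForm n (homog j a - homog j b) k X =
    starForm n (homog j a) k X - starForm n (homog j b) k X := by rw [map_sub]; rfl
  rw [e, starForm_eq_star h, starForm_eq_star h, Pi.sub_apply, homog_same, homog_same] at h1
  exact h1.symm

theorem star_add {j k : ℕ} (h : j + k = n) (a b : Spinor R E P j) (X : Fin k → E) :
    star h (a + b) X = star h a X + star h b X := by
  have h1 := star_sub h (a + b) b X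
  rw [add_sub_cancel_right] at h1
  rw [h1, sub_add_cancel]

theorem star_smul {j k : ℕ} (h : j + k = n) (f : R) (a : Spinor R E P j) (X : Fin k → E) :
    star h (f • a) X = f • star h a X := by
  have h1 := starForm_eq_star h (f • homog j a) X
  rw [map_smul, Pi.smul_apply, AlternatingMap.smul_apply, starForm_eq_star h, Pi.smul_apply,
    homog_same] at h1
  exact h1.symm

theorem star_ext (hE : LocallyFree pt E n) (hP : Separated pt P) {k j : ℕ} (h : j + k = n)
    {a b : Spinor R E P j} (hab : ∀ X, star h a X = star h b X) : a = b := by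
  rw [← sub_eq_zero]
  exact star_injective hE hP h _ fun X => by rw [star_sub, hab, sub_self]

/-- The linear map `a ↦ (X ↦ X ∧ a)`. -/
def wedgeFam (j : ℕ) : Spinor R E P j →ₗ[R] (E → Spinor R E P (j + 1)) where
  toFun a X := wedge X a
  map_add' a b := by
    funext X
    have h := congrFun (map_add (wedgeOp (P := P) X) (homog j a) (homog j b)) (j + 1)
    simpa only [← homog_add, wedgeOp_homog, homog_same, Pi.add_apply] using h
  map_smul' f a := by
    funext X
    have h := congrFun (map_smul (wedgeOp (P := P) X) f (homog j a)) (j + 1)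
    simpa only [← homog_smul, wedgeOp_homog, homog_same, Pi.smul_apply, RingHom.id_apply] using h

/-- The exactness which inverts T by one degree: a linear family with X ∧ b(X) = 0 comes from a
single multivector. Uniqueness is `wedge_injective`, so only local solutions are needed. -/
theorem exists_wedge_eq (hE : LocallyFree pt E n) (hP : Separated pt P) (hPg : Glueable pt P)
    {j : ℕ} (hj : j < n) (b : E →ₗ[R] Spinor R E P (j + 1)) (hb : ∀ X, wedge X (b X) = 0) :
    ∃ a : Spinor R E P j, ∀ X, wedge X a = b X := by
  have hpol : ∀ X Y, wedgeOp X (homog (j + 1) (b Y)) = -wedgeOp Y (homog (j + 1) (b X)) := by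
    intro X Y
    have h0 : ∀ X, wedgeOp X (homog (j + 1) (b X)) = 0 := fun X => by
      rw [wedgeOp_homog, hb]; exact homog_zero _
    have h1 := h0 (X + Y)
    rw [map_add, homog_add, map_add, wedgeOp_add, wedgeOp_add, h0, h0, zero_add, add_zero,
      add_comm] at h1
    exact eq_neg_of_add_eq_zero_left h1
  suffices H : ∀ x, ∃ (χ : R) (p : Spinor R E P j), pt x χ ≠ 0 ∧
      wedgeFam j p = χ • fun X => b X by
    obtain ⟨a, ha⟩ := exists_of_local (hPg.alt hP j) (Separated.pi fun _ => hP.alt (j + 1))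
      (wedgeFam (R := R) (E := E) (P := P) j)
      (fun a ha => wedge_injective hE hP hj a fun X => congrFun ha X) (fun X => b X) H
    exact ⟨a, fun X => congrFun ha X⟩
  · intro x
    obtain ⟨F⟩ := hE x
    -- If b(X) = X ∧ a, then contracting b(eᵢ) with eⁱ and summing gives (n - j) χ a. Conversely the
    -- constant arises as 1 + (n - (j + 1)): the 1 from expanding X in the frame, the rest from
    -- Euler's formula in degree j + 1.
    refine ⟨((n : R) - j) * F.χ, ∑ i, (b (F.e i)).curryLeft (F.coord i), ?_, ?_⟩
    · refine pt_mul_ne ?_ F.pt_ne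
      rw [← Nat.cast_sub hj.le]
      exact pt_natCast_ne x (by omega)
    · funext X
      have hh : homog j (∑ i, (b (F.e i)).curryLeft (F.coord i)) =
          ∑ i, contr (F.coord i) (homog (j + 1) (b (F.e i))) := by
        simp only [contr_homog_succ]
        exact map_sum (AddMonoidHom.mk' (homog (R := R) (V := Module.Dual R E) (W := P) j)
          (homog_add j)) _ _
      have h1 : wedgeOp X (homog j (∑ i, (b (F.e i)).curryLeft (F.coord i))) (j + 1) =
          (((n : R) - j) * F.χ) • b X := by
        rw [hh, map_sum]
        have h2 : ∀ i, wedgeOp X (contr (F.coord i) (homog (j + 1) (b (F.e i)))) =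
            F.coord i X • homog (j + 1) (b (F.e i)) +
              contr (F.coord i) (wedgeOp (F.e i) (homog (j + 1) (b X))) := by
          intro i
          have h3 := contr_extMul (Module.Dual.eval R E X) (F.coord i)
            (homog (j + 1) (b (F.e i)))
          rw [hpol X (F.e i), map_neg] at h3
          rw [← sub_eq_zero, sub_add_eq_sub_sub, sub_eq_zero]
          rw [eq_sub_iff_add_eq, neg_add_eq_iff_eq_add] at h3
          rw [sub_eq_iff_eq_add, ← Module.Dual.eval_apply R E X, ← h3]
        have h4 : ∑ i, F.coord i X • homog (j + 1) (b (F.e i)) = F.χ • homog (j + 1) (b X) := by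
          have := congrArg (fun a => homog (j + 1) a) (congrArg b (F.expand X))
          simp only [map_smul, map_sum, homog_smul] at this
          rw [this, ← Finset.sum_congr rfl fun i _ => homog_smul (F.coord i X) (j + 1) (b (F.e i))]
          exact (map_sum (AddMonoidHom.mk' (homog (R := R) (V := Module.Dual R E) (W := P) (j + 1))
            (homog_add (j + 1))) _ _).symm
        have h5 := F.dual.sum_contr_extMul (homog (j + 1) (b X)) (j + 1)
        rw [Finset.sum_congr rfl fun i _ => h2 i, Finset.sum_add_distrib, h4, Pi.add_apply]
        have h6 : (∑ i, contr (F.coord i) (wedgeOp (F.e i) (homog (j + 1) (b X)))) (j + 1) =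
          (((n : R) - (j + 1 : ℕ)) * F.χ) • homog (j + 1) (b X) (j + 1) := h5
        rw [h6, Pi.smul_apply, homog_same, ← add_smul]
        congr 1
        push_cast
        ring
      rw [wedgeOp_succ, homog_same] at h1
      exact h1

/-- Induction on k: the contractions of u with each X are images of some b(X), and `exists_wedge_eq`
assembles them. The condition X ∧ b(X) = 0 reflects that u is alternating. -/
theorem star_surjective (hE : LocallyFree pt E n) (hP : Separated pt P) (hPg : Glueable pt P)
    {k j : ℕ} (h : j + k = n) (u : E [⋀^Fin k]→ₗ[R] Spinor R E P n) :
    ∃ a : Spinor R E P j, ∀ X, star h a X = u X := by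
  induction k generalizing j with
  | zero =>
    subst h
    exact ⟨u ![], fun X => by rw [Subsingleton.elim X ![]]; rfl⟩
  | succ k ih =>
    have h' : (j + 1) + k = n := by omega
    choose b hb using fun X => ih h' ((-1 : ℤ) ^ k • u.curryLeft X)
    have hb' : ∀ X Y, star h' (b X) Y = (-1 : ℤ) ^ k • u (Fin.cons X Y : Fin (k + 1) → E) := hb
    let B : E →ₗ[R] Spinor R E P (j + 1) :=
      { toFun := b
        map_add' := fun X X' => star_ext hE hP h' fun Y => by
          rw [star_add, hb, hb, hb, map_add, smul_add]; rfl
        map_smul' := fun f X => star_ext hE hP h' fun Y => by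
          rw [RingHom.id_apply, star_smul, hb, hb, map_smul, smul_comm]; rfl }
    suffices H : ∀ X, wedge X (B X) = 0 by
      obtain ⟨a, ha⟩ := exists_wedge_eq hE hP hPg (by omega) B H
      refine ⟨a, fun X => ?_⟩
      have h1 := star_wedge h' h a (X 0) (Fin.tail X)
      rw [ha, Fin.cons_self_tail] at h1
      have h2 : star h' (B (X 0)) (Fin.tail X) = (-1 : ℤ) ^ k • u X := by
        have := hb' (X 0) (Fin.tail X)
        rwa [Fin.cons_self_tail] at this
      rw [h2] at h1
      have h3 := congrArg (fun z => (-1 : ℤ) ^ k • z) h1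
      simp only [smul_smul, ← pow_add] at h3
      rw [Even.neg_one_pow ⟨k, rfl⟩, one_smul, one_smul] at h3
      exact h3.symm
    · intro X
      cases k with
      -- Here j + 1 = n, so X ∧ b(X) has degree n + 1.
      | zero => exact alt_eq_zero_of_lt hE.dual hP (by omega) _
      | succ k =>
        refine star_injective hE hP (show (j + 1 + 1) + k = n by omega) _ fun Y => ?_
        rw [star_wedge _ h']
        show _ • star h' (b X) _ = 0
        rw [hb', u.map_eq_zero_of_eq (i := 0) (j := 1) _ rfl (by simp),
          smul_zero, smul_zero]

theorem starForm_bijective (hE : LocallyFree pt E n) (hP : Separated pt P)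
    (hPg : Glueable pt P) :
    Function.Bijective (starForm (R := R) (E := E) (P := P) n) := by
  constructor
  · rw [injective_iff_map_eq_zero]
    intro w hw
    funext j
    by_cases hj : j ≤ n
    · have h : j + (n - j) = n := by omega
      refine star_injective hE hP h _ fun X => ?_
      rw [← starForm_eq_star h]
      exact congrArg (fun u : E [⋀^Fin (n - j)]→ₗ[R] Spinor R E P n => u X) (congrFun hw (n - j))
    · exact alt_eq_zero_of_lt hE.dual hP (by omega) _
  · intro u
    have hex : ∀ j, ∃ a : Spinor R E P j, ∀ (h : j + (n - j) = n) X,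
        star h a X = u (n - j) X := by
      intro j
      by_cases h : j + (n - j) = n
      · obtain ⟨a, ha⟩ := star_surjective hE hP hPg h (u (n - j))
        exact ⟨a, fun _ => ha⟩
      · exact ⟨0, fun h' => absurd h' h⟩
    choose w hw using hex
    refine ⟨w, ?_⟩
    funext k
    by_cases hk : k ≤ n
    · obtain ⟨j, rfl⟩ := Nat.exists_eq_add_of_le' hk
      ext1 X
      rw [starForm_eq_star rfl]
      have := hw j (by omega)
      have e : j + k - j = k := by omega
      revert this
      generalize_proofs pf
      revert pf
      rw [e]
      exact fun _ H => H X
    · rw [alt_eq_zero_of_lt hE (hP.alt n) (by omega) (u k)]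
      exact alt_eq_zero_of_lt hE (hP.alt n) (by omega) _

end Star

/-! ## The divergence operator of a representation -/

section Generation

variable {R : Type*} [CommRing R] [Algebra ℝ R] {M : Type*} {pt : M → R →+* ℝ}
variable {E : Type*} [AddCommGroup E] [Module R E]
variable {P : Type*} [AddCommGroup P] [Module R P]
variable {V : Type*} [AddCommGroup V] [Module R V]
variable {n : ℕ}

variable (R V) in
/-- An element of `P`, as a family of forms concentrated in degree zero. -/
def constForm : P →ₗ[R] Forms R V P where
  toFun l := homog 0 (AlternatingMap.constOfIsEmpty R V (Fin 0) l)
  map_add' l l' := by rw [← homog_add]; rfl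
  map_smul' f l := by rw [RingHom.id_apply, ← homog_smul]; rfl

theorem constForm_zero_apply (l : P) (y : Fin 0 → V) : constForm R V l 0 y = l := by
  show homog 0 (AlternatingMap.constOfIsEmpty R V (Fin 0) l) 0 y = l
  rw [homog_same]; rfl

theorem constForm_succ (l : P) (j : ℕ) : constForm R V l (j + 1) = 0 :=
  homog_ne (j := 0) (k := j + 1) (by omega) (AlternatingMap.constOfIsEmpty R V (Fin 0) l)

theorem homog_zero_eq_constForm (a : V [⋀^Fin 0]→ₗ[R] P) :
    homog 0 a = constForm R V (a ![]) := by
  show _ = homog 0 _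
  congr 1
  ext y
  rw [Subsingleton.elim y ![]]; rfl

theorem contr_constForm (v : V) (l : P) : contr v (constForm R V l) = 0 :=
  contr_homog_zero v _

/-- A linear operator which commutes up to sign with the operators `X ∧ ·` and which vanishes in
degree zero is zero. -/
theorem eq_zero_of_wedgeOp (hE : LocallyFree pt E n) (hP : Separated pt P)
    (O : Forms R (Module.Dual R E) P →ₗ[R] Forms R (Module.Dual R E) P) (s : ℤ)
    (hO : ∀ X w, O (wedgeOp X w) = s • wedgeOp X (O w))
    (h0 : ∀ l, O (constForm R (Module.Dual R E) l) = 0) (w : Forms R (Module.Dual R E) P) :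
    O w = 0 := by
  have hZ : Separated pt (Forms R (Module.Dual R E) P) := separated_forms hP
  have key : ∀ j (a : (Module.Dual R E) [⋀^Fin j]→ₗ[R] P), O (homog j a) = 0 := by
    intro j
    induction j with
    | zero => intro a; rw [homog_zero_eq_constForm, h0]
    | succ j ih =>
      intro a
      refine hZ _ fun x => ?_
      obtain ⟨F⟩ := hE x
      refine ⟨((j + 1 : ℕ) : R) * F.χ, pt_mul_ne (pt_natCast_ne x (by omega)) F.pt_ne, ?_⟩
      -- Euler's formula writes a multiple of a as a sum of products eᵢ ∧ (degree j), to which the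
      -- induction hypothesis applies.
      have h1 : (((j + 1 : ℕ) : R) * F.χ) • homog (j + 1) a =
          ∑ i, wedgeOp (F.e i) (contr (F.coord i) (homog (j + 1) a)) := by
        funext k
        refine Eq.trans ?_ (F.dual.sum_extMul_contr _ k).symm
        rw [Pi.smul_apply]
        by_cases hk : k = j + 1
        · subst hk; rfl
        · rw [homog_ne hk, smul_zero, smul_zero]
      rw [← map_smul, h1, map_sum]
      refine Finset.sum_eq_zero fun i _ => ?_
      rw [hO, contr_homog_succ, ih, map_zero, smul_zero]
  rw [sum_homog hE.dual hP w, map_sum]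
  exact Finset.sum_eq_zero fun j _ => key j _

end Generation

/-! ### The divergence D and its Cartan formula -/

section Divergence

variable {R : Type*} [CommRing R] [Algebra ℝ R] {M : Type*} {pt : M → R →+* ℝ}
variable {E : Type*} [AddCommGroup E] [Module R E]
variable {P : Type*} [AddCommGroup P] [Module R P]
variable {n : ℕ}

theorem wedge_zero (X : E) {j : ℕ} : wedge X (0 : Spinor R E P j) = 0 := by
  rw [PNDirac.wedge, LinearMap.smulRight_zero]
  exact map_zero AlternatingMap.alternatizeUncurryFinLM

/-- `D` corresponds to the differential of `S` under the isomorphism `starForm`. -/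
def IsDiv (S : SkewAlgebroid R E) (ρ : Representation S (Spinor R E P n))
    (D : Forms R (Module.Dual R E) P →+ Forms R (Module.Dual R E) P) : Prop :=
  ∀ w, starForm n (D w) = dForm S ρ (sgn (starForm n w))

theorem exists_isDiv (hE : LocallyFree pt E n) (hP : Separated pt P) (hPg : Glueable pt P)
    (S : SkewAlgebroid R E) (ρ : Representation S (Spinor R E P n)) : ∃ D, IsDiv S ρ D := by
  let e := LinearEquiv.ofBijective _ (starForm_bijective (R := R) (E := E) (P := P) hE hP hPg)
  refine ⟨(e.symm.toLinearMap.toAddMonoidHom.comp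
    ((dForm S ρ).comp (sgn ∘ₗ starForm n).toAddMonoidHom)), fun w => ?_⟩
  exact e.apply_symm_apply (dForm S ρ (sgn (starForm n w)))

theorem starForm_injective (hE : LocallyFree pt E n) (hP : Separated pt P) (hPg : Glueable pt P) :
    Function.Injective (starForm (R := R) (E := E) (P := P) n) :=
  (starForm_bijective hE hP hPg).1

variable {S : SkewAlgebroid R E} {ρ : Representation S (Spinor R E P n)}
  {D : Forms R (Module.Dual R E) P →+ Forms R (Module.Dual R E) P}

/-- Since T exchanges X ∧ · with contraction and D with the differential, this is Cartan's formula
carried over to multivectors. -/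
theorem IsDiv.wedge (hD : IsDiv S ρ D) (X : E) (w : Forms R (Module.Dual R E) P) :
    starForm n (D (wedgeOp X w) + wedgeOp X (D w)) = (repPair S ρ X).lie (starForm n w) := by
  rw [map_add, hD, starForm_wedgeOp, starForm_wedgeOp, hD, sgn_sgn, contr_dForm, map_sub, sgn_lie,
    sgn_sgn, sgn_dForm, sgn_contr, sgn_sgn, map_neg]
  abel

/-- D lowers degrees by exactly one: under T, degree j corresponds to degree n - j, whose component
of the differential involves only degree n - j - 1, that is, `w (j + 1)`. -/
theorem IsDiv.apply_eq_zero (hE : LocallyFree pt E n) (hP : Separated pt P) (hD : IsDiv S ρ D)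
    {w : Forms R (Module.Dual R E) P} {j : ℕ} (hw : w (j + 1) = 0) : D w j = 0 := by
  by_cases hj : j ≤ n
  · obtain ⟨k, rfl⟩ := Nat.exists_eq_add_of_le hj
    refine star_injective hE hP rfl _ fun X => ?_
    rw [← starForm_eq_star, hD]
    cases k with
    | zero => rw [dForm_zero]; rfl
    | succ k =>
      have h0 : starForm (j + (k + 1)) w k = 0 := by
        ext1 Y
        rw [starForm_eq_star (show (j + 1) + k = j + (k + 1) by omega), hw]
        have := star_sub (show (j + 1) + k = j + (k + 1) by omega) (0 : Spinor R E P (j + 1)) 0 Y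
        rw [sub_self, sub_self] at this
        exact this
      have h1 : diff S ρ (0 : E [⋀^Fin k]→ₗ[R] Spinor R E P (j + (k + 1))) = 0 := by
        have := diff_add S ρ (0 : E [⋀^Fin k]→ₗ[R] Spinor R E P (j + (k + 1))) 0
        rw [add_zero] at this
        exact left_eq_add.1 this
      rw [dForm_succ, sgn_apply, h0, smul_zero, h1]; rfl
  · exact alt_eq_zero_of_lt hE.dual hP (by omega) _

theorem IsDiv.constForm (hE : LocallyFree pt E n) (hP : Separated pt P) (hD : IsDiv S ρ D)
    (l : P) : D (constForm R _ l) = 0 := by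
  funext j
  exact hD.apply_eq_zero hE hP (constForm_succ l j)

/-- Transported back by T, the right side and contraction with α have the same anticommutators with
X ∧ · and both vanish in degree zero, so `eq_zero_of_wedgeOp` applies to their difference. -/
theorem starForm_contr (hE : LocallyFree pt E n) (hP : Separated pt P) (hPg : Glueable pt P)
    (α : Module.Dual R E) (w : Forms R (Module.Dual R E) P) :
    starForm n (contr α w) = extMul α (sgn (starForm n w)) := by
  let e := LinearEquiv.ofBijective _ (starForm_bijective (R := R) (E := E) (P := P) hE hP hPg)
  have he : ∀ u, starForm n (e.symm u) = u := e.apply_symm_apply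
  have h0 := eq_zero_of_wedgeOp hE hP
    (e.symm.toLinearMap ∘ₗ extMul α ∘ₗ sgn ∘ₗ starForm n - contr α) (-1) (fun X w => ?_)
    (fun l => ?_) w
  · rw [LinearMap.sub_apply, sub_eq_zero] at h0
    rw [← h0]
    exact he _
  · apply starForm_injective hE hP hPg
    simp only [LinearMap.sub_apply, LinearMap.comp_apply, LinearEquiv.coe_coe, map_sub, he,
      starForm_wedgeOp, sgn_sgn, neg_smul, one_smul, map_neg, contr_extMul, map_smul,
      sgn_extMul, sgn_contr, Module.Dual.eval_apply]
    abel
  · apply starForm_injective hE hP hPg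
    simp only [LinearMap.sub_apply, LinearMap.comp_apply, LinearEquiv.coe_coe, he,
      contr_constForm, map_zero, sub_zero]
    funext k
    by_cases hk : k ≤ n
    · cases k with
      | zero => rfl
      | succ k =>
        have : starForm n (PNDirac.constForm R (Module.Dual R E) l) k = 0 := by
          ext1 Y
          rw [starForm_eq_star (show (n - k) + k = n by omega)]
          obtain ⟨j, hj⟩ : ∃ j, n - k = j + 1 := ⟨n - k - 1, by omega⟩
          have hz : PNDirac.constForm R (Module.Dual R E) l (n - k) = 0 := by
            rw [hj]; exact constForm_succ l j
          rw [hz]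
          have := star_sub (show (n - k) + k = n by omega) (0 : Spinor R E P (n - k)) 0 Y
          rw [sub_self, sub_self] at this
          exact this
        rw [extMul_succ, sgn_apply, this, smul_zero, LinearMap.smulRight_zero]
        exact map_zero AlternatingMap.alternatizeUncurryFinLM
    · exact alt_eq_zero_of_lt hE (hP.alt n) (by omega) _

/-- D is a first-order operator: the symbol df ∧ · of the differential becomes contraction with df.
-/
theorem IsDiv.smul (hE : LocallyFree pt E n) (hP : Separated pt P) (hPg : Glueable pt P)
    (hD : IsDiv S ρ D) (f : R) (w : Forms R (Module.Dual R E) P) :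
    D (f • w) = f • D w + contr (S.dFun f) w := by
  apply starForm_injective hE hP hPg
  rw [hD, map_add, map_smul, map_smul, dForm_smul, map_smul, hD, starForm_contr hE hP hPg]

theorem IsDiv.wedge_smul (hE : LocallyFree pt E n) (hP : Separated pt P) (hPg : Glueable pt P)
    (hD : IsDiv S ρ D) (f : R) (X : E) (w : Forms R (Module.Dual R E) P) :
    D (wedgeOp X (f • w)) + wedgeOp X (D (f • w)) =
      f • (D (wedgeOp X w) + wedgeOp X (D w)) + S.anchor X f • w := by
  rw [map_smul, hD.smul hE hP hPg, hD.smul hE hP hPg, contr_extMul, map_add, map_smul, smul_add]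
  have : Module.Dual.eval R E X (S.dFun f) = S.anchor X f := rfl
  rw [this]
  abel

/-- The Lie derivative along `X` on `P` determined by `D`, together with the natural one on the
dual. -/
def divPair (hE : LocallyFree pt E n) (hP : Separated pt P) (hPg : Glueable pt P)
    (hD : IsDiv S ρ D) (X : E) : DerPair R (Module.Dual R E) P where
  sym := S.anchor X
  onV := (densPair S 0 X).onV
  onW := AddMonoidHom.mk' (fun l => D (wedgeOp X (constForm R _ l)) 0 ![]) (fun l l' => by
    rw [map_add, map_add, map_add]; rfl)
  onV_smul := (densPair S 0 X).onV_smul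
  onW_smul f l := by
    simp only [AddMonoidHom.mk'_apply, map_smul]
    rw [hD.smul hE hP hPg, contr_extMul, contr_constForm, map_zero, sub_zero, Pi.add_apply,
      AlternatingMap.add_apply, Pi.smul_apply, AlternatingMap.smul_apply, Pi.smul_apply,
      AlternatingMap.smul_apply, constForm_zero_apply]
    rfl

variable (hE : LocallyFree pt E n) (hP : Separated pt P) (hPg : Glueable pt P)
    (hD : IsDiv S ρ D)

theorem divPair_sym (X : E) : (divPair hE hP hPg hD X).sym = S.anchor X := rfl

theorem divPair_onV (X : E) (α : Module.Dual R E) :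
    (divPair hE hP hPg hD X).onV α = S.lieDual X α := rfl

theorem divPair_onW (X : E) (l : P) :
    (divPair hE hP hPg hD X).onW l = D (wedgeOp X (constForm R _ l)) 0 ![] := rfl

theorem IsDiv.wedge_constForm (X : E) (l : P) : D (wedgeOp X (PNDirac.constForm R _ l)) =
    PNDirac.constForm R _ ((divPair hE hP hPg hD X).onW l) := by
  funext j
  cases j with
  | zero =>
    ext y
    rw [constForm_zero_apply, divPair_onW, Subsingleton.elim y ![]]
  | succ j =>
    rw [constForm_succ]
    refine hD.apply_eq_zero hE hP ?_
    rw [wedgeOp_succ, constForm_succ]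
    exact wedge_zero X

theorem divPair_lie_wedge (X Y : E) (w : Forms R (Module.Dual R E) P) :
    (divPair hE hP hPg hD X).lie (wedgeOp Y w) =
      wedgeOp (S.bracket X Y) w + wedgeOp Y ((divPair hE hP hPg hD X).lie w) := by
  refine DerPair.lie_extMul _ _ _ (fun α => ?_) w
  simp only [Module.Dual.eval_apply, divPair_sym, divPair_onV, SkewAlgebroid.lieDual,
    LinearMap.coe_mk, AddHom.coe_mk]
  ring

theorem divPair_lie_constForm (X : E) (l : P) :
    (divPair hE hP hPg hD X).lie (constForm R _ l) =
      constForm R _ ((divPair hE hP hPg hD X).onW l) := by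
  funext j
  cases j with
  | zero =>
    ext y
    rw [DerPair.lie_apply, DerPair.lieAlt_apply, constForm_zero_apply, constForm_zero_apply]
    simp
  | succ j =>
    ext y
    rw [DerPair.lie_apply, DerPair.lieAlt_apply, constForm_succ, constForm_succ]
    simp

/-- The anticommutator of the divergence and of `X ∧ ·` is a Lie derivative. -/
theorem IsDiv.wedge_eq_lie (X : E) (w : Forms R (Module.Dual R E) P) :
    D (wedgeOp X w) + wedgeOp X (D w) = (divPair hE hP hPg hD X).lie w := by
  let O : Forms R (Module.Dual R E) P →ₗ[R] Forms R (Module.Dual R E) P :=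
    { toFun := fun w => D (wedgeOp X w) + wedgeOp X (D w) - (divPair hE hP hPg hD X).lie w
      map_add' := fun w w' => by simp only [map_add]; abel
      map_smul' := fun f w => by
        rw [hD.wedge_smul hE hP hPg, DerPair.lie_smul, divPair_sym, RingHom.id_apply, smul_sub]
        abel }
  refine sub_eq_zero.1 (eq_zero_of_wedgeOp hE hP O 1 (fun Y w => ?_) (fun l => ?_) w)
  · show D (wedgeOp X (wedgeOp Y w)) + wedgeOp X (D (wedgeOp Y w)) -
        (divPair hE hP hPg hD X).lie (wedgeOp Y w) = (1 : ℤ) • wedgeOp Y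
        (D (wedgeOp X w) + wedgeOp X (D w) - (divPair hE hP hPg hD X).lie w)
    -- After applying T this is the commutation rule of the Lie derivative with the contraction by
    -- Y. The difference `O` therefore commutes with Y ∧ ·.
    have h1 : D (wedgeOp X (wedgeOp Y w)) + wedgeOp X (D (wedgeOp Y w)) =
        wedgeOp (S.bracket X Y) w + wedgeOp Y (D (wedgeOp X w) + wedgeOp X (D w)) := by
      apply starForm_injective hE hP hPg
      rw [hD.wedge, starForm_wedgeOp, map_add, starForm_wedgeOp, starForm_wedgeOp, hD.wedge,
        DerPair.contr_lie, ← sgn_lie, map_sub]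
      simp only [repPair_onV]
      abel
    rw [h1, divPair_lie_wedge, one_smul, map_sub]
    abel
  · show D (wedgeOp X _) + wedgeOp X (D _) - (divPair hE hP hPg hD X).lie _ = 0
    rw [hD.constForm hE hP, map_zero, add_zero, hD.wedge_constForm hE hP hPg,
      divPair_lie_constForm, sub_self]

/-- In top degree X ∧ Φ vanishes under T and Cartan's formula reduces to the given module structure,
which is thereby expressed through the action on L. -/
theorem act_eq_divPair (X : E) (Φ : Spinor R E P n) :
    ρ.act X Φ = (divPair hE hP hPg hD X).lieAlt Φ := by
  have h1 := hD.wedge X (homog n Φ)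
  rw [hD.wedge_eq_lie hE hP hPg] at h1
  have h2 := congrArg (fun u : Forms R E (Spinor R E P n) => u 0 ![]) h1
  simp only [DerPair.lie_apply (repPair S ρ X), DerPair.lieAlt_apply (repPair S ρ X)] at h2
  rw [starForm_eq_star (add_zero n), starForm_eq_star (add_zero n), homog_same, DerPair.lie_apply,
    homog_same] at h2
  have h3 : ∀ a : Spinor R E P n, star (add_zero n) a ![] = a := fun a => rfl
  rw [h3, h3] at h2
  simp only [Finset.univ_eq_empty, Finset.sum_empty, sub_zero, repPair_onW] at h2
  exact h2.symm

theorem IsDiv.div_div {S : LieAlgebroid R E} {ρ : Representation S.toSkewAlgebroid (Spinor R E P n)}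
    (hE : LocallyFree pt E n) (hP : Separated pt P) (hPg : Glueable pt P)
    (hD : IsDiv S.toSkewAlgebroid ρ D) (w : Forms R (Module.Dual R E) P) : D (D w) = 0 := by
  apply starForm_injective hE hP hPg
  rw [hD, hD, sgn_dForm, map_neg, dForm_dForm, neg_zero, map_zero]

end Divergence

/-! ## The product on `∧ⁿ A ⊗ L` -/

section Determinant

variable {R : Type*} [CommRing R] [Algebra ℝ R]

/-- Jacobi's formula for a derivation of the coefficients. -/
theorem derivation_det (δ : Derivation ℝ R R) {n : ℕ} (A : Matrix (Fin n) (Fin n) R) :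
    δ A.det = ∑ i, (A.updateRow i fun j => δ (A i j)).det := by
  let Δ : DerPair R (Fin n → R) R :=
    { sym := δ
      onV := AddMonoidHom.mk' (fun r j => δ (r j)) fun r r' => by funext j; simp
      onW := AddMonoidHom.mk' (fun f => δ f) fun f g => map_add δ f g
      onV_smul := fun f r => by funext j; simp [mul_comm]
      onW_smul := fun f r => by simp [mul_comm] }
  -- The defect is alternating and linear over R, so it may be evaluated on standard basis vectors;
  -- their matrices have integer entries, which derivations kill.
  have h : Δ.lieAlt Matrix.detRowAlternating = 0 := by
    refine (Pi.basisFun R (Fin n)).ext_alternating fun v _ => ?_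
    have h0 : ∀ i, Δ.onV (Pi.basisFun R (Fin n) (v i)) = 0 := by
      intro i
      funext j
      show δ (Pi.basisFun R (Fin n) (v i) j) = 0
      rw [Pi.basisFun_apply, Pi.single_apply]
      split <;> simp
    have h1 : δ (Matrix.of fun i => Pi.basisFun R (Fin n) (v i)).det = 0 := by
      have : (Matrix.of fun i => Pi.basisFun R (Fin n) (v i)).det =
          (((Matrix.of fun i => Pi.basisFun ℤ (Fin n) (v i)).det : ℤ) : R) := by
        rw [Int.cast_det]
        congr 1
        ext i j
        simp [Pi.single_apply]
      rw [this]
      exact Derivation.map_intCast δ _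
    rw [DerPair.lieAlt_apply, AlternatingMap.zero_apply]
    simp only [h0]
    rw [Finset.sum_eq_zero fun i _ => AlternatingMap.map_update_zero _ _ _, sub_zero]
    exact h1
  have h2 := congrArg (fun u : (Fin n → R) [⋀^Fin n]→ₗ[R] R => u fun i j => A i j) h
  rw [DerPair.lieAlt_apply, AlternatingMap.zero_apply, sub_eq_zero] at h2
  exact h2

/-- Both sides are the trace of adj(A) B. -/
theorem sum_det_updateRow {n : ℕ} (A B : Matrix (Fin n) (Fin n) R) :
    ∑ i, (A.updateRow i (B i)).det = ∑ j, (A.updateCol j fun i => B i j).det := by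
  have h1 : ∀ i, (A.updateRow i (B i)).det = ∑ j, A.adjugate j i * B i j := by
    intro i
    rw [← Matrix.cramer_transpose_apply, Matrix.cramer_eq_adjugate_mulVec,
      Matrix.mulVec, dotProduct, ← Matrix.adjugate_transpose]
    rfl
  have h2 : ∀ j, (A.updateCol j fun i => B i j).det = ∑ i, A.adjugate j i * B i j := by
    intro j
    rw [← Matrix.cramer_apply, Matrix.cramer_eq_adjugate_mulVec]
    rfl
  simp only [h1, h2]
  exact Finset.sum_comm

end Determinant

/-! ### The product on L' and the action of A on L -/

section Product

variable {R : Type*} [CommRing R] [Algebra ℝ R] {M : Type*} {pt : M → R →+* ℝ}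
variable {E : Type*} [AddCommGroup E] [Module R E]
variable {P : Type*} [AddCommGroup P] [Module R P]
variable {n m : ℕ}

/-- The matrix `⟨γᵢ, Xⱼ⟩`. -/
abbrev pairing (γ : Fin n → Module.Dual R E) (X : Fin n → E) : Matrix (Fin n) (Fin n) R :=
  Matrix.of fun i j => γ i (X j)

theorem Frame.det_pairing {x : M} (F : Frame pt x E n) : (pairing F.coord F.e).det = F.χ ^ n := by
  have : pairing F.coord F.e = Matrix.diagonal fun _ => F.χ := by
    ext i j
    exact (F.coord_e i j).trans (Matrix.diagonal_apply (fun _ => F.χ) i j).symm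
  rw [this, Matrix.det_diagonal]
  simp

theorem Frame.pow_mul_det_pairing {x : M} (F : Frame pt x E n) (γ : Fin n → Module.Dual R E)
    (X : Fin n → E) :
    F.χ ^ n * (pairing γ X).det = (pairing γ F.e).det * (pairing F.coord X).det := by
  have : F.χ • pairing γ X = pairing γ F.e * pairing F.coord X := by
    ext i j
    have := congrArg (γ i) (F.expand (X j))
    simp only [map_smul, map_sum, smul_eq_mul] at this
    rw [Matrix.mul_apply]
    refine this.trans ?_
    exact Finset.sum_congr rfl fun k _ => mul_comm _ _
  rw [← Matrix.det_mul, ← this, Matrix.det_smul, Fintype.card_fin]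

/-- The top multivector `e₁ ∧ ⋯ ∧ eₙ ⊗ l`. -/
def Frame.topVec {x : M} (F : Frame pt x E n) (l : P) : Spinor R E P n :=
  (LinearMap.toSpanSingleton R P l).compAlternatingMap
    ((Matrix.detRowAlternating (n := Fin n) (R := R)).compLinearMap
      (LinearMap.pi fun i => Module.Dual.eval R E (F.e i)))

theorem Frame.topVec_coord {x : M} (F : Frame pt x E n) (l : P) :
    F.topVec l F.coord = F.χ ^ n • l := by
  rw [← F.det_pairing]; rfl

/-- Evaluation of sections of the dual bundle on sections. -/
abbrev evals (X : Fin n → E) : Fin n → Module.Dual R (Module.Dual R E) :=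
  fun i => Module.Dual.eval R E (X i)

variable {q : P →ₗ[R] P →ₗ[R] Density R (Module.Dual R E) n m}

/-- `l ↦ q l l' φ`. -/
def productAt (q : P →ₗ[R] P →ₗ[R] Density R (Module.Dual R E) n m) (l' : P)
    (φ : Fin n → Module.Dual R (Module.Dual R E)) :
    P →ₗ[R] (Derivation ℝ R R) [⋀^Fin m]→ₗ[R] R where
  toFun l := q l l' φ
  map_add' a b := by rw [map_add]; rfl
  map_smul' f a := by rw [map_smul]; rfl

/-- Top forms are proportional, so the dependence on γ and on X can be moved to the frame, where it
factors through the determinant ⟨γᵢ, Xⱼ⟩. -/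
theorem Frame.product_eq {x : M} (F : Frame pt x E n) (Ψ : Spinor R E P n) (l : P)
    (γ : Fin n → Module.Dual R E) (X : Fin n → E) (v : Fin m → Derivation ℝ R R) :
    F.χ ^ n * (F.χ ^ n * q l (Ψ γ) (evals X) v) =
      F.χ ^ n * (pairing γ X).det * q l (Ψ F.coord) (evals F.e) v := by
  have h1 := F.dual.pow_smul_top Ψ γ
  have h2 := F.dual.dual.pow_smul_top (q l (Ψ F.coord)) (evals X)
  have h3 : F.χ ^ n * q l (Ψ γ) (evals X) v =
      (pairing γ F.e).det * q l (Ψ F.coord) (evals X) v := by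
    have : q l (F.χ ^ n • Ψ γ) (evals X) v =
      q l ((pairing γ F.e).det • Ψ F.coord) (evals X) v :=
      congrArg (fun p => q l p (evals X) v) h1
    simpa only [map_smul, AlternatingMap.smul_apply, smul_eq_mul] using this
  have h4 : F.χ ^ n * q l (Ψ F.coord) (evals X) v =
      (pairing F.coord X).det * q l (Ψ F.coord) (evals F.e) v := by
    have := congrArg (fun u : (Derivation ℝ R R) [⋀^Fin m]→ₗ[R] R => u v) h2
    rw [← Matrix.det_transpose]
    exact this
  rw [h3, F.pow_mul_det_pairing, mul_left_comm, h4, mul_assoc]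

theorem density_eq_zero (hE : LocallyFree pt E n) (hR : Separated pt R) {κ : Density R E n m}
    (h : ∀ β v (γ : Fin n → Module.Dual R E) X, (pairing γ X).det * κ β v = 0) : κ = 0 := by
  ext β v
  refine hR _ fun x => ?_
  obtain ⟨F⟩ := hE x
  refine ⟨F.χ ^ n, pt_pow_ne F.pt_ne n, ?_⟩
  rw [smul_eq_mul, ← F.det_pairing]
  exact h β v _ _

/-- The product which makes `∧ⁿ A ⊗ L` a square root of `∧ⁿ A ⊗ ∧ᵐ T*M`. -/
theorem exists_product (hE : LocallyFree pt E n) (hR : Separated pt R) (hRg : Glueable pt R)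
    (q : P →ₗ[R] P →ₗ[R] Density R (Module.Dual R E) n m) :
    ∃ q' : Spinor R E P n →ₗ[R] Spinor R E P n →ₗ[R] Density R E n m,
      ∀ Φ Ψ (β γ : Fin n → Module.Dual R E) (X : Fin n → E) v,
        (pairing γ X).det * q' Φ Ψ β v = q (Φ β) (Ψ γ) (evals X) v := by
  have hex : ∀ Φ Ψ : Spinor R E P n, ∃ κ : Density R E n m,
      ∀ (β γ : Fin n → Module.Dual R E) (X : Fin n → E) v,
        (pairing γ X).det * κ β v = q (Φ β) (Ψ γ) (evals X) v := by
    intro Φ Ψ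
    let G : Density R E n m →ₗ[R] ((Fin n → Module.Dual R E) × (Fin m → Derivation ℝ R R) ×
        (Fin n → Module.Dual R E) × (Fin n → E) → R) :=
      { toFun := fun κ t => (pairing t.2.2.1 t.2.2.2).det * κ t.1 t.2.1
        map_add' := fun κ κ' => by funext t; simp [mul_add]
        map_smul' := fun f κ => by funext t; simp [mul_left_comm] }
    have hG : ∀ κ, G κ = 0 → κ = 0 := fun κ h =>
      density_eq_zero hE hR fun β v γ X => congrFun h (β, v, γ, X)
    have hgl : Glueable pt (Density R E n m) := (hRg.alt hR m).alt (hR.alt m) n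
    obtain ⟨κ, hκ⟩ := exists_of_local hgl (Separated.pi fun _ => hR) G hG
      (fun t => q (Φ t.1) (Ψ t.2.2.1) (evals t.2.2.2) t.2.1) fun x => by
        obtain ⟨F⟩ := hE x
        -- The defining relation with γ the dual frame and X the frame, whose determinant is χⁿ,
        -- prescribes the product.
        refine ⟨F.χ ^ n * F.χ ^ n, F.χ ^ n •
          (productAt q (Ψ F.coord) (evals F.e)).compAlternatingMap Φ,
          pt_mul_ne (pt_pow_ne F.pt_ne n) (pt_pow_ne F.pt_ne n), ?_⟩
        funext t
        have := F.product_eq (q := q) Ψ (Φ t.1) t.2.2.1 t.2.2.2 t.2.1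
        rw [map_smul]
        show F.χ ^ n * ((pairing t.2.2.1 t.2.2.2).det *
          q (Φ t.1) (Ψ F.coord) (evals F.e) t.2.1) = F.χ ^ n * F.χ ^ n * _
        rw [← mul_assoc, ← this, mul_assoc]
    exact ⟨κ, fun β γ X v => congrFun hκ (β, v, γ, X)⟩
  choose p hp using hex
  have hinj : ∀ {κ κ' : Density R E n m}, (∀ β v (γ : Fin n → Module.Dual R E) X,
      (pairing γ X).det * κ β v = (pairing γ X).det * κ' β v) → κ = κ' := by
    intro κ κ' h
    rw [← sub_eq_zero]
    refine density_eq_zero hE hR fun β v γ X => ?_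
    rw [AlternatingMap.sub_apply, AlternatingMap.sub_apply, mul_sub, h, sub_self]
  refine ⟨LinearMap.mk₂ R p (fun Φ Φ' Ψ => hinj fun β v γ X => ?_)
    (fun f Φ Ψ => hinj fun β v γ X => ?_) (fun Φ Ψ Ψ' => hinj fun β v γ X => ?_)
    (fun f Φ Ψ => hinj fun β v γ X => ?_), fun Φ Ψ β γ X v => hp Φ Ψ β γ X v⟩
  · simp only [AlternatingMap.add_apply, mul_add, hp, map_add, LinearMap.add_apply]
  · simp only [AlternatingMap.smul_apply, smul_eq_mul, mul_left_comm _ f, hp, map_smul,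
      LinearMap.smul_apply]
  · simp only [AlternatingMap.add_apply, mul_add, hp, map_add]
  · simp only [AlternatingMap.smul_apply, smul_eq_mul, mul_left_comm _ f, hp, map_smul]

variable {q' : Spinor R E P n →ₗ[R] Spinor R E P n →ₗ[R] Density R E n m}

theorem product_unique (hE : LocallyFree pt E n) (hR : Separated pt R)
    {q'' : Spinor R E P n →ₗ[R] Spinor R E P n →ₗ[R] Density R E n m}
    (h' : ∀ Φ Ψ (β γ : Fin n → Module.Dual R E) (X : Fin n → E) v,
        (pairing γ X).det * q' Φ Ψ β v = q (Φ β) (Ψ γ) (evals X) v)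
    (h'' : ∀ Φ Ψ (β γ : Fin n → Module.Dual R E) (X : Fin n → E) v,
        (pairing γ X).det * q'' Φ Ψ β v = q (Φ β) (Ψ γ) (evals X) v) : q' = q'' := by
  refine LinearMap.ext fun Φ => LinearMap.ext fun Ψ => ?_
  rw [← sub_eq_zero]
  refine density_eq_zero hE hR fun β v γ X => ?_
  rw [AlternatingMap.sub_apply, AlternatingMap.sub_apply, mul_sub, h', h'', sub_self]

theorem isRoot_product (hE : LocallyFree pt E n) (hP1 : LocallyFree pt P 1) (hq : IsRoot pt q)
    (h' : ∀ Φ Ψ (β γ : Fin n → Module.Dual R E) (X : Fin n → E) v,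
        (pairing γ X).det * q' Φ Ψ β v = q (Φ β) (Ψ γ) (evals X) v) : IsRoot pt q' where
  sepR := hq.sepR
  sepQ := hq.sepQ.alt n
  line := (hE.dual.top hP1).isLine (hq.sepQ.alt n)
  free := hE.dual
  freeDer := hq.freeDer
  nondeg x := by
    obtain ⟨F⟩ := hE x
    obtain ⟨l, φ, v, H⟩ := hq.nondeg x
    refine ⟨F.topVec l, F.coord, v, fun h0 => ?_⟩
    have h1 := h' (F.topVec l) (F.topVec l) F.coord F.coord F.e v
    rw [F.topVec_coord, F.det_pairing] at h1
    simp only [map_smul, LinearMap.smul_apply, AlternatingMap.smul_apply, smul_eq_mul] at h1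
    have h2 := congrArg (fun u : (Derivation ℝ R R) [⋀^Fin m]→ₗ[R] R => u v)
      (F.dual.dual.pow_smul_top (q l l) φ)
    have hχ := pt_pow_ne F.pt_ne n
    have h3 : pt x (q l l (evals F.e) v) = 0 := by
      have := congrArg (pt x) h1
      rw [map_mul, h0, mul_zero, map_mul, map_mul, eq_comm, mul_eq_zero, mul_eq_zero] at this
      tauto
    have h4 := congrArg (pt x) h2
    simp only [AlternatingMap.smul_apply, smul_eq_mul, map_mul] at h4
    rw [show F.dual.dual.e = evals F.e from rfl, h3, mul_zero, mul_eq_zero] at h4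
    exact h4.elim hχ H

/-- The natural action of `X` on `∧ⁿ A* ⊗ ∧ᵐ T*M`. -/
def coDensPair (S : SkewAlgebroid R E) (m : ℕ) (X : E) :
    DerPair R (Module.Dual R (Module.Dual R E)) ((Derivation ℝ R R) [⋀^Fin m]→ₗ[R] R) where
  sym := S.anchor X
  onV := AddMonoidHom.mk' (fun φ =>
    { toFun := fun α => S.anchor X (φ α) - φ (S.lieDual X α)
      map_add' := fun α β => by
        rw [show S.lieDual X (α + β) = S.lieDual X α + S.lieDual X β from
          (densPair S 0 X).onV.map_add α β]
        simp only [map_add]; ring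
      map_smul' := fun f α => by
        rw [show S.lieDual X (f • α) = f • S.lieDual X α + S.anchor X f • α from
          (densPair S 0 X).onV_smul f α]
        simp only [map_smul, map_add, smul_eq_mul, Derivation.leibniz, RingHom.id_apply]; ring })
    (fun φ φ' => by
      ext α
      simp only [LinearMap.coe_mk, AddHom.coe_mk, LinearMap.add_apply, map_add]; ring)
  onW := (densPair S m X).onW
  onV_smul f φ := by
    ext α
    simp only [AddMonoidHom.mk'_apply, LinearMap.coe_mk, AddHom.coe_mk, LinearMap.add_apply,
      LinearMap.smul_apply, smul_eq_mul, Derivation.leibniz]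
    ring
  onW_smul := (densPair S m X).onW_smul

theorem coDensPair_onV_apply (S : SkewAlgebroid R E) (X : E)
    (φ : Module.Dual R (Module.Dual R E)) (α : Module.Dual R E) :
    (coDensPair S m X).onV φ α = S.anchor X (φ α) - φ (S.lieDual X α) := rfl

theorem coDensPair_onV_eval (S : SkewAlgebroid R E) (X Y : E) :
    (coDensPair S m X).onV (Module.Dual.eval R E Y) = Module.Dual.eval R E (S.bracket X Y) := by
  ext α
  rw [coDensPair_onV_apply]
  simp only [Module.Dual.eval_apply, SkewAlgebroid.lieDual, LinearMap.coe_mk, AddHom.coe_mk]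
  ring

theorem coDensPair_apply (S : SkewAlgebroid R E) (X : E) (κ : Density R (Module.Dual R E) n m)
    (φ v) : (coDensPair S m X).lieAlt κ φ v = S.anchor X (κ φ v)
      - ∑ i, κ (Function.update φ i ((coDensPair S m X).onV (φ i))) v
      - ∑ j, κ φ (Function.update v j ⁅S.anchor X, v j⁆) := by
  rw [DerPair.lieAlt_apply, AlternatingMap.sub_apply, alt_sum_apply]
  show S.anchor X (κ φ v) - ∑ j, κ φ (Function.update v j ⁅S.anchor X, v j⁆) - _ = _
  abel

/-- Each entry obeys X⟨γᵢ, Yⱼ⟩ = ⟨ℒ_X γᵢ, Yⱼ⟩ + ⟨γᵢ, [X, Yⱼ]⟩. Jacobi's formula works by rows, and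
`sum_det_updateRow` regroups the second part by columns. -/
theorem derivation_det_pairing (S : SkewAlgebroid R E) (X : E) (γ : Fin n → Module.Dual R E)
    (Y : Fin n → E) : S.anchor X (pairing γ Y).det =
      ∑ i, (pairing (Function.update γ i (S.lieDual X (γ i))) Y).det +
      ∑ j, (pairing γ (Function.update Y j (S.bracket X (Y j)))).det := by
  let A : Matrix (Fin n) (Fin n) R := Matrix.of fun i j => S.lieDual X (γ i) (Y j)
  let B : Matrix (Fin n) (Fin n) R := Matrix.of fun i j => γ i (S.bracket X (Y j))
  have h1 : ∀ i, (pairing γ Y).updateRow i (fun j => S.anchor X (pairing γ Y i j)) =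
      (pairing γ Y).updateRow i (A i + B i) := by
    intro i
    congr 1
    funext j
    simp only [A, B, Pi.add_apply, Matrix.of_apply, SkewAlgebroid.lieDual, LinearMap.coe_mk,
      AddHom.coe_mk]
    ring
  rw [derivation_det, Finset.sum_congr rfl fun i _ => by rw [h1 i, Matrix.det_updateRow_add],
    Finset.sum_add_distrib, sum_det_updateRow _ B]
  congr 1
  · refine Finset.sum_congr rfl fun i _ => congrArg _ ?_
    ext a b
    by_cases h : a = i
    · subst h; simp [A]
    · simp [Matrix.updateRow_ne h, Function.update_of_ne h]
  · refine Finset.sum_congr rfl fun i _ => congrArg _ ?_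
    ext a b
    by_cases h : b = i
    · subst h; simp [B]
    · simp [Matrix.updateCol_ne h, Function.update_of_ne h]

section Div

variable {S : SkewAlgebroid R E} {ρ : Representation S (Spinor R E P n)}
  {D : Forms R (Module.Dual R E) P →+ Forms R (Module.Dual R E) P}

/-- Differentiating the relation det ⟨γᵢ, Yⱼ⟩ q' = q along X and inserting the root property of L'
leaves that of L, because the terms coming from β and γ cancel. -/
theorem divPair_root_apply (hE : LocallyFree pt E n) (hP : Separated pt P) (hPg : Glueable pt P)
    (hD : IsDiv S ρ D)
    (h' : ∀ Φ Ψ (β γ : Fin n → Module.Dual R E) (X : Fin n → E) v,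
        (pairing γ X).det * q' Φ Ψ β v = q (Φ β) (Ψ γ) (evals X) v)
    (hρ : IsRootOf S q' ρ) (X : E) (Φ Ψ : Spinor R E P n) (β γ : Fin n → Module.Dual R E)
    (Y : Fin n → E) (v : Fin m → Derivation ℝ R R) :
    q ((divPair hE hP hPg hD X).onW (Φ β)) (Ψ γ) (evals Y) v +
      q (Φ β) ((divPair hE hP hPg hD X).onW (Ψ γ)) (evals Y) v =
    (coDensPair S m X).lieAlt (q (Φ β) (Ψ γ)) (evals Y) v := by
  have hr := hρ X Φ Ψ β v
  have ha : ∀ (Φ : Spinor R E P n) β, (divPair hE hP hPg hD X).onW (Φ β) =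
      ρ.act X Φ β + ∑ i, Φ (Function.update β i (S.lieDual X (β i))) := by
    intro Φ β
    rw [act_eq_divPair hE hP hPg hD, DerPair.lieAlt_apply]
    simp only [divPair_onV, sub_add_cancel]
  have hs1 : ∀ (f : Fin n → P) (l : P), q (∑ i, f i) l (evals Y) v =
      ∑ i, q (f i) l (evals Y) v := by
    intro f l
    have := congrArg (fun u : (Derivation ℝ R R) [⋀^Fin m]→ₗ[R] R => u v)
      (map_sum (productAt q l (evals Y)) f Finset.univ)
    rw [alt_sum_apply] at this
    exact this
  have hs2 : ∀ (f : Fin n → P) (l : P), q l (∑ i, f i) (evals Y) v =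
      ∑ i, q l (f i) (evals Y) v := by
    intro f l
    rw [map_sum, alt_sum_apply, alt_sum_apply]
  have hdet := derivation_det_pairing S X γ Y
  have hk := congrArg (fun r => r * q' Φ Ψ β v) hdet
  simp only [add_mul, Finset.sum_mul, h'] at hk
  have hleib : S.anchor X (q (Φ β) (Ψ γ) (evals Y) v) =
      (pairing γ Y).det * S.anchor X (q' Φ Ψ β v) +
        S.anchor X (pairing γ Y).det * q' Φ Ψ β v := by
    rw [← h' Φ Ψ β γ Y v, Derivation.leibniz, smul_eq_mul, smul_eq_mul]
    ring
  have hev : ∀ j, evals (Function.update Y j (S.bracket X (Y j))) =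
      Function.update (evals Y) j ((coDensPair S m X).onV (evals Y j)) := by
    intro j
    funext i
    by_cases h : i = j
    · subst h; simp only [evals, Function.update_self, coDensPair_onV_eval]
    · simp only [evals, Function.update_of_ne h]
  have hm := congrArg (fun r => (pairing γ Y).det * r) hr
  simp only [densityAct, mul_add, mul_sub, Finset.mul_sum, h'] at hm
  simp only [hev] at hk
  rw [ha, ha, coDensPair_apply]
  simp only [map_add, LinearMap.add_apply, AlternatingMap.add_apply, hs1, hs2]
  linear_combination hm - hleib - hk

/-- The Lie derivative on `L` determined by the divergence is the square root of the natural
action on densities. -/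
theorem divPair_root (hE : LocallyFree pt E n) (hP : Separated pt P) (hPg : Glueable pt P)
    (hq : IsRoot pt q) (hD : IsDiv S ρ D)
    (h' : ∀ Φ Ψ (β γ : Fin n → Module.Dual R E) (X : Fin n → E) v,
        (pairing γ X).det * q' Φ Ψ β v = q (Φ β) (Ψ γ) (evals X) v)
    (hρ : IsRootOf S q' ρ) (X : E) (l l' : P) :
    q ((divPair hE hP hPg hD X).onW l) l' + q l ((divPair hE hP hPg hD X).onW l') =
      (coDensPair S m X).lieAlt (q l l') := by
  rw [← sub_eq_zero]
  refine hq.sepDensity _ fun x => ?_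
  obtain ⟨F⟩ := hE x
  refine ⟨F.χ ^ n * F.χ ^ n, pt_mul_ne (pt_pow_ne F.pt_ne n) (pt_pow_ne F.pt_ne n), ?_⟩
  have hL := (divPair hE hP hPg hD X).onW_smul
  rw [divPair_sym] at hL
  -- The defect is bilinear over functions, so l and l' may be multiplied by χⁿ, after which they
  -- are values of top multivectors and `divPair_root_apply` covers them.
  have hbil : ∀ (f g : R) a b, q ((divPair hE hP hPg hD X).onW (f • a)) (g • b) +
      q (f • a) ((divPair hE hP hPg hD X).onW (g • b)) -
      (coDensPair S m X).lieAlt (q (f • a) (g • b)) =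
      (f * g) • (q ((divPair hE hP hPg hD X).onW a) b + q a ((divPair hE hP hPg hD X).onW b) -
        (coDensPair S m X).lieAlt (q a b)) := by
    intro f g a b
    ext φ v
    simp only [hL, map_smul, map_add, LinearMap.smul_apply, LinearMap.add_apply,
      DerPair.lieAlt_smul, AlternatingMap.smul_apply, AlternatingMap.add_apply,
      AlternatingMap.sub_apply, smul_eq_mul]
    rw [show (coDensPair S m X).sym = S.anchor X from rfl]
    ring
  rw [← hbil]
  have h1 : F.χ ^ n • l = F.topVec l F.coord := (F.topVec_coord l).symm
  have h2 : F.χ ^ n • l' = F.topVec l' F.coord := (F.topVec_coord l').symm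
  rw [h1, h2]
  ext φ v
  refine hq.sepR _ fun y => ?_
  obtain ⟨G⟩ := hE y
  refine ⟨G.χ ^ n, pt_pow_ne G.pt_ne n, ?_⟩
  have h3 := congrArg (fun u : (Derivation ℝ R R) [⋀^Fin m]→ₗ[R] R => u v)
    (G.dual.dual.pow_smul_top (q ((divPair hE hP hPg hD X).onW (F.topVec l F.coord))
      (F.topVec l' F.coord) + q (F.topVec l F.coord)
      ((divPair hE hP hPg hD X).onW (F.topVec l' F.coord)) -
      (coDensPair S m X).lieAlt (q (F.topVec l F.coord) (F.topVec l' F.coord))) φ)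
  refine h3.trans ?_
  have h4 := divPair_root_apply hE hP hPg hD h' hρ X (F.topVec l) (F.topVec l') F.coord F.coord
    G.e v
  exact (congrArg (fun r => (Matrix.of fun i j => G.dual.dual.coord j (φ i)).det • r)
    (sub_eq_zero.2 h4)).trans (smul_zero _)

end Div

end Product

/-! ## The differential of the dual algebroid as a commutator -/

section Trace

variable {R : Type*} [CommRing R] [Algebra ℝ R] {M : Type*} {pt : M → R →+* ℝ}
variable {V : Type*} [AddCommGroup V] [Module R V]
variable {W : Type*} [AddCommGroup W] [Module R W]
variable {n : ℕ}

/-- An endomorphism acts on top forms by its trace; the frame splits K into rank-one pieces. -/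
theorem Frame.smul_sum_update {x : M} (F : Frame pt x V n) (hV : LocallyFree pt V n)
    (hW : Separated pt W) (κ : V [⋀^Fin n]→ₗ[R] W) (K : V →ₗ[R] V) (φ : Fin n → V) :
    F.χ • ∑ i, κ (Function.update φ i (K (φ i))) = (∑ k, F.coord k (K (F.e k))) • κ φ := by
  have h1 : ∀ i, F.χ • κ (Function.update φ i (K (φ i))) =
      ∑ k, κ (Function.update φ i (F.coord k (φ i) • K (F.e k))) := by
    intro i
    rw [← κ.map_update_smul, ← map_smul, F.expand, map_sum]
    simp only [map_smul]
    exact κ.toMultilinearMap.map_update_sum Finset.univ i _ φ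
  rw [Finset.smul_sum, Finset.sum_congr rfl fun i _ => h1 i, Finset.sum_comm, Finset.sum_smul]
  exact Finset.sum_congr rfl fun k _ => sum_update_rankOne hV hW κ _ _ φ

end Trace

/-! ### Bivectors and the commutator formula for the dual differential -/

section Dual

variable {R : Type*} [CommRing R] [Algebra ℝ R] {M : Type*} {pt : M → R →+* ℝ}
variable {E : Type*} [AddCommGroup E] [Module R E]
variable {P : Type*} [AddCommGroup P] [Module R P]
variable {n m : ℕ}

/-- Exterior multiplication by a bivector. -/
def bivOp (Λ : Bivector R E) : Forms R (Module.Dual R E) P →ₗ[R] Forms R (Module.Dual R E) P :=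
  twoMul (Module.Dual.eval R E ∘ₗ Λ.sharp)

theorem bivector_eval_skew (Λ : Bivector R E) (u v : Module.Dual R E) :
    (Module.Dual.eval R E ∘ₗ Λ.sharp) u v = -(Module.Dual.eval R E ∘ₗ Λ.sharp) v u :=
  Λ.skew u v

theorem contr_bivOp (Λ : Bivector R E) (α : Module.Dual R E) (w : Forms R (Module.Dual R E) P) :
    contr α (bivOp Λ w) = wedgeOp (Λ.sharp α) w + bivOp Λ (contr α w) :=
  contr_twoMul _ (bivector_eval_skew Λ) α w

theorem bivOp_wedgeOp (Λ : Bivector R E) (X : E) (w : Forms R (Module.Dual R E) P) :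
    bivOp Λ (wedgeOp X w) = wedgeOp X (bivOp Λ w) :=
  twoMul_extMul _ (bivector_eval_skew Λ) _ w

theorem bivOp_zero (Λ : Bivector R E) (w : Forms R (Module.Dual R E) P) : bivOp Λ w 0 = 0 :=
  twoMul_zero _ w

theorem contr_bivOp_constForm (Λ : Bivector R E) (α : Module.Dual R E) (l : P) :
    contr α (bivOp Λ (constForm R _ l)) = wedgeOp (Λ.sharp α) (constForm R _ l) := by
  rw [contr_bivOp, contr_constForm, map_zero, add_zero]

theorem contr_wedgeOp_constForm (α : Module.Dual R E) (X : E) (l : P) :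
    contr α (wedgeOp X (constForm R _ l)) = constForm R _ (α X • l) := by
  rw [contr_extMul, contr_constForm, map_zero, sub_zero, map_smul]
  rfl

theorem bivOp_constForm_eq_zero (Λ : Bivector R E) (l : P) {k : ℕ} (hk : k ≠ 2) :
    bivOp Λ (constForm R _ l) k = 0 := by
  cases k with
  | zero => exact bivOp_zero _ _
  | succ k =>
    ext y
    have h := congrArg (fun u : Forms R (Module.Dual R E) P => u k (Fin.tail y))
      (contr_bivOp_constForm Λ (y 0) l)
    simp only [contr_apply, Fin.cons_self_tail] at h
    rw [h]
    match k, hk with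
    | 0, _ => rfl
    | j + 2, _ => rw [wedgeOp_succ, constForm_succ, wedge_zero]; rfl

/-- The left side acts as multiplication by the dual differential of X, the right side as
multiplication by the Lie derivative of Λ along X up to sign. Contracting with α, both give Λ♯(ℒ_X
α) - [X, Λ♯α]; the choice of σ drops out. -/
theorem dForm_dual_wedgeOp (S : SkewAlgebroid R E) (Λ : Bivector R E)
    (σ : Representation (S.dual Λ) P) (X : E) (δ : DerPair R (Module.Dual R E) P)
    (hs : δ.sym = S.anchor X) (hV : ∀ α, δ.onV α = S.lieDual X α)
    (w : Forms R (Module.Dual R E) P) :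
    dForm (S.dual Λ) σ (wedgeOp X w) + wedgeOp X (dForm (S.dual Λ) σ w) =
      bivOp Λ (δ.lie w) - δ.lie (bivOp Λ w) := by
  rw [← sub_eq_zero]
  refine eq_zero_of_contr (fun w => dForm (S.dual Λ) σ (wedgeOp X w) +
    wedgeOp X (dForm (S.dual Λ) σ w) - (bivOp Λ (δ.lie w) - δ.lie (bivOp Λ w))) 1
    (fun w => ?_) (fun α w => ?_) w
  · simp only [Pi.sub_apply, Pi.add_apply, dForm_zero, extMul_zero_apply, bivOp_zero,
      DerPair.lie_apply]
    ext y
    simp [DerPair.lieAlt_apply]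
  · have h1 := dForm_extMul_contr (S.dual Λ) σ (Module.Dual.eval R E X)
      (Module.Dual.eval R E (Λ.sharp (S.lieDual X α) - S.bracket X (Λ.sharp α))) α (fun u => ?_) w
    · have h2 := δ.lie_extMul (Module.Dual.eval R E (Λ.sharp α))
        (Module.Dual.eval R E (S.bracket X (Λ.sharp α))) (fun u => by
          simp only [hs, hV, Module.Dual.eval_apply, SkewAlgebroid.lieDual, LinearMap.coe_mk,
            AddHom.coe_mk]
          ring) w
      have h3 : extMul (Module.Dual.eval R E (Λ.sharp (S.lieDual X α) -
          S.bracket X (Λ.sharp α))) w = wedgeOp (Λ.sharp (S.lieDual X α)) w -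
            wedgeOp (S.bracket X (Λ.sharp α)) w := by
        rw [eq_sub_iff_add_eq, ← wedgeOp_add, sub_add_cancel]
      rw [h3] at h1
      simp only [map_sub, one_smul]
      rw [h1, contr_bivOp, DerPair.contr_lie, DerPair.contr_lie, contr_bivOp, contr_bivOp, map_add,
        map_sub, h2, hV]
      abel
    · have e := Λ.skew α u
      have e2 := congrArg (S.anchor X) e
      have e1 := Λ.skew (S.lieDual X α) u
      simp only [Module.Dual.eval_apply, SkewAlgebroid.dual, SkewAlgebroid.lieDual,
        SkewAlgebroid.dFun, Bivector.eval, LinearMap.coe_mk, AddHom.coe_mk, LinearMap.sub_apply,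
        LinearMap.comp_apply, map_sub, map_neg, S.bracket_skew (Λ.sharp _) X] at e1 e2 ⊢
      rw [e1]
      linear_combination -e2

variable {S : SkewAlgebroid R E} {ρ : Representation S (Spinor R E P n)}
  {D : Forms R (Module.Dual R E) P →+ Forms R (Module.Dual R E) P}

/-- The derivation `l ↦ ⟨α, -D(Λ ∧ l)⟩` of `P`. -/
def bivAct (D : Forms R (Module.Dual R E) P →+ Forms R (Module.Dual R E) P) (Λ : Bivector R E)
    (α : Module.Dual R E) : P →+ P :=
  AddMonoidHom.mk' (fun l => -contr α (D (bivOp Λ (constForm R _ l))) 0 ![]) (fun l l' => by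
    simp only [map_add, Pi.add_apply, AlternatingMap.add_apply, neg_add])

theorem bivAct_apply (Λ : Bivector R E) (α : Module.Dual R E) (l : P) :
    bivAct D Λ α l = -contr α (D (bivOp Λ (constForm R _ l))) 0 ![] := rfl

variable (hE : LocallyFree pt E n) (hP : Separated pt P) (hPg : Glueable pt P)
    (hD : IsDiv S ρ D)

theorem bivAct_smul (hE : LocallyFree pt E n) (hP : Separated pt P) (hPg : Glueable pt P)
    (hD : IsDiv S ρ D) (Λ : Bivector R E) (α : Module.Dual R E) (f : R) (l : P) :
    bivAct D Λ α (f • l) = f • bivAct D Λ α l + S.anchor (Λ.sharp α) f • l := by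
  have e : α (Λ.sharp (S.dFun f)) = -S.anchor (Λ.sharp α) f := Λ.skew (S.dFun f) α
  rw [bivAct_apply, bivAct_apply, map_smul, map_smul, hD.smul hE hP hPg, map_add, map_smul,
    contr_bivOp_constForm, contr_wedgeOp_constForm, e, Pi.add_apply, AlternatingMap.add_apply,
    constForm_zero_apply, Pi.smul_apply, AlternatingMap.smul_apply, neg_add, smul_neg, neg_smul,
    neg_neg]

theorem divPair_add (X Y : E) (l : P) : (divPair hE hP hPg hD (X + Y)).onW l =
    (divPair hE hP hPg hD X).onW l + (divPair hE hP hPg hD Y).onW l := by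
  simp only [divPair_onW, wedgeOp_add, map_add]
  rfl

theorem divPair_smul (f : R) (X : E) (l : P) : (divPair hE hP hPg hD (f • X)).onW l =
    f • (divPair hE hP hPg hD X).onW l + S.anchor X f • l := by
  simp only [divPair_onW, wedgeOp_smul]
  rw [hD.smul hE hP hPg, contr_wedgeOp_constForm, Pi.add_apply, AlternatingMap.add_apply,
    constForm_zero_apply]
  rfl

theorem divPair_sum_smul {ι : Type*} (s : Finset ι) (f : ι → R) (X : ι → E) (l : P) :
    (divPair hE hP hPg hD (∑ i ∈ s, f i • X i)).onW l =
      ∑ i ∈ s, f i • (divPair hE hP hPg hD (X i)).onW l + (∑ i ∈ s, S.anchor (X i) (f i)) • l := by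
  let G : E →+ P := AddMonoidHom.mk' (fun X => (divPair hE hP hPg hD X).onW l)
    fun X Y => divPair_add hE hP hPg hD X Y l
  have h := map_sum G (fun i => f i • X i) s
  have hG : ∀ i, G (f i • X i) = f i • (divPair hE hP hPg hD (X i)).onW l +
    S.anchor (X i) (f i) • l := fun i => divPair_smul hE hP hPg hD _ _ _
  simp only [hG, Finset.sum_add_distrib, ← Finset.sum_smul] at h
  exact h

/-- The local expression 2Λ = ∑ eᵢ ∧ Λ♯eⁱ, multiplied by χ. -/
theorem Frame.smul_bivOp_constForm {x : M} (F : Frame pt x E n) (Λ : Bivector R E) (l : P) :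
    F.χ • (bivOp Λ (constForm R (Module.Dual R E) l) + bivOp Λ (constForm R _ l)) =
      ∑ i, wedgeOp (F.e i) (wedgeOp (Λ.sharp (F.coord i)) (constForm R _ l)) := by
  refine forms_ext ?_ fun α => ?_
  · rw [Pi.smul_apply, Pi.add_apply, bivOp_zero, add_zero, smul_zero, Finset.sum_apply]
    exact (Finset.sum_eq_zero fun i _ => rfl).symm
  · have h1 : ∀ i, contr α (wedgeOp (F.e i) (wedgeOp (Λ.sharp (F.coord i))
        (constForm R _ l))) = wedgeOp (Λ.sharp (α (F.e i) • F.coord i)) (constForm R _ l) +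
          wedgeOp (F.coord i (Λ.sharp α) • F.e i) (constForm R _ l) := by
      intro i
      rw [contr_extMul, contr_wedgeOp_constForm, Λ.skew, neg_smul, map_neg, map_neg,
        sub_neg_eq_add, map_smul, map_smul, map_smul, wedgeOp_smul, wedgeOp_smul,
        Module.Dual.eval_apply]
    have h2 : F.χ • α = ∑ i, α (F.e i) • F.coord i := F.dual.expand α
    have hw : ∀ X : Fin n → E, wedgeOp (∑ i, X i) (constForm R (Module.Dual R E) l) =
        ∑ i, wedgeOp (X i) (constForm R _ l) := fun X => by
      have := congrArg (fun u : Module.End R (Forms R (Module.Dual R E) P) => u (constForm R _ l))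
        (map_sum (wedgeLin (R := R) (E := E) (P := P)) X Finset.univ)
      simp only [LinearMap.sum_apply] at this
      exact this
    rw [map_sum, Finset.sum_congr rfl fun i _ => h1 i, Finset.sum_add_distrib, ← hw, ← hw,
      ← map_sum, ← h2, ← F.expand, map_smul, map_add, contr_bivOp_constForm, map_smul,
      wedgeOp_smul, smul_add]

/-- The exterior derivative of a section of the dual. -/
def dTwo (S : SkewAlgebroid R E) (α : Module.Dual R E) (X Y : E) : R :=
  S.anchor X (α Y) - S.anchor Y (α X) - α (S.bracket X Y)

/-- Applying D to the local expression of Λ and using its Cartan formula on each product shows that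
`bivAct` is the Lie derivative along Λ♯α on L plus half the trace of dα against Λ. The identity is
doubled to avoid that half. -/
theorem Frame.smul_bivAct {x : M} (F : Frame pt x E n) (Λ : Bivector R E) (α : Module.Dual R E)
    (l : P) : F.χ • (bivAct D Λ α l + bivAct D Λ α l) =
      F.χ • ((divPair hE hP hPg hD (Λ.sharp α)).onW l + (divPair hE hP hPg hD (Λ.sharp α)).onW l) +
        (∑ i, dTwo S α (F.e i) (Λ.sharp (F.coord i))) • l := by
  have h1 := congrArg D (F.smul_bivOp_constForm Λ l)
  have h2 : ∀ i, D (wedgeOp (F.e i) (wedgeOp (Λ.sharp (F.coord i)) (constForm R _ l))) =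
      wedgeOp (S.bracket (F.e i) (Λ.sharp (F.coord i))) (constForm R _ l) +
      wedgeOp (Λ.sharp (F.coord i)) (constForm R _ ((divPair hE hP hPg hD (F.e i)).onW l)) -
      wedgeOp (F.e i)
        (constForm R _ ((divPair hE hP hPg hD (Λ.sharp (F.coord i))).onW l)) := by
    intro i
    rw [eq_sub_iff_add_eq, ← hD.wedge_constForm hE hP hPg (Λ.sharp (F.coord i)),
      hD.wedge_eq_lie hE hP hPg, divPair_lie_wedge, divPair_lie_constForm]
  rw [hD.smul hE hP hPg, map_sum, Finset.sum_congr rfl fun i _ => h2 i] at h1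
  have h3 := congrArg (fun u => contr α u 0 ![]) h1
  simp only [map_add, map_smul, contr_bivOp_constForm, contr_wedgeOp_constForm, map_sum, map_sub,
    Pi.add_apply, AlternatingMap.add_apply, Finset.sum_apply, alt_sum_apply, Pi.sub_apply,
    AlternatingMap.sub_apply, constForm_zero_apply, Pi.smul_apply, AlternatingMap.smul_apply] at h3
  have h4 : contr α (D (bivOp Λ (constForm R _ l))) 0 ![] = -bivAct D Λ α l := by
    rw [bivAct_apply, neg_neg]
  have e : α (Λ.sharp (S.dFun F.χ)) = -S.anchor (Λ.sharp α) F.χ := Λ.skew (S.dFun F.χ) α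
  rw [h4, e] at h3
  have h5 := divPair_sum_smul hE hP hPg hD Finset.univ (fun i => F.coord i (Λ.sharp α)) F.e l
  rw [← F.expand, divPair_smul] at h5
  have h6 := divPair_sum_smul hE hP hPg hD Finset.univ (fun i => α (F.e i))
    (fun i => Λ.sharp (F.coord i)) l
  have h7 : ∑ i, α (F.e i) • Λ.sharp (F.coord i) = F.χ • Λ.sharp α := by
    have : F.χ • α = ∑ i, α (F.e i) • F.coord i := F.dual.expand α
    rw [← map_smul, this, map_sum]
    simp only [map_smul]
  rw [h7, divPair_smul] at h6
  have h8 : ∀ i, α (Λ.sharp (F.coord i)) = -F.coord i (Λ.sharp α) := fun i => Λ.skew _ α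
  simp only [dTwo, h8, Finset.sum_sub_distrib, Finset.sum_add_distrib, neg_smul,
    Finset.sum_neg_distrib, ← Finset.sum_smul, smul_neg, map_neg, sub_smul, smul_add]
    at h3 ⊢
  rw [← sub_eq_zero] at h3 h5 h6 ⊢
  rw [← neg_eq_zero, ← h3]
  have h9 := congrArg₂ (· + ·) h5 h6
  simp only [add_zero] at h9
  rw [← sub_eq_zero, ← h9]
  abel

/-- The actions of [α, ·]_Λ and ℒ_{Λ♯α} on A* differ by the endomorphism β ↦ -dα(·, Λ♯β). Its trace
is the change of the action on densities, and half of it is exactly the correction in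
`Frame.smul_bivAct`. -/
theorem bivAct_root (hE : LocallyFree pt E n) (hP : Separated pt P) (hPg : Glueable pt P)
    (hD : IsDiv S ρ D) {q : P →ₗ[R] P →ₗ[R] Density R (Module.Dual R E) n m}
    {q' : Spinor R E P n →ₗ[R] Spinor R E P n →ₗ[R] Density R E n m} (hq : IsRoot pt q)
    (h' : ∀ Φ Ψ (β γ : Fin n → Module.Dual R E) (X : Fin n → E) v,
        (pairing γ X).det * q' Φ Ψ β v = q (Φ β) (Ψ γ) (evals X) v)
    (hρ : IsRootOf S q' ρ) (Λ : Bivector R E) (α : Module.Dual R E) (l l' : P) :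
    q (bivAct D Λ α l) l' + q l (bivAct D Λ α l') =
      (densPair (S.dual Λ) m α).lieAlt (q l l') := by
  refine hq.sepDensity.eq fun x => ?_
  obtain ⟨F⟩ := hE x
  refine ⟨2 * F.χ, pt_mul_ne (pt_two_ne x) F.pt_ne, ?_⟩
  -- The two derivatives have the same symbol, so their difference is linear over functions and acts
  -- on top forms by its trace.
  let K : Module.Dual R (Module.Dual R E) →ₗ[R] Module.Dual R (Module.Dual R E) :=
    { toFun := fun φ => (densPair (S.dual Λ) m α).onV φ - (coDensPair S m (Λ.sharp α)).onV φ
      map_add' := fun φ φ' => by simp only [map_add]; abel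
      map_smul' := fun f φ => by
        rw [DerPair.onV_smul, DerPair.onV_smul, RingHom.id_apply, smul_sub]
        show _ + S.anchor (Λ.sharp α) f • φ - (_ + S.anchor (Λ.sharp α) f • φ) = _
        abel }
  have hK : ∀ X β, K (Module.Dual.eval R E X) β = -dTwo S α X (Λ.sharp β) := by
    intro X β
    show S.anchor (Λ.sharp α) (β X) - (S.lieDual (Λ.sharp α) β - S.lieDual (Λ.sharp β) α -
      S.dFun (Λ.eval α β)) X - (S.anchor (Λ.sharp α) (β X) - S.lieDual (Λ.sharp α) β X) = _
    have e := congrArg (S.anchor X) (Λ.skew α β)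
    rw [map_neg] at e
    simp only [LinearMap.sub_apply, SkewAlgebroid.lieDual, SkewAlgebroid.dFun, Bivector.eval,
      LinearMap.coe_mk, AddHom.coe_mk, S.bracket_skew (Λ.sharp β) X, map_neg, dTwo]
    linear_combination e
  have htr : ∀ κ : Density R (Module.Dual R E) n m,
      F.χ • (densPair (S.dual Λ) m α).lieAlt κ =
        F.χ • (coDensPair S m (Λ.sharp α)).lieAlt κ +
          (∑ i, dTwo S α (F.e i) (Λ.sharp (F.coord i))) • κ := by
    intro κ
    ext1 φ
    have h1 := F.dual.dual.smul_sum_update hE.dual.dual (hq.sepR.alt m) κ K φ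
    have h2 : ∑ k, F.dual.dual.coord k (K (F.dual.dual.e k)) =
        -∑ i, dTwo S α (F.e i) (Λ.sharp (F.coord i)) := by
      rw [← Finset.sum_neg_distrib]
      exact Finset.sum_congr rfl fun k _ => hK (F.e k) (F.coord k)
    rw [h2] at h1
    have h3 : ∀ i, κ (Function.update φ i (K (φ i))) =
        κ (Function.update φ i ((densPair (S.dual Λ) m α).onV (φ i))) -
        κ (Function.update φ i ((coDensPair S m (Λ.sharp α)).onV (φ i))) :=
      fun i => κ.map_update_sub φ i _ _
    simp only [h3, Finset.sum_sub_distrib] at h1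
    simp only [AlternatingMap.smul_apply, AlternatingMap.add_apply, DerPair.lieAlt_apply]
    have h4 : (densPair (S.dual Λ) m α).onW (κ φ) = (coDensPair S m (Λ.sharp α)).onW (κ φ) := rfl
    have h5 : F.dual.dual.χ = F.χ := rfl
    rw [h5, smul_sub, neg_smul, sub_eq_iff_eq_add] at h1
    rw [h4, smul_sub, smul_sub, h1]
    abel
  have hb := F.smul_bivAct hE hP hPg hD Λ α
  have hr := divPair_root hE hP hPg hq hD h' hρ (Λ.sharp α) l l'
  have ht := htr (q l l')
  rw [← hr] at ht
  ext φ v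
  have e1 := congrArg (fun p => q p l' φ v) (hb l)
  have e2 := congrArg (fun p => q l p φ v) (hb l')
  have e3 := congrArg (fun κ : Density R (Module.Dual R E) n m => κ φ v) ht
  simp only [map_add, map_smul, LinearMap.add_apply, LinearMap.smul_apply,
    AlternatingMap.add_apply, AlternatingMap.smul_apply, smul_eq_mul] at e1 e2 e3 ⊢
  linear_combination e1 + e2 - 2 * e3

/-- The differential of the algebroid structure induced by `Λ` on the dual is the commutator of
the exterior multiplication by `Λ` and the divergence. -/
theorem dForm_dual_eq (hE : LocallyFree pt E n) (hP : Separated pt P) (hPg : Glueable pt P)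
    (hD : IsDiv S ρ D) {q : P →ₗ[R] P →ₗ[R] Density R (Module.Dual R E) n m}
    {q' : Spinor R E P n →ₗ[R] Spinor R E P n →ₗ[R] Density R E n m} (hq : IsRoot pt q)
    (h' : ∀ Φ Ψ (β γ : Fin n → Module.Dual R E) (X : Fin n → E) v,
        (pairing γ X).det * q' Φ Ψ β v = q (Φ β) (Ψ γ) (evals X) v)
    (hρ : IsRootOf S q' ρ) (Λ : Bivector R E) (σ : Representation (S.dual Λ) P)
    (hσ : IsRootOf (S.dual Λ) q σ) (w : Forms R (Module.Dual R E) P) :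
    dForm (S.dual Λ) σ w = bivOp Λ (D w) - D (bivOp Λ w) := by
  let O : Forms R (Module.Dual R E) P →ₗ[R] Forms R (Module.Dual R E) P :=
    { toFun := fun w => dForm (S.dual Λ) σ w - (bivOp Λ (D w) - D (bivOp Λ w))
      map_add' := fun w w' => by simp only [map_add]; abel
      map_smul' := fun f w => by
        -- The symbols agree: the dual differential of f is -Λ♯(df), and contraction with df fails
        -- to commute with Λ by Λ♯(df).
        have e : extMul ((S.dual Λ).dFun f) w = -wedgeOp (Λ.sharp (S.dFun f)) w := by
          have : (S.dual Λ).dFun f = Module.Dual.eval R E ((-1 : R) • Λ.sharp (S.dFun f)) := by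
            ext α
            have := Λ.skew α (S.dFun f)
            simp only [neg_smul, one_smul, map_neg]
            exact this
          rw [this, map_smul, smul_extMul, neg_one_smul]
        rw [dForm_smul, e, hD.smul hE hP hPg, map_add, map_smul, map_smul, hD.smul hE hP hPg,
          contr_bivOp, RingHom.id_apply, smul_sub, smul_sub]
        abel }
  refine sub_eq_zero.1 (eq_zero_of_wedgeOp hE hP O (-1) (fun X w => ?_) (fun l => ?_) w)
  · show dForm (S.dual Λ) σ (wedgeOp X w) - (bivOp Λ (D (wedgeOp X w)) - D (bivOp Λ (wedgeOp X w)))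
      = (-1 : ℤ) • wedgeOp X (dForm (S.dual Λ) σ w - (bivOp Λ (D w) - D (bivOp Λ w)))
    have h1 := dForm_dual_wedgeOp S Λ σ X (divPair hE hP hPg hD X) rfl (fun _ => rfl) w
    rw [← hD.wedge_eq_lie hE hP hPg, ← hD.wedge_eq_lie hE hP hPg, map_add, bivOp_wedgeOp,
      ← eq_sub_iff_add_eq] at h1
    rw [h1, bivOp_wedgeOp, map_sub, map_sub, neg_smul, one_smul]
    abel
  · show dForm (S.dual Λ) σ _ - (bivOp Λ (D _) - D (bivOp Λ _)) = 0
    rw [hD.constForm hE hP, map_zero, zero_sub, sub_neg_eq_add, add_eq_zero_iff_eq_neg]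
    -- In degree zero both operators define roots of the same action on densities, hence the same
    -- action on L.
    have hact : ∀ α, σ.act α l = bivAct D Λ α l := fun α =>
      DFunLike.congr_fun (hq.unique (S.anchor (Λ.sharp α))
        (AddMonoidHom.mk' (σ.act α) (σ.act_add α)) (bivAct D Λ α) (fun f a => σ.act_smul α f a)
        (fun f a => bivAct_smul hE hP hPg hD Λ α f a)
        (fun a b => ((isRootOf_iff _ _).1 hσ α a b).trans
          (bivAct_root hE hP hPg hD hq h' hρ Λ α a b).symm)) l
    refine forms_ext ?_ fun α => ?_
    · rw [dForm_zero, Pi.neg_apply, hD.apply_eq_zero hE hP (bivOp_constForm_eq_zero Λ l (by simp)),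
        neg_zero]
    · rw [contr_dForm, contr_constForm, map_zero, sub_zero, map_neg]
      funext j
      cases j with
      | zero =>
        ext y
        rw [DerPair.lie_apply, DerPair.lieAlt_apply, constForm_zero_apply, repPair_onW, hact,
          bivAct_apply, Subsingleton.elim y ![]]
        simp
      | succ j =>
        have h0 : D (bivOp Λ (constForm R _ l)) (j + 2) = 0 :=
          hD.apply_eq_zero hE hP (bivOp_constForm_eq_zero Λ l (by omega))
        ext y
        rw [Pi.neg_apply, AlternatingMap.neg_apply, contr_apply, h0, DerPair.lie_apply,
          DerPair.lieAlt_apply, constForm_succ]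
        simp only [AlternatingMap.zero_apply, Finset.sum_const_zero, sub_zero, neg_zero]
        exact map_zero _

end Dual

/-! ## The hierarchy of a Poisson–Nijenhuis structure -/

section Hierarchy

variable {R : Type*} [CommRing R] [Algebra ℝ R]
variable {E : Type*} [AddCommGroup E] [Module R E]

namespace SkewAlgebroid

theorem ext_of {S S' : SkewAlgebroid R E} (h : ∀ X Y, S.bracket X Y = S'.bracket X Y)
    (h' : S.anchor = S'.anchor) : S = S' := by
  obtain ⟨b, a, _, _, _⟩ := S
  obtain ⟨b', a', _, _, _⟩ := S'
  obtain rfl : b = b' := funext fun X => funext fun Y => h X Y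
  obtain rfl : a = a' := h'
  rfl

variable (S : SkewAlgebroid R E)

theorem bracket_sub (X Y Z : E) : S.bracket X (Y - Z) = S.bracket X Y - S.bracket X Z :=
  map_sub (AddMonoidHom.mk' (S.bracket X) (S.bracket_add X)) Y Z

theorem lieDual_apply (X : E) (θ : Module.Dual R E) (Y : E) :
    S.lieDual X θ Y = S.anchor X (θ Y) - θ (S.bracket X Y) := rfl

theorem dFun_apply (f : R) (X : E) : S.dFun f X = S.anchor X f := rfl

theorem lieDual_sub (X : E) (θ η : Module.Dual R E) :
    S.lieDual X (θ - η) = S.lieDual X θ - S.lieDual X η := (densPair S 0 X).onV.map_sub θ η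

theorem dFun_add (f g : R) : S.dFun (f + g) = S.dFun f + S.dFun g := by
  ext X; simp [dFun_apply]

theorem dFun_sub (f g : R) : S.dFun (f - g) = S.dFun f - S.dFun g := by
  ext X; simp [dFun_apply]

theorem dual_bracket_apply (Λ : Bivector R E) (ξ θ : Module.Dual R E) (X : E) :
    (S.dual Λ).bracket ξ θ X = S.anchor (Λ.sharp ξ) (θ X) - θ (S.bracket (Λ.sharp ξ) X) -
      (S.anchor (Λ.sharp θ) (ξ X) - ξ (S.bracket (Λ.sharp θ) X)) -
      S.anchor X (θ (Λ.sharp ξ)) := rfl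

theorem deform_bracket (N : E →ₗ[R] E) (X Y : E) : (S.deform N).bracket X Y =
    S.bracket (N X) Y + S.bracket X (N Y) - N (S.bracket X Y) := rfl

/-- The mixed torsion of two endomorphisms vanishes. -/
def TorsionFree (P Q : E →ₗ[R] E) : Prop :=
  ∀ X Y, S.bracket (P X) (Q Y) =
    P (S.bracket X (Q Y)) + Q (S.bracket (P X) Y) - P (Q (S.bracket X Y))

variable {S}

theorem isNijenhuis_iff {N : E →ₗ[R] E} : S.IsNijenhuis N ↔ S.TorsionFree N N := by
  refine forall₂_congr fun X Y => ?_
  rw [deform_bracket, map_sub, map_add, add_comm (N (S.bracket (N X) Y))]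

theorem TorsionFree.mul {N P Q : E →ₗ[R] E} (h : S.TorsionFree N Q) (h' : S.TorsionFree P Q) :
    S.TorsionFree (N * P) Q := by
  intro X Y
  simp only [Module.End.mul_apply]
  rw [h, h' X Y]
  simp only [map_sub, map_add]
  abel

theorem TorsionFree.symm {P Q : E →ₗ[R] E} (h : S.TorsionFree P Q) (hc : Commute P Q) :
    S.TorsionFree Q P := by
  intro X Y
  have hc' : ∀ Z, P (Q Z) = Q (P Z) := LinearMap.congr_fun hc
  rw [S.bracket_skew, h, S.bracket_skew (Q X) Y, S.bracket_skew X (P Y), S.bracket_skew X Y]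
  simp only [map_neg, hc']
  abel

theorem torsionFree_one (Q : E →ₗ[R] E) : S.TorsionFree 1 Q := by
  intro X Y
  simp

theorem TorsionFree.pow_left {P Q : E →ₗ[R] E} (h : S.TorsionFree P Q) (k : ℕ) :
    S.TorsionFree (P ^ k) Q := by
  induction k with
  | zero => rw [pow_zero]; exact torsionFree_one Q
  | succ k ih => rw [pow_succ']; exact h.mul ih

theorem IsNijenhuis.torsionFree_pow {N : E →ₗ[R] E} (h : S.IsNijenhuis N) (k l : ℕ) :
    S.TorsionFree (N ^ k) (N ^ l) :=
  (((isNijenhuis_iff.1 h).pow_left l).symm (Commute.pow_self N l)).pow_left k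

theorem IsNijenhuis.pow {N : E →ₗ[R] E} (h : S.IsNijenhuis N) (k : ℕ) : S.IsNijenhuis (N ^ k) :=
  isNijenhuis_iff.2 (h.torsionFree_pow k k)

/-- The identity has vanishing mixed torsion with every endomorphism, so the torsion of 1 + N is
that of N. -/
theorem IsNijenhuis.one_add {N : E →ₗ[R] E} (h : S.IsNijenhuis N) : S.IsNijenhuis (1 + N) := by
  intro X Y
  have := h X Y
  simp only [deform_bracket, LinearMap.add_apply, Module.End.one_apply, S.bracket_add,
    S.add_bracket, map_add, map_sub] at this ⊢
  rw [this]
  abel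

end SkewAlgebroid

namespace LieAlgebroid

/-- The deformation of a Lie algebroid along a Nijenhuis operator. -/
def deformLie (A : LieAlgebroid R E) (N : E →ₗ[R] E) (h : A.IsNijenhuis N) : LieAlgebroid R E where
  toSkewAlgebroid := A.toSkewAlgebroid.deform N
  jacobi X Y Z := by
    have hN : ∀ X Y, A.bracket (N X) (N Y) = N (A.bracket (N X) Y) + N (A.bracket X (N Y)) -
        N (N (A.bracket X Y)) := fun X Y => by rw [h X Y, SkewAlgebroid.deform_bracket]; simp
    -- The inner N[Y, Z]_N is replaced by [NY, NZ] and the torsion removes [NX, N[Y, Z]]; what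
    -- remains is a sum of double brackets of A to which its Jacobi identity applies termwise.
    have hexp : ∀ X Y Z, (A.deform N).bracket X ((A.deform N).bracket Y Z) =
        A.bracket (N X) (A.bracket (N Y) Z) + A.bracket (N X) (A.bracket Y (N Z)) +
        A.bracket X (A.bracket (N Y) (N Z)) - N (A.bracket X (A.bracket (N Y) Z) +
        A.bracket X (A.bracket Y (N Z)) + A.bracket (N X) (A.bracket Y Z)) +
        N (N (A.bracket X (A.bracket Y Z))) := by
      intro X Y Z
      rw [A.deform_bracket N X, ← h Y Z, A.deform_bracket N Y Z, A.bracket_sub, A.bracket_add,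
        A.bracket_sub, A.bracket_add, hN X (A.bracket Y Z)]
      simp only [map_sub, map_add]
      abel
    have hj : ∀ X Y Z, A.bracket X (A.bracket Y Z) =
        A.bracket Y (A.bracket X Z) - A.bracket Z (A.bracket X Y) := by
      intro X Y Z
      rw [A.jacobi X Y Z, A.bracket_skew (A.bracket X Y) Z]
      abel
    rw [(A.deform N).bracket_skew ((A.deform N).bracket X Y) Z, hexp, hexp, hexp,
      hj (N X) (N Y) Z, hj (N X) Y (N Z), hj X (N Y) (N Z), hj X (N Y) Z, hj X Y (N Z),
      hj (N X) Y Z, hj X Y Z]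
    simp only [map_sub, map_add]
    abel
  anchor_bracket X Y := by
    show A.anchor (N _) = ⁅A.anchor (N X), A.anchor (N Y)⁆
    rw [← h X Y, A.anchor_bracket]

theorem lieDual_bracket (A : LieAlgebroid R E) (X Y : E) (θ : Module.Dual R E) :
    A.lieDual (A.bracket X Y) θ = A.lieDual X (A.lieDual Y θ) - A.lieDual Y (A.lieDual X θ) := by
  ext Z
  simp only [SkewAlgebroid.lieDual_apply, LinearMap.sub_apply, A.anchor_bracket,
    Derivation.commutator_apply, map_sub, A.jacobi X Y Z, map_add]
  ring

theorem lieDual_dFun (A : LieAlgebroid R E) (X : E) (f : R) :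
    A.lieDual X (A.dFun f) = A.dFun (A.anchor X f) := by
  ext Z
  simp only [SkewAlgebroid.lieDual_apply, SkewAlgebroid.dFun_apply, A.anchor_bracket,
    Derivation.commutator_apply]
  ring

end LieAlgebroid

/-- Consequently Λ is Poisson exactly when Λ♯ preserves brackets, provided that the dual separates
sections. -/
theorem halfSchouten_eq (S : SkewAlgebroid R E) (Λ : Bivector R E) (α β γ : Module.Dual R E) :
    S.halfSchouten Λ α β γ = γ (S.bracket (Λ.sharp α) (Λ.sharp β)) -
      γ (Λ.sharp ((S.dual Λ).bracket α β)) := by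
  have e1 := congrArg (S.anchor (Λ.sharp α)) (Λ.skew β γ)
  rw [Λ.skew ((S.dual Λ).bracket α β) γ, S.dual_bracket_apply, SkewAlgebroid.halfSchouten,
    S.bracket_skew (Λ.sharp γ) (Λ.sharp α)]
  simp only [Bivector.eval, map_neg] at e1 ⊢
  linear_combination -e1

/-- The Lie algebroid structure induced by a Poisson bivector on the dual. -/
def LieAlgebroid.dualLie (A : LieAlgebroid R E) (Λ : Bivector R E) (h : A.IsPoisson Λ)
    (hsep : ∀ X : E, (∀ γ : Module.Dual R E, γ X = 0) → X = 0) :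
    LieAlgebroid R (Module.Dual R E) :=
  have hb : ∀ α β, Λ.sharp ((A.dual Λ).bracket α β) = A.bracket (Λ.sharp α) (Λ.sharp β) := by
    intro α β
    rw [eq_comm, ← sub_eq_zero]
    refine hsep _ fun γ => ?_
    rw [map_sub, ← halfSchouten_eq, h]
  { toSkewAlgebroid := A.toSkewAlgebroid.dual Λ
    anchor_bracket := fun α β => by
      show A.anchor (Λ.sharp _) = ⁅A.anchor (Λ.sharp α), A.anchor (Λ.sharp β)⁆
      rw [hb, A.anchor_bracket]
    jacobi := fun α β γ => by
      have hd : ∀ ξ θ, (A.dual Λ).bracket ξ θ =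
        A.lieDual (Λ.sharp ξ) θ - A.lieDual (Λ.sharp θ) ξ - A.dFun (θ (Λ.sharp ξ)) :=
        fun ξ θ => rfl
      have hs := h α β γ
      have e1 : (A.dual Λ).bracket β γ (Λ.sharp α) = A.anchor (Λ.sharp β) (γ (Λ.sharp α)) -
          γ (A.bracket (Λ.sharp β) (Λ.sharp α)) - (A.anchor (Λ.sharp γ) (β (Λ.sharp α)) -
          β (A.bracket (Λ.sharp γ) (Λ.sharp α))) - A.anchor (Λ.sharp α) (γ (Λ.sharp β)) := rfl
      have e2 : (A.dual Λ).bracket α γ (Λ.sharp β) = A.anchor (Λ.sharp α) (γ (Λ.sharp β)) -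
          γ (A.bracket (Λ.sharp α) (Λ.sharp β)) - (A.anchor (Λ.sharp γ) (α (Λ.sharp β)) -
          α (A.bracket (Λ.sharp γ) (Λ.sharp β))) - A.anchor (Λ.sharp β) (γ (Λ.sharp α)) := rfl
      -- In the Jacobi identity the Lie derivative terms cancel by [ℒ_X, ℒ_Y] = ℒ_[X,Y]. The
      -- remainder is exact, and this identity of functions is the vanishing Schouten square.
      have key : A.anchor (Λ.sharp α) (γ (Λ.sharp β)) + (A.dual Λ).bracket β γ (Λ.sharp α) =
          γ (A.bracket (Λ.sharp α) (Λ.sharp β)) - A.anchor (Λ.sharp γ) (β (Λ.sharp α)) +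
          A.anchor (Λ.sharp β) (γ (Λ.sharp α)) + (A.dual Λ).bracket α γ (Λ.sharp β) := by
        rw [e1, e2]
        have s1 := congrArg (A.anchor (Λ.sharp γ)) (Λ.skew β α)
        have s2 := congrArg (A.anchor (Λ.sharp β)) (Λ.skew γ α)
        simp only [SkewAlgebroid.halfSchouten, Bivector.eval, map_neg] at hs s1 s2
        rw [A.bracket_skew (Λ.sharp γ) (Λ.sharp β), A.bracket_skew (Λ.sharp β) (Λ.sharp α),
          map_neg, map_neg]
        linear_combination hs + s1 + s2
      have key' := congrArg A.dFun key
      simp only [A.dFun_add, A.dFun_sub] at key'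
      have j1 := hd α ((A.dual Λ).bracket β γ)
      have j2 := hd ((A.dual Λ).bracket α β) γ
      have j3 := hd β ((A.dual Λ).bracket α γ)
      rw [hb, congrArg (A.lieDual (Λ.sharp α)) (hd β γ)] at j1
      rw [hb, congrArg (A.lieDual (Λ.sharp γ)) (hd α β)] at j2
      rw [hb, congrArg (A.lieDual (Λ.sharp β)) (hd α γ)] at j3
      rw [j1, j2, j3]
      simp only [A.lieDual_sub, A.lieDual_bracket, A.lieDual_dFun]
      rw [← sub_eq_zero] at key' ⊢
      rw [← neg_eq_zero, ← key']
      abel }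

/-- The obstruction for `(A_N)*_Λ` to be `A*_{NΛ}`. -/
def compat (S : SkewAlgebroid R E) (Λ : Bivector R E) (N : E →ₗ[R] E) (ξ θ : Module.Dual R E)
    (X : E) : R :=
  θ (N (S.bracket (Λ.sharp ξ) X) - S.bracket (Λ.sharp ξ) (N X)) -
    ξ (N (S.bracket (Λ.sharp θ) X) - S.bracket (Λ.sharp θ) (N X)) +
    S.anchor X (θ (N (Λ.sharp ξ))) - S.anchor (N X) (θ (Λ.sharp ξ))

/-! ### One obstruction for two compatibility conditions -/

section Compat

variable {S : SkewAlgebroid R E} {Λ Λ' : Bivector R E} {N : E →ₗ[R] E}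

/-- The same obstruction appears here and in `dual_deform_bracket`; hence the hypothesis comparing
A*_{NΛ} with (A*_Λ)_{N*} also yields that (A_N)*_Λ equals A*_{NΛ}. -/
theorem deform_dual_bracket (h : ∀ ξ, Λ'.sharp ξ = N (Λ.sharp ξ)) (ξ θ : Module.Dual R E) (X : E) :
    ((S.deform N).dual Λ).bracket ξ θ X = (S.dual Λ').bracket ξ θ X + compat S Λ N ξ θ X := by
  rw [SkewAlgebroid.dual_bracket_apply, SkewAlgebroid.dual_bracket_apply, compat]
  simp only [h, SkewAlgebroid.deform_bracket, map_sub, map_add]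
  simp only [SkewAlgebroid.deform, LinearMap.comp_apply]
  ring

theorem dual_deform_bracket (h : ∀ ξ, Λ'.sharp ξ = N (Λ.sharp ξ))
    (hc : ∀ ξ, Λ.sharp (N.dualMap ξ) = N (Λ.sharp ξ)) (ξ θ : Module.Dual R E) (X : E) :
    (S.dual Λ').bracket ξ θ X =
      ((S.dual Λ).deform N.dualMap).bracket ξ θ X + compat S Λ N ξ θ X := by
  rw [SkewAlgebroid.deform_bracket, LinearMap.sub_apply, LinearMap.add_apply,
    LinearMap.dualMap_apply, SkewAlgebroid.dual_bracket_apply, SkewAlgebroid.dual_bracket_apply,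
    SkewAlgebroid.dual_bracket_apply, SkewAlgebroid.dual_bracket_apply, compat]
  simp only [h, hc, LinearMap.dualMap_apply, map_sub]
  ring

/-- Vanishing of the obstruction makes the bracket of Λ' the deformation by N*. Applying Λ♯, which
preserves brackets and intertwines N* with N, gives the bracket deformed by N, and the Nijenhuis
condition concludes. -/
theorem isPoisson_of_compat (h : ∀ ξ, Λ'.sharp ξ = N (Λ.sharp ξ))
    (hc : ∀ ξ, Λ.sharp (N.dualMap ξ) = N (Λ.sharp ξ)) (hN : S.IsNijenhuis N)
    (hC : ∀ ξ θ X, compat S Λ N ξ θ X = 0) (hΛ : S.IsPoisson Λ)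
    (hsep : ∀ X : E, (∀ γ : Module.Dual R E, γ X = 0) → X = 0) : S.IsPoisson Λ' := by
  have hb : ∀ α β, Λ.sharp ((S.dual Λ).bracket α β) = S.bracket (Λ.sharp α) (Λ.sharp β) := by
    intro α β
    rw [eq_comm, ← sub_eq_zero]
    refine hsep _ fun γ => ?_
    rw [map_sub, ← halfSchouten_eq, hΛ]
  intro α β γ
  have h1 : (S.dual Λ').bracket α β = ((S.dual Λ).deform N.dualMap).bracket α β := by
    ext X
    rw [dual_deform_bracket h hc, hC, add_zero]
  rw [halfSchouten_eq, h, h, h, h1, hN, SkewAlgebroid.deform_bracket, SkewAlgebroid.deform_bracket,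
    map_sub, map_add]
  simp only [map_sub, map_add, hc, hb, sub_self]

end Compat

/-! ### Powers of N -/

section PN

variable {A : LieAlgebroid R E} {N : E →ₗ[R] E} {Λ : Bivector R E}

theorem IsPoissonNijenhuis.sharp_dualMap (h : IsPoissonNijenhuis A N Λ) (ξ : Module.Dual R E) :
    Λ.sharp (N.dualMap ξ) = N (Λ.sharp ξ) := LinearMap.congr_fun h.sharp_comm ξ

theorem IsPoissonNijenhuis.sharp_dualMap_pow (h : IsPoissonNijenhuis A N Λ) (k : ℕ)
    (ξ : Module.Dual R E) : Λ.sharp ((N ^ k).dualMap ξ) = (N ^ k) (Λ.sharp ξ) := by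
  induction k generalizing ξ with
  | zero => rfl
  | succ k ih =>
    have : (N ^ (k + 1)).dualMap ξ = N.dualMap ((N ^ k).dualMap ξ) := by
      ext X
      simp only [LinearMap.dualMap_apply, pow_succ, Module.End.mul_apply]
    rw [this, h.sharp_dualMap, ih, pow_succ']
    rfl

/-- The case of N itself is the hypothesis on dual brackets. The obstruction for N^{l+1} at X is
that for N^l at NX plus that for N at (ξ, (N*)^l θ), up to the mixed torsion of N^l and N. -/
theorem IsPoissonNijenhuis.compat_zero (h : IsPoissonNijenhuis A N Λ) (l : ℕ)
    (ξ θ : Module.Dual R E) (X : E) : compat A.toSkewAlgebroid Λ (N ^ l) ξ θ X = 0 := by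
  have h1 : ∀ ξ θ X, compat A.toSkewAlgebroid Λ N ξ θ X = 0 := by
    intro ξ θ X
    have e := dual_deform_bracket (S := A.toSkewAlgebroid) (Λ := Λ)
      (Λ' := Λ.iterate N h.sharp_comm 1) (N := N) (fun ξ => by simp [Bivector.iterate])
      h.sharp_dualMap ξ θ X
    rw [h.dual_bracket] at e
    exact (left_eq_add.1 e)
  induction l generalizing X with
  | zero =>
    simp [compat]
  | succ l ih =>
    have hT := (h.nijenhuis.torsionFree_pow l 1) (Λ.sharp θ) X
    rw [pow_one] at hT
    have e1 := ih (N X)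
    have e2 := h1 ξ ((N ^ l).dualMap θ) X
    have hT' := congrArg ξ hT
    simp only [compat, h.sharp_dualMap_pow, LinearMap.dualMap_apply, map_sub, map_add, pow_succ,
      Module.End.mul_apply] at e1 e2 hT' ⊢
    linear_combination e1 + e2 - hT'

/-- Replacing Λ by N^k Λ amounts to replacing θ by (N*)^k θ, up to the mixed torsion of N^k and N^l.
-/
theorem IsPoissonNijenhuis.compat_iterate (h : IsPoissonNijenhuis A N Λ) (k l : ℕ)
    (ξ θ : Module.Dual R E) (X : E) :
    compat A.toSkewAlgebroid (Λ.iterate N h.sharp_comm k) (N ^ l) ξ θ X = 0 := by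
  have e := h.compat_zero l ξ ((N ^ k).dualMap θ) X
  have hT := congrArg θ ((h.nijenhuis.torsionFree_pow k l) (Λ.sharp ξ) X)
  have hcomm : ∀ Y, (N ^ l) ((N ^ k) Y) = (N ^ k) ((N ^ l) Y) :=
    LinearMap.congr_fun (Commute.pow_pow_self N l k)
  simp only [compat, h.sharp_dualMap_pow, LinearMap.dualMap_apply, map_sub, map_add,
    Bivector.iterate, LinearMap.comp_apply, hcomm] at e hT ⊢
  linear_combination e - hT

/-- This lets the differential of A_{k+l}^* be written both with the divergence of A and with that
of A_l. -/
theorem IsPoissonNijenhuis.deform_dual (h : IsPoissonNijenhuis A N Λ) (k l : ℕ) :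
    (A.deform (N ^ l)).dual (Λ.iterate N h.sharp_comm k) =
      A.dual (Λ.iterate N h.sharp_comm (k + l)) := by
  have hs : ∀ ξ, (Λ.iterate N h.sharp_comm (k + l)).sharp ξ =
      (N ^ l) ((Λ.iterate N h.sharp_comm k).sharp ξ) := by
    intro ξ
    simp only [Bivector.iterate, LinearMap.comp_apply, add_comm k l, pow_add, Module.End.mul_apply]
  refine SkewAlgebroid.ext_of (fun ξ θ => ?_) ?_
  · ext X
    rw [deform_dual_bracket hs, h.compat_iterate, add_zero]
  · ext1 ξ
    show A.anchor ((N ^ l) _) = A.anchor _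
    rw [hs]

theorem IsPoissonNijenhuis.poisson_iterate (h : IsPoissonNijenhuis A N Λ)
    (hsep : ∀ X : E, (∀ γ : Module.Dual R E, γ X = 0) → X = 0) (k : ℕ) :
    A.IsPoisson (Λ.iterate N h.sharp_comm k) :=
  isPoisson_of_compat (N := N ^ k) (fun _ => rfl) (h.sharp_dualMap_pow k) (h.nijenhuis.pow k)
    (h.compat_zero k) h.poisson hsep

end PN

end Hierarchy

/-! ## The Dirac generating operator -/

section Main

variable {R : Type*} [CommRing R] [Algebra ℝ R] {M : Type*} {pt : M → R →+* ℝ}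
variable {E : Type*} [AddCommGroup E] [Module R E]
variable {P : Type*} [AddCommGroup P] [Module R P]
variable {Q : Type*} [AddCommGroup Q] [Module R Q]
variable {n m : ℕ}

/-- The differentials of a Lie algebroid and of its deformation anticommute. -/
theorem dForm_deform_anticomm {q : Q →ₗ[R] Q →ₗ[R] Density R E n m} (hq : IsRoot pt q)
    (hg : Glueable pt Q) (A : LieAlgebroid R E) {N : E →ₗ[R] E} (hN : A.IsNijenhuis N)
    (ρ : Representation A.toSkewAlgebroid Q) (hρ : IsRootOf A.toSkewAlgebroid q ρ)
    (ρN : Representation (A.deform N) Q) (hρN : IsRootOf (A.deform N) q ρN) (w : Forms R E Q) :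
    dForm A.toSkewAlgebroid ρ (dForm (A.deform N) ρN w) +
      dForm (A.deform N) ρN (dForm A.toSkewAlgebroid ρ w) = 0 := by
  -- The bracket deformed along 1 + N is the sum of the two brackets, and its differential squares
  -- to zero; the cross terms are the claim.
  let B := A.deformLie (1 + N) hN.one_add
  obtain ⟨τ, hτ⟩ := hq.exists_rep hg B
  have hbr : ∀ X Y, B.bracket X Y = A.bracket X Y + (A.deform N).bracket X Y := by
    intro X Y
    show (A.deform (1 + N)).bracket X Y = _
    simp only [SkewAlgebroid.deform_bracket, LinearMap.add_apply, Module.End.one_apply,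
      A.bracket_add, A.add_bracket]
    abel
  have han : ∀ X, B.anchor X = A.anchor X + (A.deform N).anchor X := fun X =>
    map_add A.anchor X (N X)
  have hact : ∀ X a, τ.act X a = ρ.act X a + ρN.act X a := by
    intro X
    refine DFunLike.congr_fun (hq.unique (B.anchor X)
      (AddMonoidHom.mk' (τ.act X) (τ.act_add X))
      (AddMonoidHom.mk' (ρ.act X) (ρ.act_add X) + AddMonoidHom.mk' (ρN.act X) (ρN.act_add X))
      (fun f a => τ.act_smul X f a) (fun f a => ?_) (fun a b => ?_))
    · simp only [AddMonoidHom.add_apply, AddMonoidHom.mk'_apply, ρ.act_smul, ρN.act_smul, han,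
        Derivation.add_apply, add_smul, smul_add]
      abel
    · ext φ v
      have e1 := hτ X a b φ v
      have e2 := hρ X a b φ v
      have e3 := hρN X a b φ v
      have hl : ∀ θ, B.lieDual X θ = A.lieDual X θ + (A.deform N).lieDual X θ := by
        intro θ
        ext Y
        simp only [SkewAlgebroid.lieDual_apply, LinearMap.add_apply, hbr, han, map_add,
          Derivation.add_apply]
        ring
      simp only [densityAct, hl, han, add_lie, AlternatingMap.map_update_add,
        AlternatingMap.add_apply, Finset.sum_add_distrib, Derivation.add_apply] at e1 e2 e3
      simp only [AddMonoidHom.add_apply, AddMonoidHom.mk'_apply, map_add, LinearMap.add_apply,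
        AlternatingMap.add_apply]
      linear_combination e1 - e2 - e3
  have hd : ∀ w, dForm B.toSkewAlgebroid τ w =
      dForm A.toSkewAlgebroid ρ w + dForm (A.deform N) ρN w := by
    intro w
    rw [← sub_eq_zero]
    refine eq_zero_of_contr (fun w => dForm B.toSkewAlgebroid τ w -
      (dForm A.toSkewAlgebroid ρ w + dForm (A.deform N) ρN w)) (-1) (fun w => ?_)
      (fun v w => ?_) w
    · simp only [Pi.sub_apply, Pi.add_apply, dForm_zero, add_zero, sub_zero]
    · have hl := DerPair.lie_add_pair (repPair A.toSkewAlgebroid ρ v) (repPair (A.deform N) ρN v)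
        (repPair B.toSkewAlgebroid τ v) (hbr v) (hact v) w
      simp only [map_sub, map_add, contr_dForm, hl, neg_smul, one_smul]
      abel
  have h2 := dForm_dForm B τ w
  simp only [hd, map_add] at h2
  have hA := dForm_dForm A ρ w
  have hN2 : dForm (A.deform N) ρN (dForm (A.deform N) ρN w) = 0 :=
    dForm_dForm (A.deformLie N hN) ρN w
  rw [hA, hN2, zero_add, add_zero, add_comm] at h2
  rw [← h2, add_comm]

theorem IsDiv.anticomm (hE : LocallyFree pt E n) (hP : Separated pt P) (hPg : Glueable pt P)
    {q' : Spinor R E P n →ₗ[R] Spinor R E P n →ₗ[R] Density R E n m} (hq : IsRoot pt q')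
    {A : LieAlgebroid R E} {N : E →ₗ[R] E} (hN : A.IsNijenhuis N)
    {ρ : Representation A.toSkewAlgebroid (Spinor R E P n)}
    (hρ : IsRootOf A.toSkewAlgebroid q' ρ)
    {ρN : Representation (A.deform N) (Spinor R E P n)} (hρN : IsRootOf (A.deform N) q' ρN)
    {D D' : Forms R (Module.Dual R E) P →+ Forms R (Module.Dual R E) P}
    (hD : IsDiv A.toSkewAlgebroid ρ D) (hD' : IsDiv (A.deform N) ρN D')
    (w : Forms R (Module.Dual R E) P) : D (D' w) + D' (D w) = 0 := by
  apply starForm_injective hE hP hPg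
  rw [map_add, hD, hD', hD', hD, sgn_dForm, sgn_dForm, sgn_sgn, map_neg, map_neg, map_zero,
    ← neg_add, dForm_deform_anticomm hq (hPg.alt hP n) A hN ρ hρ ρN hρN, neg_zero]

/-- The component of degree `j` of the divergence. -/
def delOf (D : Forms R (Module.Dual R E) P →+ Forms R (Module.Dual R E) P) (j : ℕ) :
    Spinor R E P (j + 1) →+ Spinor R E P j :=
  AddMonoidHom.mk' (fun a => D (homog (j + 1) a) j) fun a b => by rw [homog_add, map_add]; rfl

theorem IsDiv.delOf_apply (hE : LocallyFree pt E n) (hP : Separated pt P)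
    {S : SkewAlgebroid R E} {ρ : Representation S (Spinor R E P n)}
    {D : Forms R (Module.Dual R E) P →+ Forms R (Module.Dual R E) P} (hD : IsDiv S ρ D)
    (w : Forms R (Module.Dual R E) P) (j : ℕ) : delOf D j (w (j + 1)) = D w j := by
  rw [← sub_eq_zero]
  show D (homog (j + 1) (w (j + 1))) j - D w j = 0
  rw [← Pi.sub_apply, ← map_sub]
  refine hD.apply_eq_zero hE hP ?_
  rw [Pi.sub_apply, homog_same, sub_self]

theorem IsDiv.delOf_spec {S : SkewAlgebroid R E} {ρ : Representation S (Spinor R E P n)}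
    {D : Forms R (Module.Dual R E) P →+ Forms R (Module.Dual R E) P} (hD : IsDiv S ρ D)
    (j k : ℕ) (h : (j + 1) + k = n) (h' : j + (k + 1) = n) (a : Spinor R E P (j + 1))
    (X : Fin (k + 1) → E) :
    diffFun S ρ (star h a) X = (-1 : ℤ) ^ k • star h' (delOf D j a) X := by
  have h1 := congrArg (fun u : Forms R E (Spinor R E P n) => u (k + 1) X) (hD (homog (j + 1) a))
  rw [← sgn_sgn (starForm n (D (homog (j + 1) a)))] at h1
  have h2 : starForm n (D (homog (j + 1) a)) (k + 1) X = star h' (delOf D j a) X :=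
    starForm_eq_star h' _ X
  have h3 : star h a = starForm n (homog (j + 1) a) k := by
    funext Y
    rw [starForm_eq_star h, homog_same]
  have h4 := congrArg (fun u : Forms R E (Spinor R E P n) => u (k + 1) X)
    (sgn_dForm S ρ (starForm n (homog (j + 1) a)))
  simp only [Pi.neg_apply, AlternatingMap.neg_apply] at h4
  rw [← hD, h2, sgn_apply, AlternatingMap.smul_apply, pow_succ, mul_neg_one, neg_smul,
    neg_inj] at h4
  rw [← h4, smul_smul, ← pow_add, Even.neg_one_pow ⟨k, rfl⟩, one_smul, dForm_succ, h3]
  rfl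

theorem DiracData.unique (hE : LocallyFree pt E n) (hP1 : LocallyFree pt P 1)
    {S : SkewAlgebroid R E} {T : SkewAlgebroid R (Module.Dual R E)}
    {q : P →ₗ[R] P →ₗ[R] Density R (Module.Dual R E) n m} (hq : IsRoot pt q)
    (D D' : DiracData S T q) : D = D' := by
  have hqq : D.q' = D'.q' := product_unique hE hq.sepR D.q'_spec D'.q'_spec
  have hroot := isRoot_product hE hP1 hq D.q'_spec
  have hr : D.repL' = D'.repL' := hroot.rep_unique S _ _ D.repL'_root (hqq ▸ D'.repL'_root)
  refine DiracData.ext (hq.rep_unique T _ _ D.repL_root D'.repL_root) hqq hr ?_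
  funext j
  ext1 a
  by_cases hj : j + 1 ≤ n
  · have h : (j + 1) + (n - (j + 1)) = n := by omega
    have h' : j + ((n - (j + 1)) + 1) = n := by omega
    refine star_ext hE hq.sepQ h' fun X => ?_
    have e := D.del_spec j _ h h' a X
    rw [hr, D'.del_spec j _ h h' a X] at e
    have e2 := congrArg (fun z => (-1 : ℤ) ^ (n - (j + 1)) • z) e
    simp only [smul_smul, ← pow_add] at e2
    rw [Even.neg_one_pow ⟨_, rfl⟩, one_smul, one_smul] at e2
    exact e2.symm
  -- Beyond degree n there are no multivectors, so the operator is determined there although its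
  -- specification says nothing.
  · rw [alt_eq_zero_of_lt hE.dual hq.sepQ (by omega) a, map_zero, map_zero]

/-- The theorem for modules of sections, described through the point evaluations `pt`. -/
theorem exists_diracData (hE : LocallyFree pt E n) (hEs : Separated pt E)
    (hRg : Glueable pt R) (hPg : Glueable pt P) (hP1 : LocallyFree pt P 1)
    {q : P →ₗ[R] P →ₗ[R] Density R (Module.Dual R E) n m} (hq : IsRoot pt q)
    {A : LieAlgebroid R E} {N : E →ₗ[R] E} {Λ : Bivector R E} (h : IsPoissonNijenhuis A N Λ)
    (l k : ℕ) :
    ∃ D : DiracData (A.deform (N ^ l)) (A.dual (Λ.iterate N h.sharp_comm k)) q,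
      (∀ D' : DiracData (A.deform (N ^ l)) (A.dual (Λ.iterate N h.sharp_comm k)) q, D' = D) ∧
      ∀ w, D.dirac (D.dirac w) = 0 := by
  have hP := hq.sepQ
  have hsep : ∀ X : E, (∀ γ : Module.Dual R E, γ X = 0) → X = 0 := fun X => hE.eq_zero hEs
  have hNl := h.nijenhuis.pow l
  obtain ⟨q', hq'⟩ := exists_product hE hq.sepR hRg q
  have hroot := isRoot_product hE hP1 hq hq'
  have hQg : Glueable pt (Spinor R E P n) := hPg.alt hP n
  obtain ⟨ρ, hρ⟩ := hroot.exists_rep hQg A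
  obtain ⟨ρN, hρN⟩ : ∃ ρN : Representation (A.deform (N ^ l)) (Spinor R E P n),
    IsRootOf (A.deform (N ^ l)) q' ρN := hroot.exists_rep hQg (A.deformLie (N ^ l) hNl)
  obtain ⟨σ, hσ⟩ : ∃ σ : Representation (A.dual (Λ.iterate N h.sharp_comm k)) P,
    IsRootOf _ q σ := hq.exists_rep hPg (A.dualLie _ (h.poisson_iterate hsep k) hsep)
  obtain ⟨σ', hσ'⟩ : ∃ σ' : Representation (A.dual (Λ.iterate N h.sharp_comm (k + l))) P,
    IsRootOf _ q σ' := hq.exists_rep hPg (A.dualLie _ (h.poisson_iterate hsep (k + l)) hsep)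
  obtain ⟨D, hD⟩ := exists_isDiv hE hP hPg A.toSkewAlgebroid ρ
  obtain ⟨B, hB⟩ := exists_isDiv hE hP hPg (A.deform (N ^ l)) ρN
  have hc1 : ∀ w, dForm _ σ w = _ := fun w =>
    dForm_dual_eq hE hP hPg hD hq hq' hρ (Λ.iterate N h.sharp_comm k) σ hσ w
  have hc2 : ∀ w, dForm _ σ' w = _ := fun w =>
    dForm_dual_eq hE hP hPg hD hq hq' hρ (Λ.iterate N h.sharp_comm (k + l)) σ' hσ' w
  have hc3 : ∀ w, dForm _ σ' w = bivOp (Λ.iterate N h.sharp_comm k) (B w) -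
      B (bivOp (Λ.iterate N h.sharp_comm k) w) := by
    -- Stated for an arbitrary equal structure `T`, so that the equality from `deform_dual` can be
    -- substituted although the type of σ' depends on it.
    have hgen : ∀ (T : SkewAlgebroid R (Module.Dual R E)) (σ : Representation T P),
        T = (A.deform (N ^ l)).dual (Λ.iterate N h.sharp_comm k) → IsRootOf T q σ → ∀ w,
        dForm T σ w = bivOp (Λ.iterate N h.sharp_comm k) (B w) -
          B (bivOp (Λ.iterate N h.sharp_comm k) w) := by
      rintro _ σ rfl hσ w
      exact dForm_dual_eq hE hP hPg hB hq hq' hρN _ σ hσ w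
    exact hgen _ σ' (h.deform_dual k l).symm hσ'
  have haa : ∀ w, dForm (A.dual (Λ.iterate N h.sharp_comm k)) σ
      (dForm (A.dual (Λ.iterate N h.sharp_comm k)) σ w) = 0 := fun w =>
    dForm_dForm (A.dualLie _ (h.poisson_iterate hsep k) hsep) σ w
  have hbb : ∀ w, B (B w) = 0 := fun w =>
    IsDiv.div_div (S := A.deformLie (N ^ l) hNl) hE hP hPg hB w
  have hDD : ∀ w, D (D w) = 0 := fun w => IsDiv.div_div hE hP hPg hD w
  have hDB : ∀ w, D (B w) = -B (D w) := fun w =>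
    eq_neg_of_add_eq_zero_left (IsDiv.anticomm hE hP hPg hroot hNl hρ hρN hD hB w)
  let Δ : DiracData (A.deform (N ^ l)) (A.dual (Λ.iterate N h.sharp_comm k)) q :=
    { repL := σ
      repL_root := hσ
      q' := q'
      q'_spec := hq'
      repL' := ρN
      repL'_root := hρN
      del := delOf B
      del_spec := hB.delOf_spec }
  refine ⟨Δ, fun D' => DiracData.unique hE hP1 hq D' Δ, fun w => ?_⟩
  have hdirac : ∀ w, Δ.dirac w = dForm (A.dual (Λ.iterate N h.sharp_comm k)) σ w + B w := by
    intro w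
    funext j
    cases j with
    | zero =>
      rw [Pi.add_apply, dForm_zero, zero_add]
      exact hB.delOf_apply hE hP w 0
    | succ j =>
      rw [Pi.add_apply, dForm_succ, ← hB.delOf_apply hE hP w (j + 1)]
      rfl
  -- Evaluate d_{k+l} D + D d_{k+l}: with d_{k+l} = [Λ_{k+l}, D] it is 0 as D² = 0, and with d_{k+l}
  -- = [Λ_k, B] and DB = -BD it is -(d_k B + B d_k).
  have hab : ∀ w, dForm (A.dual (Λ.iterate N h.sharp_comm k)) σ (B w) +
      B (dForm (A.dual (Λ.iterate N h.sharp_comm k)) σ w) = 0 := by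
    intro w
    have e1 := hc3 (D w)
    have e2 := congrArg D (hc3 w)
    rw [hc2] at e1 e2
    simp only [map_sub, hDD, map_zero, zero_sub, sub_zero, hDB] at e1 e2
    rw [hc1, hc1, map_sub, hDB, map_neg]
    rw [← neg_eq_zero]
    have e3 := congrArg₂ (· + ·) e1 e2
    simp only [neg_add_cancel] at e3
    rw [e3]
    abel
  rw [hdirac, hdirac, map_add, map_add, haa, hbb, zero_add, add_zero, hab]

end Main

/-! ### Smooth functions and sections: separation, gluing, frames -/

section Sections

variable {m : ℕ} {M : Type*} [TopologicalSpace M] [ChartedSpace (EuclideanSpace ℝ (Fin m)) M]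
  {F : Type*} [NormedAddCommGroup F] [NormedSpace ℝ F]
  {V : M → Type*} [∀ x, AddCommGroup (V x)] [∀ x, Module ℝ (V x)]
  [∀ x, TopologicalSpace (V x)] [TopologicalSpace (Bundle.TotalSpace F V)] [FiberBundle F V]
  [VectorBundle ℝ F V]

variable (m M) in
/-- Evaluation of smooth functions at a point. -/
def evalAt (x : M) : C^∞⟮𝓡 m, M; ℝ⟯ →+* ℝ := ContMDiffMap.evalRingHom x

@[simp] theorem evalAt_apply (x : M) (f : C^∞⟮𝓡 m, M; ℝ⟯) : evalAt m M x f = f x := rfl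

theorem separated_functions : Separated (evalAt m M) C^∞⟮𝓡 m, M; ℝ⟯ := by
  intro q hq
  ext x
  obtain ⟨χ, hχ, h⟩ := hq x
  have := congrArg (fun f : C^∞⟮𝓡 m, M; ℝ⟯ => f x) h
  exact (mul_eq_zero.1 this).resolve_left hχ

theorem separated_sections : Separated (evalAt m M) Cₛ^∞⟮𝓡 m; F, V⟯ := by
  intro q hq
  ext x
  obtain ⟨χ, hχ, h⟩ := hq x
  have := congrArg (fun f : Cₛ^∞⟮𝓡 m; F, V⟯ => f x) h
  exact (smul_eq_zero.1 this).resolve_left hχ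

/-- The glued value at z is taken from the fraction attached to z; near x it agrees with p x / χ x,
hence it is smooth. -/
theorem glueable_functions : Glueable (evalAt m M) C^∞⟮𝓡 m, M; ℝ⟯ := by
  intro χ p hχ hp
  have hp' : ∀ x y z, χ y z * p x z = χ x z * p y z := fun x y z =>
    congrArg (fun f : C^∞⟮𝓡 m, M; ℝ⟯ => f z) (hp x y)
  simp only [evalAt_apply] at hχ
  have key : ∀ x z, χ x z ≠ 0 → (χ z z)⁻¹ * p z z = (χ x z)⁻¹ * p x z := by
    intro x z h
    have := hp' x z z
    have := hχ z
    field_simp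
    linear_combination -hp' x z z
  refine ⟨⟨fun x => (χ x x)⁻¹ * p x x, fun x => ?_⟩, fun x => ?_⟩
  · have h1 : ContMDiffAt (𝓡 m) 𝓘(ℝ) ∞ (fun z => (χ x z)⁻¹ * p x z) x :=
      (((χ x).contMDiff x).inv₀ (hχ x)).mul ((p x).contMDiff x)
    refine h1.congr_of_eventuallyEq ?_
    filter_upwards [(χ x).contMDiff.continuous.continuousAt.eventually_ne (hχ x)] with z hz
    exact key x z hz
  · ext z
    show χ x z * ((χ z z)⁻¹ * p z z) = p x z
    have := hp' x z z
    have := hχ z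
    field_simp
    linear_combination -hp' x z z

theorem glueable_sections : Glueable (evalAt m M) Cₛ^∞⟮𝓡 m; F, V⟯ := by
  intro χ p hχ hp
  have hp' : ∀ x y z, χ y z • p x z = χ x z • p y z := fun x y z =>
    congrArg (fun f : Cₛ^∞⟮𝓡 m; F, V⟯ => f z) (hp x y)
  simp only [evalAt_apply] at hχ
  refine ⟨⟨fun x => (χ x x)⁻¹ • p x x, fun x => ?_⟩, fun x => ?_⟩
  · have h1 := (((χ x).contMDiff x).inv₀ (hχ x)).smul_section ((p x).contMDiff x)
    refine h1.congr_of_eventuallyEq ?_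
    filter_upwards [(χ x).contMDiff.continuous.continuousAt.eventually_ne (hχ x)] with z hz
    refine congrArg (Bundle.TotalSpace.mk' F z) ?_
    show (χ z z)⁻¹ • p z z = (χ x z)⁻¹ • p x z
    rw [inv_smul_eq_iff₀ (hχ z), smul_comm, hp', inv_smul_smul₀ hz]
  · ext z
    show χ x z • ((χ z z)⁻¹ • p z z) = p x z
    rw [smul_comm, ← hp', inv_smul_smul₀ (hχ z)]

theorem coe_section_sum {ι : Type*} (t : Finset ι) (s : ι → Cₛ^∞⟮𝓡 m; F, V⟯) (x : M) :
    (∑ i ∈ t, s i) x = ∑ i ∈ t, s i x :=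
  map_sum ((Pi.evalAddMonoidHom V x).comp (ContMDiffSection.coeAddHom (𝓡 m) F ∞ V)) s t

variable [IsManifold (𝓡 m) ∞ M] [T2Space M]

/-- A bump function at `x`, as a smooth function. -/
def bump {x : M} (ψ : SmoothBumpFunction (𝓡 m) x) : C^∞⟮𝓡 m, M; ℝ⟯ := ⟨ψ, ψ.contMDiff⟩

@[simp] theorem bump_apply {x : M} (ψ : SmoothBumpFunction (𝓡 m) x) (z : M) : bump ψ z = ψ z := rfl

theorem exists_bump {x : M} {U : Set M} (hU : U ∈ nhds x) :
    ∃ ψ : SmoothBumpFunction (𝓡 m) x, tsupport ψ ⊆ U := by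
  obtain ⟨ψ, -, h⟩ := (SmoothBumpFunction.nhds_basis_tsupport (I := 𝓡 m) x).mem_iff.1 hU
  exact ⟨ψ, h⟩

theorem contMDiff_mul_of_tsupport {x : M} (ψ : SmoothBumpFunction (𝓡 m) x) {U : Set M}
    (hU : IsOpen U) (hψ : tsupport ψ ⊆ U) {g : M → ℝ} (hg : ContMDiffOn (𝓡 m) 𝓘(ℝ) ∞ g U) :
    ContMDiff (𝓡 m) 𝓘(ℝ) ∞ (fun z => ψ z * g z) :=
  contMDiff_of_tsupport fun z hz =>
    have hz' : z ∈ U := hψ (tsupport_smul_subset_left ψ g hz)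
    ψ.contMDiffAt.mul (hg.contMDiffAt (hU.mem_nhds hz'))

variable [FiniteDimensional ℝ F] [ContMDiffVectorBundle ∞ F V (𝓡 m)]

theorem locallyFree_sections : LocallyFree (evalAt m M) Cₛ^∞⟮𝓡 m; F, V⟯ (Module.finrank ℝ F) := by
  intro x
  let e := trivializationAt F V x
  let b := Module.finBasis ℝ F
  obtain ⟨ψ, hψ⟩ := exists_bump (m := m)
    (e.open_baseSet.mem_nhds (FiberBundle.mem_baseSet_trivializationAt' x))
  have hmem : ∀ z, ψ z ≠ 0 → z ∈ e.baseSet := fun z hz => hψ (subset_tsupport _ hz)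
  have hcoord : ∀ (s : Cₛ^∞⟮𝓡 m; F, V⟯) i, ContMDiff (𝓡 m) 𝓘(ℝ) ∞
      (fun z => ψ z * e.localFrameCoeff (𝓡 m) b i z (s z)) := fun s i =>
    contMDiff_mul_of_tsupport ψ e.open_baseSet hψ
      (contMDiffOn_baseSet_localFrameCoeff b s.contMDiff.contMDiffOn i)
  -- The frame and its coordinates are each cut off by ψ to become global, hence χ = ψ².
  refine ⟨⟨bump ψ * bump ψ, fun i => ⟨(ψ : M → ℝ) • e.localFrame b i,
      ψ.contMDiff.contMDiffOn.smul_section_of_tsupport e.open_baseSet hψ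
        (e.contMDiffOn_localFrame_baseSet ∞ b i)⟩,
    fun i => ⟨⟨fun s => ⟨_, hcoord s i⟩, fun s t => ?_⟩, fun f s => ?_⟩, ?_, fun s => ?_,
    fun i j => ?_⟩⟩
  · ext z
    show ψ z * e.localFrameCoeff (𝓡 m) b i z (s z + t z) = ψ z * _ + ψ z * _
    rw [map_add, mul_add]
  · ext z
    show ψ z * e.localFrameCoeff (𝓡 m) b i z (f z • s z) = f z * (ψ z * _)
    rw [map_smul, smul_eq_mul]; ring
  · simp [evalAt_apply]
  · ext z
    simp only [coe_section_sum, section_smul_apply]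
    show (ψ z * ψ z) • s z = ∑ i, (ψ z * e.localFrameCoeff (𝓡 m) b i z (s z)) •
      (ψ z • e.localFrame b i z)
    by_cases hz : ψ z = 0
    · simp [hz]
    · conv_lhs => rw [e.eq_sum_localFrameCoeff_smul (I := 𝓡 m) (b := b) (s := s) (hmem z hz),
        Finset.smul_sum]
      refine Finset.sum_congr rfl fun i _ => ?_
      rw [smul_smul, smul_smul]; congr 1; ring
  · ext z
    show ψ z * e.localFrameCoeff (𝓡 m) b i z (ψ z • e.localFrame b j z) = _
    by_cases hz : ψ z = 0
    · split_ifs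
      · simp [hz]
      · simp [hz]
    · rw [map_smul, e.localFrameCoeff_apply_of_mem_baseSet b (hmem z hz),
        e.localFrame_apply_of_mem_baseSet b (hmem z hz), Module.Basis.repr_self,
        Finsupp.single_apply]
      simp only [eq_comm (a := j)]
      split_ifs <;> simp

end Sections

/-! ### Hadamard's lemma -/

section Hadamard

variable {H : Type*} [NormedAddCommGroup H] [NormedSpace ℝ H]

open MeasureTheory in
/-- Hadamard's lemma: `f p = f y + G(p) (p - y)` with `G` smooth and `G(y) = df(y)`. -/
theorem exists_hadamard {f : H → ℝ} (hf : ContDiff ℝ ∞ f) (y : H) :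
    ∃ G : H → H →L[ℝ] ℝ, ContDiff ℝ ∞ G ∧ G y = fderiv ℝ f y ∧
      ∀ p, f p = f y + G p (p - y) := by
  have hdf : ContDiff ℝ ∞ (fderiv ℝ f) := hf.fderiv_right (by simp)
  -- G(p) is the integral of df(y + t(p - y)) over [0, 1], written as a convolution at 0 so that
  -- smooth dependence on parameters applies. Convolution evaluates g at -t, whence the sign; β is 1
  -- on [-1, 0] and gives compact support.
  let β : ContDiffBump (0 : ℝ) := ⟨2, 3, by norm_num, by norm_num⟩
  let g : H → ℝ → H →L[ℝ] ℝ := fun p s => β s • fderiv ℝ f (y + (-s) • (p - y))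
  let k : ℝ → ℝ := Set.indicator (Set.Ioc 0 1) 1
  have hk : LocallyIntegrable k volume :=
    ((integrable_indicator_iff measurableSet_Ioc).2
      (integrableOn_const (by simp) (by simp))).locallyIntegrable
  have hg : ContDiff ℝ ∞ (Function.uncurry g) := by
    refine (β.contDiff.comp contDiff_snd).smul (hdf.comp ?_)
    exact contDiff_const.add (contDiff_snd.neg.smul (contDiff_fst.sub contDiff_const))
  have hconv := contDiffOn_convolution_right_with_param (μ := volume) (f := k) (n := ⊤)
    (ContinuousLinearMap.lsmul ℝ ℝ : ℝ →L[ℝ] (H →L[ℝ] ℝ) →L[ℝ] _) (g := g) isOpen_univ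
    (isCompact_closedBall (0 : ℝ) 3)
    (fun p s _ hs => by
      have : β s = 0 := β.zero_of_le_dist (by simpa using (le_of_lt (by simpa using hs)))
      simp [g, this]) hk hg.contDiffOn
  have hG : ∀ p, convolution k (g p) (ContinuousLinearMap.lsmul ℝ ℝ) volume 0 =
      ∫ t in (0 : ℝ)..1, fderiv ℝ f (y + t • (p - y)) := by
    intro p
    rw [intervalIntegral.integral_of_le zero_le_one, ← integral_indicator measurableSet_Ioc]
    refine integral_congr_ae (Filter.Eventually.of_forall fun t => ?_)
    by_cases ht : t ∈ Set.Ioc (0 : ℝ) 1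
    · have : β (-t) = 1 := β.one_of_mem_closedBall (by
        simp only [Metric.mem_closedBall, dist_zero_right, norm_neg, Real.norm_eq_abs]
        rw [abs_of_pos ht.1]; exact ht.2.trans (by norm_num [β]))
      simp [k, g, ht, this]
    · simp [k, ht]
  refine ⟨fun p => ∫ t in (0 : ℝ)..1, fderiv ℝ f (y + t • (p - y)), ?_, by simp, fun p => ?_⟩
  · simp only [← hG]
    rw [Set.univ_prod_univ, contDiffOn_univ] at hconv
    have h2 : ContDiff ℝ ∞ (fun p : H => (p, (0 : ℝ))) := contDiff_id.prodMk contDiff_const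
    have h3 := ContDiff.comp hconv h2
    exact h3
  · have hcont : Continuous fun t : ℝ => fderiv ℝ f (y + t • (p - y)) :=
      hdf.continuous.comp (by fun_prop)
    have hd : ∀ t ∈ Set.uIcc (0 : ℝ) 1, HasDerivAt (fun t : ℝ => f (y + t • (p - y)))
        (fderiv ℝ f (y + t • (p - y)) (p - y)) t := by
      intro t _
      have h1 : HasDerivAt (fun t : ℝ => y + t • (p - y)) (p - y) t := by
        simpa using ((hasDerivAt_id t).smul_const (p - y)).const_add y
      exact ((hf.differentiable (by simp)).differentiableAt.hasFDerivAt).comp_hasDerivAt t h1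
    have hFTC := intervalIntegral.integral_eq_sub_of_hasDerivAt hd
      ((hcont.clm_apply continuous_const).intervalIntegrable _ _)
    rw [ContinuousLinearMap.intervalIntegral_apply (hcont.intervalIntegrable _ _), hFTC]
    simp

end Hadamard

/-! ### Derivations of smooth functions in local coordinates -/

section Derivations

variable {m : ℕ} {M : Type*} [TopologicalSpace M] [ChartedSpace (EuclideanSpace ℝ (Fin m)) M]
  [IsManifold (𝓡 m) ∞ M] [T2Space M]

/-- Derivations are local: with ψ(y) = 1 and ψf = 0, the Leibniz rule at y leaves Df(y) = 0. -/
theorem derivation_apply_eq_zero (D : Derivation ℝ C^∞⟮𝓡 m, M; ℝ⟯ C^∞⟮𝓡 m, M; ℝ⟯)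
    {f : C^∞⟮𝓡 m, M; ℝ⟯} {y : M} (hf : ∀ᶠ z in nhds y, f z = 0) : D f y = 0 := by
  obtain ⟨ψ, hψ⟩ := exists_bump (m := m) hf
  have h0 : bump ψ * f = 0 := by
    ext z
    show ψ z * f z = 0
    by_cases hz : ψ z = 0
    · simp [hz]
    · rw [show f z = 0 from hψ (subset_tsupport _ hz), mul_zero]
  have h1 : D (bump ψ * f) y = 0 := by rw [h0, map_zero]; rfl
  rw [D.leibniz] at h1
  have h2 : ψ y * D f y + f y * D (bump ψ) y = 0 := h1
  rwa [hf.self_of_nhds, ψ.eq_one, one_mul, zero_mul, add_zero] at h2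

/-- The `i`-th coordinate function at `x`, cut off by `ψ`. -/
def coordFun {x : M} (ψ : SmoothBumpFunction (𝓡 m) x) (i : Fin m) : C^∞⟮𝓡 m, M; ℝ⟯ :=
  ⟨fun z => ψ z * extChartAt (𝓡 m) x z i, contMDiff_mul_of_tsupport ψ (chartAt _ x).open_source
    ψ.tsupport_subset_chartAt_source
    ((EuclideanSpace.proj (𝕜 := ℝ) i).contMDiff.comp_contMDiffOn contMDiffOn_extChartAt)⟩

/-- The function `f` in the chart at `x`. -/
def inChart (x : M) (f : C^∞⟮𝓡 m, M; ℝ⟯) : EuclideanSpace ℝ (Fin m) → ℝ :=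
  f ∘ (extChartAt (𝓡 m) x).symm

theorem contDiffOn_inChart (x : M) (f : C^∞⟮𝓡 m, M; ℝ⟯) :
    ContDiffOn ℝ ∞ (inChart x f) (extChartAt (𝓡 m) x).target :=
  (f.contMDiff.comp_contMDiffOn (contMDiffOn_extChartAt_symm x)).contDiffOn

theorem contDiffAt_inChart {x z : M} (hz : z ∈ (chartAt (EuclideanSpace ℝ (Fin m)) x).source)
    (f : C^∞⟮𝓡 m, M; ℝ⟯) : ContDiffAt ℝ ∞ (inChart x f) (extChartAt (𝓡 m) x z) :=
  (contDiffOn_inChart x f).contDiffAt ((isOpen_extChartAt_target x).mem_nhds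
    ((extChartAt (𝓡 m) x).map_source (by simpa using hz)))

theorem inChart_apply {x z : M} (hz : z ∈ (chartAt (EuclideanSpace ℝ (Fin m)) x).source)
    (f : C^∞⟮𝓡 m, M; ℝ⟯) : inChart x f (extChartAt (𝓡 m) x z) = f z :=
  congrArg f ((extChartAt (𝓡 m) x).left_inv (by simpa using hz))

/-- The `i`-th partial derivative in the chart at `x`. -/
def partialAt (x : M) (i : Fin m) (f : C^∞⟮𝓡 m, M; ℝ⟯) (z : M) : ℝ :=
  fderiv ℝ (inChart x f) (extChartAt (𝓡 m) x z) (EuclideanSpace.single i 1)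

theorem contMDiffOn_partialAt (x : M) (i : Fin m) (f : C^∞⟮𝓡 m, M; ℝ⟯) :
    ContMDiffOn (𝓡 m) 𝓘(ℝ) ∞ (partialAt x i f)
      (chartAt (EuclideanSpace ℝ (Fin m)) x).source := by
  have h1 : ContDiffOn ℝ ∞ (fun p => fderiv ℝ (inChart x f) p (EuclideanSpace.single i 1))
      (extChartAt (𝓡 m) x).target :=
    ((contDiffOn_inChart x f).fderiv_of_isOpen (isOpen_extChartAt_target x) (by simp)).clm_apply
      contDiffOn_const
  exact h1.contMDiffOn.comp contMDiffOn_extChartAt fun z hz =>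
    (extChartAt (𝓡 m) x).map_source (by simpa using hz)

theorem partialAt_add {x z : M} (hz : z ∈ (chartAt (EuclideanSpace ℝ (Fin m)) x).source)
    (i : Fin m) (f g : C^∞⟮𝓡 m, M; ℝ⟯) :
    partialAt x i (f + g) z = partialAt x i f z + partialAt x i g z := by
  have h : inChart x (f + g) = inChart x f + inChart x g := rfl
  rw [partialAt, h, fderiv_add ((contDiffAt_inChart hz f).differentiableAt (by simp))
    ((contDiffAt_inChart hz g).differentiableAt (by simp))]
  rfl

theorem partialAt_mul {x z : M} (hz : z ∈ (chartAt (EuclideanSpace ℝ (Fin m)) x).source)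
    (i : Fin m) (f g : C^∞⟮𝓡 m, M; ℝ⟯) :
    partialAt x i (f * g) z = f z * partialAt x i g z + g z * partialAt x i f z := by
  have h : inChart x (f * g) = inChart x f * inChart x g := rfl
  rw [partialAt, h, fderiv_mul ((contDiffAt_inChart hz f).differentiableAt (by simp))
    ((contDiffAt_inChart hz g).differentiableAt (by simp)), inChart_apply hz, inChart_apply hz]
  rfl

theorem partialAt_smul (x z : M) (i : Fin m) (c : ℝ) (f : C^∞⟮𝓡 m, M; ℝ⟯) :
    partialAt x i (c • f) z = c * partialAt x i f z := by
  have h : inChart x (c • f) = c • inChart x f := rfl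
  rw [partialAt, h, fderiv_const_smul_field]
  rfl

theorem partialAt_coordFun {x z : M} (hz : z ∈ (chartAt (EuclideanSpace ℝ (Fin m)) x).source)
    {ψ : SmoothBumpFunction (𝓡 m) x} (hψ : ∀ᶠ w in nhds z, ψ w = 1) (i j : Fin m) :
    partialAt x j (coordFun ψ i) z = if i = j then 1 else 0 := by
  have h : inChart x (coordFun ψ i) =ᶠ[nhds (extChartAt (𝓡 m) x z)]
      EuclideanSpace.proj (𝕜 := ℝ) i := by
    have hz' : z ∈ (extChartAt (𝓡 m) x).source := by simpa using hz
    have hc := continuousAt_extChartAt_symm' (I := 𝓡 m) hz'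
    rw [ContinuousAt, (extChartAt (𝓡 m) x).left_inv hz'] at hc
    filter_upwards [hc.eventually hψ, (isOpen_extChartAt_target x).mem_nhds
      ((extChartAt (𝓡 m) x).map_source hz')] with p hp hp'
    show ψ _ * extChartAt (𝓡 m) x ((extChartAt (𝓡 m) x).symm p) i = p i
    rw [hp, one_mul, (extChartAt (𝓡 m) x).right_inv hp']
  rw [partialAt, h.fderiv_eq, ContinuousLinearMap.fderiv]
  simp

/-- The vector field `ψ ∂/∂xᵢ` for a bump function `ψ` at `x`. -/
def coordField {x : M} (ψ : SmoothBumpFunction (𝓡 m) x) (i : Fin m) :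
    Derivation ℝ C^∞⟮𝓡 m, M; ℝ⟯ C^∞⟮𝓡 m, M; ℝ⟯ :=
  have hmem : ∀ z, ψ z ≠ 0 → z ∈ (chartAt (EuclideanSpace ℝ (Fin m)) x).source := fun z hz =>
    ψ.support_subset_source hz
  Derivation.mk'
    { toFun := fun f => ⟨fun z => ψ z * partialAt x i f z, contMDiff_mul_of_tsupport ψ
        (chartAt _ x).open_source ψ.tsupport_subset_chartAt_source (contMDiffOn_partialAt x i f)⟩
      map_add' := fun f g => by
        ext z
        show ψ z * partialAt x i (f + g) z = ψ z * _ + ψ z * _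
        by_cases hz : ψ z = 0
        · simp [hz]
        · rw [partialAt_add (hmem z hz), mul_add]
      map_smul' := fun c f => by
        ext z
        show ψ z * partialAt x i (c • f) z = c * (ψ z * _)
        rw [partialAt_smul]; ring }
    fun f g => by
      ext z
      show ψ z * partialAt x i (f * g) z = f z * (ψ z * _) + g z * (ψ z * _)
      by_cases hz : ψ z = 0
      · simp [hz]
      · rw [partialAt_mul (hmem z hz)]; ring

/-- A derivation in local coordinates. -/
theorem derivation_apply_eq_sum (D : Derivation ℝ C^∞⟮𝓡 m, M; ℝ⟯ C^∞⟮𝓡 m, M; ℝ⟯) {x y : M}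
    (hy : y ∈ (chartAt (EuclideanSpace ℝ (Fin m)) x).source)
    {η : SmoothBumpFunction (𝓡 m) x} (hη : ∀ᶠ w in nhds y, η w = 1) (f : C^∞⟮𝓡 m, M; ℝ⟯) :
    D f y = ∑ i, D (coordFun η i) y * partialAt x i f y := by
  set φ := extChartAt (𝓡 m) x with hφ
  have hηφ : ∀ z ∈ (chartAt (EuclideanSpace ℝ (Fin m)) x).source, η.toContDiffBump (φ z) = η z :=
    fun z hz => (η.eqOn_source hz).symm
  have hη1 : η y = 1 := hη.self_of_nhds
  let g : EuclideanSpace ℝ (Fin m) → ℝ := fun p => η.toContDiffBump p * inChart x f p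
  have hg : ContDiff ℝ ∞ g := by
    refine (contMDiff_of_tsupport fun p hp => ?_ : ContMDiff (𝓡 m) 𝓘(ℝ) ∞ g).contDiff
    have hp' := tsupport_smul_subset_left η.toContDiffBump (inChart x f) hp
    rw [η.toContDiffBump.tsupport_eq] at hp'
    have hp'' : p ∈ φ.target := η.closedBall_subset ⟨hp', by simp⟩
    exact (η.toContDiffBump.contDiffAt.mul ((contDiffOn_inChart x f).contDiffAt
      ((isOpen_extChartAt_target x).mem_nhds hp''))).contMDiffAt
  have hgφ : ∀ z ∈ (chartAt (EuclideanSpace ℝ (Fin m)) x).source, g (φ z) = η z * f z := by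
    intro z hz
    show η.toContDiffBump (φ z) * inChart x f (φ z) = _
    rw [hηφ z hz, inChart_apply hz]
  have hdg : fderiv ℝ g (φ y) = fderiv ℝ (inChart x f) (φ y) := by
    apply Filter.EventuallyEq.fderiv_eq
    have hy' : y ∈ φ.source := by simpa [hφ] using hy
    have hc := continuousAt_extChartAt_symm' (I := 𝓡 m) hy'
    rw [ContinuousAt, φ.left_inv hy'] at hc
    filter_upwards [hc.eventually hη, (isOpen_extChartAt_target x).mem_nhds
      (φ.map_source hy')] with p hp hp'
    have h1 := hηφ (φ.symm p) (by simpa [hφ] using φ.map_target hp')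
    rw [φ.right_inv hp', hp] at h1
    show η.toContDiffBump p * inChart x f p = _
    rw [h1, one_mul]
  obtain ⟨G, hG, hGy, hGp⟩ := exists_hadamard hg (φ y)
  let u : Fin m → C^∞⟮𝓡 m, M; ℝ⟯ := fun i =>
    ⟨fun z => η z * G (φ z) (EuclideanSpace.single i 1), contMDiff_mul_of_tsupport η
      (chartAt _ x).open_source η.tsupport_subset_chartAt_source
      ((hG.clm_apply contDiff_const).contMDiff.comp_contMDiffOn contMDiffOn_extChartAt)⟩
  have hexp : ∀ (ℓ : EuclideanSpace ℝ (Fin m) →L[ℝ] ℝ) v,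
      ℓ v = ∑ i, v i * ℓ (EuclideanSpace.single i 1) := by
    intro ℓ v
    conv_lhs => rw [← (EuclideanSpace.basisFun (Fin m) ℝ).sum_repr v]
    simp [map_sum]
  have hev : ∀ (w : Fin m → C^∞⟮𝓡 m, M; ℝ⟯) z, (∑ i, w i) z = ∑ i, w i z := fun w z =>
    map_sum (evalAt m M z) w _
  -- Hadamard's formula for ηf in the chart, times η²: one factor makes the coefficients of G
  -- global, the other the coordinates. Applying D at y then kills all but the first-order terms,
  -- since η is 1 near y.
  have hid : bump η * (bump η * (bump η * f)) =
      f y • (bump η * bump η) + ∑ i, u i * (coordFun η i - φ y i • bump η) := by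
    ext z
    have : (f y • (bump η * bump η) + ∑ i, u i * (coordFun η i - φ y i • bump η)) z =
        f y * (η z * η z) + ∑ i, (η z * G (φ z) (EuclideanSpace.single i 1)) *
          (η z * φ z i - φ y i * η z) := by
      show f y * (η z * η z) + (∑ i, u i * (coordFun η i - φ y i • bump η)) z = _
      rw [hev]; rfl
    rw [this]
    show η z * (η z * (η z * f z)) = _
    by_cases hz : η z = 0
    · simp [hz]
    · have hz' := η.support_subset_source hz
      rw [← hgφ z hz', hGp, hgφ y hy, hη1, hexp, one_mul, mul_add, mul_add, Finset.mul_sum,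
        Finset.mul_sum]
      congr 1
      · ring
      · refine Finset.sum_congr rfl fun i _ => ?_
        rw [PiLp.sub_apply]; ring
  have hmul : ∀ a b : C^∞⟮𝓡 m, M; ℝ⟯, D (a * b) y = a y * D b y + b y * D a y := by
    intro a b; rw [D.leibniz]; rfl
  have hDη : D (bump η) y = 0 := by
    have h1 : D (bump η - 1) y = 0 := derivation_apply_eq_zero D (by
      filter_upwards [hη] with z hz
      show η z - 1 = 0
      rw [hz, sub_self])
    rwa [map_sub, D.map_one_eq_zero, sub_zero] at h1
  have hsm : ∀ (c : ℝ) (a : C^∞⟮𝓡 m, M; ℝ⟯), D (c • a) = c • D a := fun c a => D.map_smul c a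
  have hmain := congrArg (fun a => D a y) hid
  have hr : D (f y • (bump η * bump η) + ∑ i, u i * (coordFun η i - φ y i • bump η)) y =
      f y * D (bump η * bump η) y + ∑ i, D (u i * (coordFun η i - φ y i • bump η)) y := by
    rw [map_add, hsm, map_sum, ← hev]; rfl
  have hs : ∀ i, D (coordFun η i - φ y i • bump η) y =
      D (coordFun η i) y - φ y i * D (bump η) y := by
    intro i; rw [map_sub, hsm]; rfl
  simp only [hr, hmul, hs, hDη, bump_apply, hη1] at hmain
  simp only [one_mul, mul_zero, add_zero, zero_add, sub_zero] at hmain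
  rw [hmain]
  refine Finset.sum_congr rfl fun i _ => ?_
  have e1 : u i y = partialAt x i f y := by
    show η y * G (φ y) _ = fderiv ℝ _ _ _
    rw [hη1, one_mul, hGy, hdg]
  have e2 : (coordFun η i - φ y i • bump η) y = 0 := by
    show η y * φ y i - φ y i * η y = 0
    ring
  rw [e1, e2, zero_mul, add_zero, mul_comm]

theorem locallyFree_derivations :
    LocallyFree (evalAt m M) (Derivation ℝ C^∞⟮𝓡 m, M; ℝ⟯ C^∞⟮𝓡 m, M; ℝ⟯) m := by
  intro x
  obtain ⟨η⟩ : Nonempty (SmoothBumpFunction (𝓡 m) x) := inferInstance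
  -- The support of ψ lies where η is locally 1, so there the cut-off coordinates are genuine
  -- coordinates and dual to the fields ψ ∂/∂xᵢ.
  obtain ⟨ψ, hψ⟩ := exists_bump (m := m) (eventually_eventually_nhds.2 η.eventuallyEq_one)
  have hη : ∀ z, ψ z ≠ 0 → ∀ᶠ w in nhds z, η w = 1 := fun z hz => hψ (subset_tsupport _ hz)
  have hmem : ∀ z, ψ z ≠ 0 → z ∈ (chartAt (EuclideanSpace ℝ (Fin m)) x).source := fun z hz =>
    ψ.support_subset_source hz
  refine ⟨⟨bump ψ * bump ψ, coordField ψ,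
    fun i => ⟨⟨fun D => bump ψ * D (coordFun η i), fun D D' => ?_⟩, fun f D => ?_⟩, ?_,
    fun D => ?_, fun i j => ?_⟩⟩
  · simp [mul_add]
  · simp [mul_left_comm]
  · simp [evalAt_apply]
  · ext f z
    have hs : (∑ i, (bump ψ * D (coordFun η i)) • coordField ψ i) f z =
        ∑ i, (ψ z * D (coordFun η i) z) * (ψ z * partialAt x i f z) := by
      have h1 := map_sum (Derivation.coeFnAddMonoidHom (R := ℝ) (A := C^∞⟮𝓡 m, M; ℝ⟯)
        (M := C^∞⟮𝓡 m, M; ℝ⟯)) (fun i => (bump ψ * D (coordFun η i)) • coordField ψ i)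
        Finset.univ
      have h2 := congrFun h1 f
      rw [Finset.sum_apply] at h2
      exact (congrArg (evalAt m M z) h2).trans (map_sum (evalAt m M z) _ _)
    refine Eq.trans ?_ hs.symm
    show (ψ z * ψ z) * D f z = _
    by_cases hz : ψ z = 0
    · simp [hz]
    · rw [derivation_apply_eq_sum D (hmem z hz) (hη z hz), Finset.mul_sum]
      exact Finset.sum_congr rfl fun i _ => by ring
  · ext z
    show ψ z * (ψ z * partialAt x j (coordFun η i) z) = _
    by_cases hz : ψ z = 0
    · split_ifs
      · simp [hz]
      · simp [hz]
    · rw [partialAt_coordFun (hmem z hz) (hη z hz)]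
      split_ifs <;> simp

end Derivations

/-! ### Line bundles and square roots of densities on a manifold -/

section Root

variable {m : ℕ} {M : Type*} [TopologicalSpace M] [ChartedSpace (EuclideanSpace ℝ (Fin m)) M]
  [IsManifold (𝓡 m) ∞ M] [T2Space M]
  {L : M → Type*} [∀ x, AddCommGroup (L x)] [∀ x, Module ℝ (L x)]
  [∀ x, TopologicalSpace (L x)] [TopologicalSpace (Bundle.TotalSpace ℝ L)] [FiberBundle ℝ L]
  [VectorBundle ℝ ℝ L] [ContMDiffVectorBundle ∞ ℝ L (𝓡 m)]

theorem locallyFree_line : LocallyFree (evalAt m M) Cₛ^∞⟮𝓡 m; ℝ, L⟯ 1 := by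
  have h := locallyFree_sections (m := m) (F := ℝ) (V := L)
  rwa [Module.finrank_self] at h

theorem exists_section_ne_zero (x : M) : ∃ l : Cₛ^∞⟮𝓡 m; ℝ, L⟯, l x ≠ 0 := by
  let e := trivializationAt ℝ L x
  have hx : x ∈ e.baseSet := FiberBundle.mem_baseSet_trivializationAt' x
  let b := Module.Basis.singleton Unit ℝ
  obtain ⟨ψ, hψ⟩ := exists_bump (m := m) (e.open_baseSet.mem_nhds hx)
  refine ⟨⟨(ψ : M → ℝ) • e.localFrame b (),
      ψ.contMDiff.contMDiffOn.smul_section_of_tsupport e.open_baseSet hψ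
        (e.contMDiffOn_localFrame_baseSet ∞ b ())⟩, ?_⟩
  show ψ x • e.localFrame b () x ≠ 0
  rw [ψ.eq_one, one_smul, e.localFrame_apply_of_mem_baseSet b hx]
  exact (e.basisAt b hx).ne_zero ()

theorem IsSquareRoot.isRoot {E : Type*} [AddCommGroup E] [Module C^∞⟮𝓡 m, M; ℝ⟯ E] {n : ℕ}
    (hE : LocallyFree (evalAt m M) E n)
    {q : Cₛ^∞⟮𝓡 m; ℝ, L⟯ →ₗ[C^∞⟮𝓡 m, M; ℝ⟯] Cₛ^∞⟮𝓡 m; ℝ, L⟯ →ₗ[C^∞⟮𝓡 m, M; ℝ⟯]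
      Density C^∞⟮𝓡 m, M; ℝ⟯ E n m} (hq : IsSquareRoot q) : IsRoot (evalAt m M) q where
  sepR := separated_functions
  sepQ := separated_sections
  line := locallyFree_line.isLine separated_sections
  free := hE.dual
  freeDer := locallyFree_derivations
  nondeg x := by
    obtain ⟨l, hl⟩ := exists_section_ne_zero (m := m) (L := L) x
    obtain ⟨φ, v, h⟩ := hq l x hl
    exact ⟨l, φ, v, h⟩

end Root

end PNDirac

end

/-! ### The theorem for bundles -/

theorem mainTheorem9 {m : ℕ} {M : Type*} [TopologicalSpace M]
    [ChartedSpace (EuclideanSpace ℝ (Fin m)) M] [IsManifold (𝓡 m) ∞ M]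
    [T2Space M] [SecondCountableTopology M]
    -- the vector bundle `A`, of rank `n = dim F`
    {F : Type*} [NormedAddCommGroup F] [NormedSpace ℝ F] [FiniteDimensional ℝ F]
    {A : M → Type*} [∀ x, AddCommGroup (A x)] [∀ x, Module ℝ (A x)]
    [∀ x, TopologicalSpace (A x)] [TopologicalSpace (Bundle.TotalSpace F A)] [FiberBundle F A]
    [VectorBundle ℝ F A] [ContMDiffVectorBundle ∞ F A (𝓡 m)]
    -- the line bundle `L`
    {L : M → Type*} [∀ x, AddCommGroup (L x)] [∀ x, Module ℝ (L x)]
    [∀ x, TopologicalSpace (L x)] [TopologicalSpace (Bundle.TotalSpace ℝ L)] [FiberBundle ℝ L]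
    [VectorBundle ℝ ℝ L] [ContMDiffVectorBundle ∞ ℝ L (𝓡 m)]
    -- the Poisson–Nijenhuis structure
    (𝒜 : PNDirac.LieAlgebroid C^∞⟮𝓡 m, M; ℝ⟯ Cₛ^∞⟮𝓡 m; F, A⟯)
    (N : Cₛ^∞⟮𝓡 m; F, A⟯ →ₗ[C^∞⟮𝓡 m, M; ℝ⟯] Cₛ^∞⟮𝓡 m; F, A⟯)
    (Λ : PNDirac.Bivector C^∞⟮𝓡 m, M; ℝ⟯ Cₛ^∞⟮𝓡 m; F, A⟯)
    (hPN : PNDirac.IsPoissonNijenhuis 𝒜 N Λ)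
    -- `L` is a square root of `∧ⁿ A* ⊗ ∧ᵐ T*M`
    (q : Cₛ^∞⟮𝓡 m; ℝ, L⟯ →ₗ[C^∞⟮𝓡 m, M; ℝ⟯] Cₛ^∞⟮𝓡 m; ℝ, L⟯ →ₗ[C^∞⟮𝓡 m, M; ℝ⟯]
      PNDirac.Density C^∞⟮𝓡 m, M; ℝ⟯ (Module.Dual C^∞⟮𝓡 m, M; ℝ⟯ Cₛ^∞⟮𝓡 m; F, A⟯)
        (Module.finrank ℝ F) m)
    (hq : PNDirac.IsSquareRoot q) (l k : ℕ) :
    ∃ D : PNDirac.DiracData (𝒜.deform (N ^ l)) (𝒜.dual (Λ.iterate N hPN.sharp_comm k)) q,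
      (∀ D' : PNDirac.DiracData (𝒜.deform (N ^ l))
        (𝒜.dual (Λ.iterate N hPN.sharp_comm k)) q, D' = D) ∧
      ∀ w, D.dirac (D.dirac w) = 0 := by
  have hE := PNDirac.locallyFree_sections (m := m) (F := F) (V := A)
  exact PNDirac.exists_diracData hE PNDirac.separated_sections PNDirac.glueable_functions
    PNDirac.glueable_sections PNDirac.locallyFree_line (hq.isRoot hE.dual) hPN l k
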